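/- Let $n\ge 2$, $0\le m\le n$, let $\Pi=\{(x,t):0<x<1,\ t\in\mathbb R\}$, and let $BC^1(\Pi)$ be the space of bounded continuous functions on $\overline\Pi$ whose first order partial derivatives are also bounded and continuous on $\overline\Pi$. Consider the system $$\partial_t u_j+a_j(x,t)\,\partial_x u_j+\sum_{k=1}^n b_{jk}(x,t)\,u_k=0,\qquad j\le n,\ 0<x<1,\ t>\tau, \tag{1}$$ with the boundary conditions $$u_j(x_j,t)=(Pu)_j(t):=\sum_{k=1}^m p_{jk}u_k(1,t)+\sum_{k=m+1}^n p_{jk}u_k(0,t),\qquad j\le n, \tag{2}$$ where $x_j=0$ for $j\le m$, $x_j=1$ for $j>m$, and the $p_{jk}$ are real constants, and with the initial condition $u(\cdot,\tau)=\varphi$. Assume: * $a_j,\,b_{jk}\in BC^1(\Pi)$ for all $j,k\le n$, and for some $\Lambda_0>0$ we have $a_j\ge\Lambda_0$ on $\overline\Pi$ for $j\le m$ and $a_j\le-\Lambda_0$ on $\overline\Pi$ for $j>m$; * there is $k\in\mathbb N$ with $(CP)^k u\equiv0$ for all $u\in C(\overline\Pi)^n$, where $(Cv)_j(x,t)=c_j(x_j,x,t)\,v_j(\omega_j(x_j,x,t))$,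 the characteristic $\omega_j(\cdot,x,t):[0,1]\to\mathbb R$ solves $\partial_\xi\omega_j(\xi,x,t)=1/a_j(\xi,\omega_j(\xi,x,t))$, $\omega_j(x,x,t)=t$, and $c_j(\xi,x,t)=\exp\int_x^\xi (b_{jj}/a_j)(\eta,\omega_j(\eta,x,t))\,d\eta$; * for all $j\ne k$ there is $\beta_{jk}\in BC^1(\Pi)$ with $b_{jk}=\beta_{jk}(a_k-a_j)$. An evolution family $\{U(t,\tau)\}_{t\ge\tau}$ on $L^2(0,1)^n$ (bounded linear operators with $U(\tau,\tau)=I$, $U(t,s)U(s,\tau)=U(t,\tau)$ for $t\ge s\ge\tau$, strongly continuous in $(t,\tau)$ for $t\ge\tau$) is said to be generated by (1), (2) if, for all $\tau\in\mathbb R$ and $\varphi\in L^2(0,1)^n$, $t\mapsto U(t,\tau)\varphi$ is the $L^2$-generalized solution with initial value $\varphi$: whenever $\varphi^l\in C_0^\infty(0,1)^n$ and $\varphi^l\to\varphi$ in $L^2(0,1)^n$, there are classical (i.e. $C^1$ on $[0,1]\times[\tau,\infty)$) solutions $u^l$ with initial values $\varphi^l$, and $u^l(\cdot,t)\to U(t,\tau)\varphi$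 in $L^2(0,1)^n$ uniformly in $t\in[\tau,\theta]$, for every $\theta>\tau$. Let $$Y_0=\Big\{v\in C([0,1])^n:\ v_j(x_j)=\sum_{k=1}^m p_{jk}v_k(1)+\sum_{k=m+1}^n p_{jk}v_k(0),\ j\le n\Big\}$$ with the maximum norm. Then (1), (2) generates an evolution family $\{U(t,\tau)\}_{t\ge\tau}$ on $L^2(0,1)^n$, and this family is smoothing from $L^2(0,1)^n$ to $Y_0$: there is $T_0>0$ such that $U(t,\tau)$ is a bounded linear operator from $L^2(0,1)^n$ into $Y_0$ for all $\tau\in\mathbb R$ and $t\ge\tau+T_0$. Moreover, for every $\alpha>0$ there is $K>0$ such that $$\sup_{\tau+T_0\le t\le\tau+T_0+\alpha}\|U(t,\tau)\varphi\|_{C([0,1])^n}\le K\|\varphi\|_{L^2(0,1)^n}\qquad\text{for all }\tau\in\mathbb R,\ \varphi\in L^2(0,1)^n.$$ -/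

import Mathlib

open Set Filter Topology MeasureTheory
open scoped ContDiff unitInterval

/-- The closed strip `{(x, t) : 0 ≤ x ≤ 1, t ∈ ℝ}`. -/
def closedStrip : Set (ℝ × ℝ) := Icc (0 : ℝ) 1 ×ˢ univ

/-- `f` is bounded and continuously differentiable on the closed strip, with bounded first order
derivatives. Only the values of `f` on the closed strip matter; `∂ₓf` and `∂ₜf` are the two
components of the derivative within the strip. -/
def IsBC1 (f : ℝ × ℝ → ℝ) : Prop :=
  ContDiffOn ℝ 1 f closedStrip ∧
    ∃ M : ℝ, ∀ q ∈ closedStrip, |f q| ≤ M ∧ ‖fderivWithin ℝ f closedStrip q‖ ≤ M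

/-- The data of the problem
`∂ₜu + a(x,t) ∂ₓu + b(x,t) u = 0` with `a = diag (a₁, …, aₙ)` and reflection boundary conditions
with coefficients `p`. Indices start at `0`, so the first `m` indices are those with `j < m`. -/
structure HyperbolicProblem (n : ℕ) where
  m : ℕ
  a : Fin n → ℝ × ℝ → ℝ
  b : Fin n → Fin n → ℝ × ℝ → ℝ
  p : Fin n → Fin n → ℝ

namespace HyperbolicProblem

variable {n : ℕ} (S : HyperbolicProblem n)

/-- The endpoint at which a boundary value is prescribed for the `j`-th component:
`0` for the first `m` indices, `1` for the others. -/
noncomputable def inPt (j : Fin n) : I := if (j : ℕ) < S.m then 0 else 1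

/-- The endpoint at which the `j`-th component enters the reflection boundary conditions:
`1` for the first `m` indices, `0` for the others. -/
noncomputable def outPt (j : Fin n) : I := if (j : ℕ) < S.m then 1 else 0

/-- The reflection operator
`(Pu)_j(t) = ∑_{k ≤ m} p_{jk} u_k(1,t) + ∑_{k > m} p_{jk} u_k(0,t)`. -/
noncomputable def P (u : Fin n → ℝ × ℝ → ℝ) (j : Fin n) (t : ℝ) : ℝ :=
  ∑ k, S.p j k * u k ((S.outPt k : ℝ), t)

/-- The speeds are bounded away from zero: the first `m` are positive, the others negative. -/
def NonDegenerate : Prop :=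
  ∃ Λ : ℝ, 0 < Λ ∧ ∀ j : Fin n, ∀ q ∈ closedStrip,
    ((j : ℕ) < S.m → Λ ≤ S.a j q) ∧ (S.m ≤ (j : ℕ) → S.a j q ≤ -Λ)

/-- `y : [0,1] → ℝ` solves `y' = 1 / a_j(ξ, y)`, `y(x) = t`. -/
def IsCharacteristic (j : Fin n) (x t : ℝ) (y : ℝ → ℝ) : Prop :=
  y x = t ∧ ∀ ξ ∈ Icc (0 : ℝ) 1, HasDerivWithinAt y (1 / S.a j (ξ, y ξ)) (Icc 0 1) ξ

open Classical in
/-- The `j`-th characteristic `ξ ↦ ω_j(ξ, x, t)` through `(x, t)`. For nondegenerate `C¹` speeds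
and `x ∈ [0,1]` the characteristic exists and is unique on `[0,1]`. -/
noncomputable def omega (j : Fin n) (ξ x t : ℝ) : ℝ :=
  if h : ∃ y, S.IsCharacteristic j x t y then h.choose ξ else t

/-- `c_j(ξ, x, t) = exp ∫_x^ξ (b_{jj} / a_j)(η, ω_j(η, x, t)) dη`. -/
noncomputable def c (j : Fin n) (ξ x t : ℝ) : ℝ :=
  Real.exp (∫ η in x..ξ, S.b j j (η, S.omega j η x t) / S.a j (η, S.omega j η x t))

/-- `(Cv)_j(x,t) = c_j(x_j, x, t) v_j(ω_j(x_j, x, t))`, where `x_j` is `inPt j`. -/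
noncomputable def C (v : Fin n → ℝ → ℝ) (j : Fin n) (q : ℝ × ℝ) : ℝ :=
  S.c j (S.inPt j) q.1 q.2 * v j (S.omega j (S.inPt j) q.1 q.2)

/-- There is `k` such that `(CP)^k u ≡ 0` on the closed strip for every continuous `u`. -/
def CPNilpotent : Prop :=
  ∃ k : ℕ, ∀ u : Fin n → ℝ × ℝ → ℝ, (∀ j, ContinuousOn (u j) closedStrip) →
    ∀ j, ∀ q ∈ closedStrip, ((fun w => S.C (S.P w))^[k] u) j q = 0

/-- `b_{jk} = β_{jk} (a_k - a_j)` on the closed strip for `j ≠ k`, with `β_{jk}` in `BC¹`. -/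
def LevyCondition : Prop :=
  ∀ j k : Fin n, j ≠ k → ∃ β : ℝ × ℝ → ℝ, IsBC1 β ∧
    ∀ q ∈ closedStrip, S.b j k q = β q * (S.a k q - S.a j q)

/-- `u` is a classical (`C¹` on the closed half-strip) solution with initial value `φ` at time
`τ`. -/
structure IsClassicalSolution (τ : ℝ) (φ : Fin n → ℝ → ℝ) (u : Fin n → ℝ × ℝ → ℝ) : Prop where
  contDiffOn : ∀ j, ContDiffOn ℝ 1 (u j) (Icc (0 : ℝ) 1 ×ˢ Ici τ)
  equation : ∀ j, ∀ x ∈ Ioo (0 : ℝ) 1, ∀ t, τ < t →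
    deriv (fun s => u j (x, s)) t + S.a j (x, t) * deriv (fun y => u j (y, t)) x
      + ∑ k, S.b j k (x, t) * u k (x, t) = 0
  initial : ∀ j, ∀ x ∈ Icc (0 : ℝ) 1, u j (x, τ) = φ j x
  boundary : ∀ j, ∀ t, τ ≤ t → u j ((S.inPt j : ℝ), t) = S.P u j t

end HyperbolicProblem

/-- `L²(0,1)ⁿ` with the maximum of the component norms. The measure is Lebesgue measure on
`[0,1]`, the endpoints being negligible. -/
abbrev L2n (n : ℕ) : Type := Fin n → Lp ℝ 2 (volume : Measure I)

/-- `φ ∈ C₀^∞(0,1)ⁿ`. -/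
def IsTestFunction {n : ℕ} (φ : Fin n → ℝ → ℝ) : Prop :=
  ∀ j, ContDiff ℝ ∞ (φ j) ∧ HasCompactSupport (φ j) ∧ tsupport (φ j) ⊆ Ioo 0 1

/-- A two-parameter family `{U(t,τ)}_{t ≥ τ}` of bounded operators is an evolution family. The
values `U t τ` with `t < τ` play no role. -/
structure IsEvolutionFamily {X : Type*} [NormedAddCommGroup X] [NormedSpace ℝ X]
    (U : ℝ → ℝ → X →L[ℝ] X) : Prop where
  refl : ∀ τ, U τ τ = ContinuousLinearMap.id ℝ X
  comp : ∀ τ s t, τ ≤ s → s ≤ t → (U t s).comp (U s τ) = U t τ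
  strongly_continuous : ∀ v : X, ContinuousOn (fun q : ℝ × ℝ => U q.1 q.2 v) {q | q.2 ≤ q.1}

/-- `V(t,τ)` maps `Z` boundedly into `Y` whenever `t ≥ τ + T`, where `Y` is embedded into `Z`
by `ι`. -/
def IsSmoothingAfter {Y Z : Type*} [NormedAddCommGroup Y] [NormedSpace ℝ Y]
    [NormedAddCommGroup Z] [NormedSpace ℝ Z] (ι : Y →L[ℝ] Z) (V : ℝ → ℝ → Z →L[ℝ] Z)
    (T : ℝ) : Prop :=
  0 < T ∧ ∀ τ t, τ + T ≤ t → ∃ W : Z →L[ℝ] Y, ι.comp W = V t τ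

namespace HyperbolicProblem

variable {n : ℕ} (S : HyperbolicProblem n)

/-- `w : [τ,∞) → L²(0,1)ⁿ` is the `L²`-generalized solution with initial value `φ` at time `τ`:
it is continuous and, for an arbitrary sequence of test functions `φˡ → φ` in `L²`, there are
classical solutions `uˡ` with initial values `φˡ`, and they converge to `w` in `L²`
uniformly on each `[τ, T]`. -/
def IsL2GeneralizedSolution (τ : ℝ) (φ : L2n n) (w : ℝ → L2n n) : Prop :=
  ContinuousOn w (Ici τ) ∧
  ∀ φl : ℕ → Fin n → ℝ → ℝ, (∀ l, IsTestFunction (φl l)) →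
    (∀ j, Tendsto (fun l => eLpNorm (fun x : I => φ j x - φl l j x) 2 volume) atTop (𝓝 0)) →
    ∃ ul : ℕ → Fin n → ℝ × ℝ → ℝ, (∀ l, S.IsClassicalSolution τ (φl l) (ul l)) ∧
      ∀ T > τ, ∀ ε > 0, ∀ᶠ l in atTop, ∀ t ∈ Icc τ T, ∀ j,
        eLpNorm (fun x : I => w t j x - ul l j ((x : ℝ), t)) 2 volume ≤ ENNReal.ofReal ε

/-- `U` is an evolution family on `L²(0,1)ⁿ` generated by the problem: it maps an initial function
`φ` at time `τ` into the value at time `t` of the `L²`-generalized solution. -/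
def Generates (U : ℝ → ℝ → L2n n →L[ℝ] L2n n) : Prop :=
  IsEvolutionFamily U ∧ ∀ τ φ, S.IsL2GeneralizedSolution τ φ (fun t => U t τ φ)

/-- The subspace `Y₀` of `C([0,1])ⁿ` (with the maximum norm) of the functions that satisfy the
zero order compatibility conditions. -/
def Y0 : Submodule ℝ (Fin n → C(I, ℝ)) where
  carrier := {v | ∀ j, v j (S.inPt j) = ∑ k, S.p j k * v k (S.outPt k)}
  add_mem' := by
    intro v w hv hw j
    simp only [Pi.add_apply, ContinuousMap.add_apply, mul_add, Finset.sum_add_distrib]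
    rw [hv j, hw j]
  zero_mem' := by
    intro j
    simp
  smul_mem' := by
    intro r v hv j
    simp only [Pi.smul_apply, ContinuousMap.smul_apply, smul_eq_mul]
    rw [hv j, Finset.mul_sum]
    exact Finset.sum_congr rfl fun k _ => by ring

/-- The embedding of `Y₀` into `L²(0,1)ⁿ`: each component is sent to its class. -/
noncomputable def Y0.toL2 : S.Y0 →L[ℝ] L2n n :=
  ContinuousLinearMap.pi fun j =>
    (ContinuousMap.toLp 2 (volume : Measure I) ℝ).comp
      ((ContinuousLinearMap.proj j).comp S.Y0.subtypeL)

end HyperbolicProblem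

/-! Existence of the evolution family. Dividing the `j`-th equation by `a_j` makes `x` the evolution
variable, and a solution is a fixed point of the map that takes boundary values at `x_j` from the
reflections and integrates along characteristics from there. In the weight `exp (λ (t - τ) - μ |x -
x_j|)` a large `μ` makes the reflections small, and then a large `λ` makes the coupling small, so a
Neumann series converges together with its time derivative (`CharSystem.exists_fixed_point`,
`CharSystem.exists_solution`). Test functions satisfy every compatibility condition, so they launch
classical solutions (`CoeffBounds.exists_classicalSolution`). A weighted energy estimate, uniform in
`τ` (`CoeffBounds.exists_energy_estimate`), extends the solution map from this dense set to `L²`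
(`CoeffBounds.exists_isPropagator`, `IsPropagator.generates`).

Smoothing. Integrating the `j`-th equation along its characteristic expresses `u_j - (CPu)_j` by
integrals of `b_jk u_k / a_j`, `k ≠ j`. The condition on `b_jk` gives `b_jk / a_j = β_jk a_k (1/a_j
- 1/a_k)`, a factor that vanishes where the `j`-th and `k`-th characteristics are tangent. Now
`(1/a_j - 1/a_k) ∂ₜu_k` is the difference of the derivatives of `u_k` along the two families, and
the derivative along the `k`-th one is of order zero by the equation. The divergence theorem on the
region swept by translating the curve back in time therefore bounds the integral by `L¹` norms of
`u` on segments `x = const` (`IsNearSolution.abs_integral_curve_le`), and such traces are bounded by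
the energy (`IsNearSolution.trace_le`). Hence `u - CPu` is bounded pointwise by the `L²` norm of the
initial value (`CoeffBounds.exists_abs_sub_CP_le`).

Since `CP` looks back and forth in time by at most `1/Λ` and `(CP)^k = 0`, telescoping turns this
into a bound for `u` itself after a fixed waiting time (`CoeffBounds.abs_le_of_iterate`,
`CoeffBounds.exists_sup_estimate`). Applied to differences of classical solutions, the bound makes
approximating sequences Cauchy in the complete space `Y₀`, and their limit is `U(t,τ)φ`
(`HyperbolicProblem.Generates.exists_Y0`). No constant depends on `τ`, which gives the uniformity.
-/

/-! ### Functions with a continuous time derivative. -/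

/-- `f` is continuous on the plane and has the continuous partial derivative `f'` in the second
variable. -/
structure TimeC1 (f f' : ℝ × ℝ → ℝ) : Prop where
  cont : Continuous f
  cont' : Continuous f'
  hasDeriv : ∀ x t, HasDerivAt (fun s => f (x, s)) (f' (x, t)) t

namespace TimeC1

variable {f f' g g' : ℝ × ℝ → ℝ}

/-- Hadamard's form of the increment: the slope is an integral of `f'`, hence continuous in all
parameters, also where `a = b`. -/
lemma sub_eq (h : TimeC1 f f') (x a b : ℝ) :
    f (x, b) - f (x, a) = (b - a) * ∫ s in (0 : ℝ)..1, f' (x, a + s * (b - a)) := by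
  have hc : Continuous fun s : ℝ => (b - a) * f' (x, a + s * (b - a)) := by
    have := h.cont'; fun_prop
  have h1 : ∀ s ∈ uIcc (0 : ℝ) 1, HasDerivAt (fun s => f (x, a + s * (b - a)))
      ((b - a) * f' (x, a + s * (b - a))) s := by
    intro s _
    have h2 : HasDerivAt (fun s : ℝ => a + s * (b - a)) (b - a) s := by
      simpa using ((hasDerivAt_id s).mul_const (b - a)).const_add a
    exact ((h.hasDeriv x (a + s * (b - a))).comp s h2).congr_deriv (mul_comm _ _)
  have := intervalIntegral.integral_eq_sub_of_hasDerivAt h1 (hc.intervalIntegrable _ _)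
  rw [← intervalIntegral.integral_const_mul, this]
  simp

lemma abs_sub_le (h : TimeC1 f f') {x a b K : ℝ} (hK : ∀ s ∈ uIcc a b, |f' (x, s)| ≤ K) :
    |f (x, b) - f (x, a)| ≤ K * |b - a| := by
  have := Convex.norm_image_sub_le_of_norm_hasDerivWithin_le (f := fun s => f (x, s))
    (f' := fun s => f' (x, s)) (C := K) (s := uIcc a b) (x := a) (y := b)
    (fun s _ => (h.hasDeriv x s).hasDerivWithinAt) (fun s hs => by simpa using hK s hs)
    (convex_uIcc a b) left_mem_uIcc right_mem_uIcc
  simpa using this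

lemma add (hf : TimeC1 f f') (hg : TimeC1 g g') :
    TimeC1 (fun q => f q + g q) (fun q => f' q + g' q) :=
  ⟨hf.cont.add hg.cont, hf.cont'.add hg.cont', fun x t => (hf.hasDeriv x t).add (hg.hasDeriv x t)⟩

lemma neg (hf : TimeC1 f f') : TimeC1 (fun q => -f q) (fun q => -f' q) :=
  ⟨hf.cont.neg, hf.cont'.neg, fun x t => (hf.hasDeriv x t).neg⟩

lemma mul (hf : TimeC1 f f') (hg : TimeC1 g g') :
    TimeC1 (fun q => f q * g q) (fun q => f' q * g q + f q * g' q) :=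
  ⟨hf.cont.mul hg.cont, (hf.cont'.mul hg.cont).add (hf.cont.mul hg.cont'),
    fun x t => (hf.hasDeriv x t).mul (hg.hasDeriv x t)⟩

lemma inv (hf : TimeC1 f f') (h0 : ∀ q, f q ≠ 0) :
    TimeC1 (fun q => (f q)⁻¹) (fun q => -f' q / f q ^ 2) :=
  ⟨hf.cont.inv₀ h0, hf.cont'.neg.div (hf.cont.pow 2) fun q => pow_ne_zero 2 (h0 q),
    fun x t => (hf.hasDeriv x t).inv (h0 _)⟩

lemma const_mul (hf : TimeC1 f f') (r : ℝ) : TimeC1 (fun q => r * f q) (fun q => r * f' q) :=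
  ⟨hf.cont.const_mul r, hf.cont'.const_mul r, fun x t => (hf.hasDeriv x t).const_mul r⟩

lemma sum {ι : Type*} {s : Finset ι} {F F' : ι → ℝ × ℝ → ℝ} (h : ∀ i, TimeC1 (F i) (F' i)) :
    TimeC1 (fun q => ∑ i ∈ s, F i q) (fun q => ∑ i ∈ s, F' i q) :=
  ⟨continuous_finsetSum _ fun i _ => (h i).cont, continuous_finsetSum _ fun i _ => (h i).cont',
    fun x t => HasDerivAt.fun_sum fun i _ => (h i).hasDeriv x t⟩

lemma of_space {k : ℝ → ℝ} (hk : Continuous k) : TimeC1 (fun q => k q.1) (fun _ => 0) :=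
  ⟨hk.comp continuous_fst, continuous_const, fun x t => hasDerivAt_const t (k x)⟩

lemma of_time {k k' : ℝ → ℝ} (hk' : Continuous k') (hk : ∀ t, HasDerivAt k (k' t) t) :
    TimeC1 (fun q => k q.2) (fun q => k' q.2) :=
  ⟨(continuous_iff_continuousAt.2 fun t => (hk t).continuousAt).comp continuous_snd,
    hk'.comp continuous_snd, fun _ t => hk t⟩

lemma comp_fst (hf : TimeC1 f f') {ρ : ℝ → ℝ} (hρ : Continuous ρ) :
    TimeC1 (fun q => f (ρ q.1, q.2)) (fun q => f' (ρ q.1, q.2)) :=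
  ⟨hf.cont.comp (by fun_prop), hf.cont'.comp (by fun_prop), fun x t => hf.hasDeriv (ρ x) t⟩

end TimeC1

/-! ### Characteristic flows and integrals along characteristics. -/

/-- A real function with bounded slope field has a global integral curve through each point. -/
lemma exists_global_integral_curve {α : ℝ × ℝ → ℝ} (hα : Continuous α) {M : ℝ}
    (hM : ∀ q, |α q| ≤ M) {K : NNReal} (hK : ∀ x, LipschitzWith K fun s => α (x, s)) (x t : ℝ) :
    ∃ y : ℝ → ℝ, y x = t ∧ ∀ ξ, HasDerivAt y (α (ξ, y ξ)) ξ := by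
  have hM0 : 0 ≤ M := (abs_nonneg _).trans (hM (0, 0))
  have key : ∀ N : ℕ, ∃ y : ℝ → ℝ, y x = t ∧ ∀ ξ ∈ Ioo (x - (N + 1)) (x + (N + 1)),
      HasDerivAt y (α (ξ, y ξ)) ξ := by
    intro N
    have hx : x ∈ Icc (x - ((N : ℝ) + 1)) (x + (N + 1)) := by
      constructor <;> linarith [(N.cast_nonneg : (0 : ℝ) ≤ N)]
    -- The slope bound `M` holds on the whole plane, so a ball of radius `M * (N + 1)` is large
    -- enough for the full interval of half-length `N + 1`.
    have hP : IsPicardLindelof (fun ξ s => α (ξ, s)) (⟨x, hx⟩ : Icc (x - ((N : ℝ) + 1)) (x + (N + 1)))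
        t (⟨M * (N + 1), by positivity⟩ : NNReal) 0 ⟨M, hM0⟩ K := by
      refine ⟨fun ξ _ => (hK ξ).lipschitzOnWith, fun s _ => ?_, fun ξ _ s _ => ?_, ?_⟩
      · exact (hα.comp (by fun_prop : Continuous fun ξ : ℝ => (ξ, s))).continuousOn
      · exact hM (ξ, s)
      · show M * max (x + ((N : ℝ) + 1) - x) (x - (x - ((N : ℝ) + 1))) ≤ M * (N + 1) - 0
        simp
    obtain ⟨y, hy, hy'⟩ := hP.exists_eq_forall_mem_Icc_hasDerivWithinAt₀
    exact ⟨y, hy, fun ξ hξ => (hy' ξ (Ioo_subset_Icc_self hξ)).hasDerivAt (Icc_mem_nhds hξ.1 hξ.2)⟩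
  choose Y hY0 hY using key
  have agree : ∀ N N' : ℕ, N ≤ N' → ∀ ξ ∈ Ioo (x - ((N : ℝ) + 1)) (x + (N + 1)),
      Y N ξ = Y N' ξ := by
    intro N N' hN
    have hN' : (N : ℝ) ≤ N' := by exact_mod_cast hN
    refine ODE_solution_unique_of_mem_Ioo (v := fun ξ s => α (ξ, s)) (s := fun _ => univ) (K := K)
      (t₀ := x) (fun ξ _ => (hK ξ).lipschitzOnWith) ?_ (fun ξ hξ => ⟨hY N ξ hξ, trivial⟩)
      (fun ξ hξ => ⟨hY N' ξ ⟨by linarith [hξ.1], by linarith [hξ.2]⟩, trivial⟩)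
      ((hY0 N).trans (hY0 N').symm)
    constructor <;> linarith [(N.cast_nonneg : (0 : ℝ) ≤ N)]
  have hmem : ∀ ξ : ℝ, ∀ N : ℕ, |ξ - x| < N + 1 → ξ ∈ Ioo (x - ((N : ℝ) + 1)) (x + (N + 1)) := by
    intro ξ N h
    rw [abs_lt] at h
    constructor <;> linarith [h.1, h.2]
  -- The point `ξ` is served by the solution with index `⌈|ξ - x|⌉₊`; near `ξ₀` all these agree with
  -- the one of index `N₀ + 1`, by uniqueness.
  refine ⟨fun ξ => Y ⌈|ξ - x|⌉₊ ξ, by simp [hY0], fun ξ₀ => ?_⟩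
  set N₀ := ⌈|ξ₀ - x|⌉₊ with hN₀
  have hle : |ξ₀ - x| ≤ N₀ := Nat.le_ceil _
  have hev : (fun ξ => Y ⌈|ξ - x|⌉₊ ξ) =ᶠ[𝓝 ξ₀] Y (N₀ + 1) := by
    have : ∀ᶠ ξ in 𝓝 ξ₀, |ξ - x| < N₀ + 1 :=
      (by fun_prop : Continuous fun ξ : ℝ => |ξ - x|).continuousAt.eventually
        (gt_mem_nhds (by linarith))
    filter_upwards [this] with ξ hξ
    refine agree _ _ (Nat.ceil_le.2 ?_) ξ (hmem _ _ ?_)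
    · push_cast; exact hξ.le
    · linarith [Nat.le_ceil |ξ - x|]
  have hval : Y N₀ ξ₀ = Y (N₀ + 1) ξ₀ := hev.self_of_nhds
  show HasDerivAt _ (α (ξ₀, Y N₀ ξ₀)) ξ₀
  rw [hval]
  refine (hY (N₀ + 1) ξ₀ (hmem _ _ ?_)).congr_of_eventuallyEq hev
  push_cast; linarith

/-- `Ω ξ x t` is the value at `ξ` of the solution of `y' = α (ξ, y)`, `y x = t`, and `Ω'` is its
derivative in `t`. -/
structure IsFlow (α : ℝ × ℝ → ℝ) (K : ℝ) (Ω Ω' : ℝ → ℝ → ℝ → ℝ) : Prop where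
  self : ∀ x t, Ω x x t = t
  deriv : ∀ ξ x t, HasDerivAt (fun η => Ω η x t) (α (ξ, Ω ξ x t)) ξ
  comp : ∀ ξ η x t, Ω ξ η (Ω η x t) = Ω ξ x t
  cont : Continuous fun q : ℝ × ℝ × ℝ => Ω q.1 q.2.1 q.2.2
  cont' : Continuous fun q : ℝ × ℝ × ℝ => Ω' q.1 q.2.1 q.2.2
  hasDeriv : ∀ ξ x t, HasDerivAt (fun s => Ω ξ x s) (Ω' ξ x t) t
  abs_le : ∀ ξ x t, |Ω' ξ x t| ≤ Real.exp (K * |ξ - x|)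

lemma abs_intervalIntegral_le {f : ℝ → ℝ} {a b K : ℝ} (h : ∀ s ∈ uIcc a b, |f s| ≤ K) :
    |∫ s in a..b, f s| ≤ K * |b - a| := by
  exact intervalIntegral.norm_integral_le_of_norm_le_const (f := f) (C := K)
    fun s hs => h s (uIoc_subset_uIcc hs)

/-- The difference of two solutions satisfies a linear equation whose coefficient is the mean of
`α'` between them, so it is an explicit exponential times the initial difference. This gives at once
the Lipschitz bound and, when the two solutions merge, the derivative `Ω' = exp ∫ α'`. -/
lemma exists_isFlow {α α' : ℝ × ℝ → ℝ} (hα : TimeC1 α α') {M K : ℝ}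
    (hM : ∀ q, |α q| ≤ M) (hK : ∀ q, |α' q| ≤ K) : ∃ Ω Ω', IsFlow α K Ω Ω' := by
  have hK0 : 0 ≤ K := (abs_nonneg _).trans (hK (0, 0))
  have hlip : ∀ x, LipschitzWith ⟨K, hK0⟩ fun s => α (x, s) := fun x =>
    LipschitzWith.of_dist_le_mul fun a b => by
      rw [Real.dist_eq, Real.dist_eq]
      exact hα.abs_sub_le fun s _ => hK _
  choose y hy0 hy using exists_global_integral_curve hα.cont hM hlip
  have huniq : ∀ y₁ y₂ : ℝ → ℝ, (∀ ξ, HasDerivAt y₁ (α (ξ, y₁ ξ)) ξ) →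
      (∀ ξ, HasDerivAt y₂ (α (ξ, y₂ ξ)) ξ) → ∀ x, y₁ x = y₂ x → y₁ = y₂ := fun y₁ y₂ h₁ h₂ x hx =>
    ODE_solution_unique_univ (v := fun ξ s => α (ξ, s)) (s := fun _ => univ) (K := ⟨K, hK0⟩)
      (fun ξ => (hlip ξ).lipschitzOnWith) (fun ξ => ⟨h₁ ξ, trivial⟩) (fun ξ => ⟨h₂ ξ, trivial⟩) hx
  have hyc : ∀ x t, Continuous (y x t) := fun x t =>
    continuous_iff_continuousAt.2 fun ξ => (hy x t ξ).continuousAt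
  have hcomp : ∀ ξ η x t, y η (y x t η) ξ = y x t ξ := fun ξ η x t =>
    congrFun (huniq _ _ (hy _ _) (hy _ _) η (hy0 _ _)) ξ
  let A : ℝ → ℝ → ℝ → ℝ → ℝ := fun x t₀ t₁ η =>
    ∫ s in (0 : ℝ)..1, α' (η, y x t₀ η + s * (y x t₁ η - y x t₀ η))
  have hAb : ∀ x t₀ t₁ η, |A x t₀ t₁ η| ≤ K := fun x t₀ t₁ η => by
    simpa using abs_intervalIntegral_le (a := 0) (b := 1)
      (f := fun s => α' (η, y x t₀ η + s * (y x t₁ η - y x t₀ η))) (fun s _ => hK _)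
  have hAc : ∀ x t₀ t₁, Continuous (A x t₀ t₁) := fun x t₀ t₁ => by
    refine intervalIntegral.continuous_parametric_intervalIntegral_of_continuous' ?_ 0 1
    have := hα.cont'; have := hyc x t₀; have := hyc x t₁
    fun_prop
  -- The integrating factor `exp (-∫ A)` makes the difference of the two solutions constant in `ξ`.
  have hdiff : ∀ x t₀ t₁ ξ, y x t₁ ξ - y x t₀ ξ =
      (t₁ - t₀) * Real.exp (∫ η in x..ξ, A x t₀ t₁ η) := by
    intro x t₀ t₁ ξ
    have hI : ∀ ξ, HasDerivAt (fun ξ => ∫ η in x..ξ, A x t₀ t₁ η) (A x t₀ t₁ ξ) ξ := fun ξ =>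
      intervalIntegral.integral_hasDerivAt_right ((hAc x t₀ t₁).intervalIntegrable _ _)
        ((hAc x t₀ t₁).stronglyMeasurableAtFilter _ _) (hAc x t₀ t₁).continuousAt
    have hz : ∀ ξ, HasDerivAt (fun ξ => (y x t₁ ξ - y x t₀ ξ) *
        Real.exp (-∫ η in x..ξ, A x t₀ t₁ η)) 0 ξ := by
      intro ξ
      have h1 := ((hy x t₁ ξ).sub (hy x t₀ ξ)).mul (hI ξ).neg.exp
      refine h1.congr_deriv ?_
      rw [hα.sub_eq ξ (y x t₀ ξ) (y x t₁ ξ)]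
      simp only [Pi.sub_apply, A]
      ring
    have hconst := is_const_of_deriv_eq_zero (fun ξ => (hz ξ).differentiableAt)
      (fun ξ => (hz ξ).deriv) ξ x
    simp only [hy0, intervalIntegral.integral_same, neg_zero, Real.exp_zero, mul_one] at hconst
    rw [← hconst, mul_assoc, ← Real.exp_add]
    simp
  have hEb : ∀ x t₀ t₁ ξ, Real.exp (∫ η in x..ξ, A x t₀ t₁ η) ≤ Real.exp (K * |ξ - x|) :=
    fun x t₀ t₁ ξ => Real.exp_le_exp.2
      ((le_abs_self _).trans (abs_intervalIntegral_le fun s _ => hAb x t₀ t₁ s))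
  have hlipt : ∀ x t₀ t₁ ξ, |y x t₁ ξ - y x t₀ ξ| ≤ Real.exp (K * |ξ - x|) * |t₁ - t₀| := by
    intro x t₀ t₁ ξ
    rw [hdiff, abs_mul, Real.abs_exp, mul_comm]
    exact mul_le_mul_of_nonneg_right (hEb _ _ _ _) (abs_nonneg _)
  have hlipξ : ∀ x t ξ ξ', |y x t ξ - y x t ξ'| ≤ M * |ξ - ξ'| := by
    intro x t ξ ξ'
    have := Convex.norm_image_sub_le_of_norm_hasDerivWithin_le (f := y x t) (s := univ)
      (C := M) (fun s _ => (hy x t s).hasDerivWithinAt) (fun s _ => hM _) convex_univ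
      (mem_univ ξ') (mem_univ ξ)
    simpa using this
  -- By the group property the curve through `(x₀, t₀)` is also the curve through `(x, y x₀ t₀ x)`,
  -- so two curves with different base points can be compared by their values over the same `x`.
  have hcont : Continuous fun q : ℝ × ℝ × ℝ => y q.2.1 q.2.2 q.1 := by
    rw [continuous_iff_continuousAt]
    rintro ⟨ξ₀, x₀, t₀⟩
    rw [ContinuousAt, tendsto_iff_dist_tendsto_zero]
    refine squeeze_zero (fun _ => dist_nonneg) (g := fun q : ℝ × ℝ × ℝ => M * |q.1 - ξ₀| +
      Real.exp (K * |ξ₀ - q.2.1|) * (|q.2.2 - t₀| + M * |q.2.1 - x₀|)) ?_ ?_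
    · rintro ⟨ξ, x, t⟩
      simp only [Real.dist_eq]
      have h1 := hlipξ x t ξ ξ₀
      have h2 := hlipt x (y x₀ t₀ x) t ξ₀
      rw [hcomp] at h2
      have h3 := hlipξ x₀ t₀ x x₀
      rw [hy0] at h3
      have h4 : |t - y x₀ t₀ x| ≤ |t - t₀| + M * |x - x₀| := by
        calc |t - y x₀ t₀ x| = |(t - t₀) - (y x₀ t₀ x - t₀)| := by ring_nf
          _ ≤ |t - t₀| + |y x₀ t₀ x - t₀| := abs_sub _ _
          _ ≤ _ := by linarith
      calc |y x t ξ - y x₀ t₀ ξ₀| ≤ |y x t ξ - y x t ξ₀| + |y x t ξ₀ - y x₀ t₀ ξ₀| :=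
            abs_sub_le _ _ _
        _ ≤ _ := add_le_add h1 (h2.trans (mul_le_mul_of_nonneg_left h4 (Real.exp_nonneg _)))
    · have : Continuous fun q : ℝ × ℝ × ℝ => M * |q.1 - ξ₀| +
        Real.exp (K * |ξ₀ - q.2.1|) * (|q.2.2 - t₀| + M * |q.2.1 - x₀|) := by fun_prop
      simpa using this.tendsto (ξ₀, x₀, t₀)
  refine ⟨fun ξ x t => y x t ξ, fun ξ x t => Real.exp (∫ η in x..ξ, A x t t η), hy0,
    fun ξ x t => hy x t ξ, hcomp, hcont, ?_, ?_, ?_⟩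
  · have hA2 : Continuous fun q : (ℝ × ℝ × ℝ) × ℝ => A q.1.2.1 q.1.2.2 q.1.2.2 q.2 := by
      simp only [A, sub_self, mul_zero, add_zero, intervalIntegral.integral_const]
      have h1 := hα.cont'
      have h2 : Continuous fun q : (ℝ × ℝ × ℝ) × ℝ => y q.1.2.1 q.1.2.2 q.2 :=
        hcont.comp (by fun_prop : Continuous fun q : (ℝ × ℝ × ℝ) × ℝ => (q.2, q.1.2.1, q.1.2.2))
      exact (h1.comp (continuous_snd.prodMk h2)).const_smul (1 - 0 : ℝ)
    refine Real.continuous_exp.comp ?_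
    have h3 : ∀ q : ℝ × ℝ × ℝ, ∫ η in q.2.1..q.1, A q.2.1 q.2.2 q.2.2 η =
        (∫ η in (0 : ℝ)..q.1, A q.2.1 q.2.2 q.2.2 η) -
          ∫ η in (0 : ℝ)..q.2.1, A q.2.1 q.2.2 q.2.2 η := fun q =>
      (intervalIntegral.integral_interval_sub_left ((hAc _ _ _).intervalIntegrable _ _)
        ((hAc _ _ _).intervalIntegrable _ _)).symm
    simp_rw [h3]
    refine Continuous.sub ?_ ?_
    · exact intervalIntegral.continuous_parametric_intervalIntegral_of_continuous
        (f := fun (q : ℝ × ℝ × ℝ) η => A q.2.1 q.2.2 q.2.2 η) hA2 (by fun_prop)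
    · exact intervalIntegral.continuous_parametric_intervalIntegral_of_continuous
        (f := fun (q : ℝ × ℝ × ℝ) η => A q.2.1 q.2.2 q.2.2 η) hA2 (by fun_prop)
  · intro ξ x t
    rw [hasDerivAt_iff_tendsto_slope]
    have hE : Continuous fun s => Real.exp (∫ η in x..ξ, A x t s η) := by
      refine Real.continuous_exp.comp ?_
      refine intervalIntegral.continuous_parametric_intervalIntegral_of_continuous' ?_ x ξ
      refine intervalIntegral.continuous_parametric_intervalIntegral_of_continuous'
        (f := fun (p : ℝ × ℝ) s => α' (p.2, y x t p.2 + s * (y x p.1 p.2 - y x t p.2))) ?_ 0 1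
      have h1 := hα.cont'; have h2 := hyc x t
      have h3 : Continuous fun q : (ℝ × ℝ) × ℝ => y x q.1.1 q.1.2 :=
        hcont.comp (by fun_prop : Continuous fun q : (ℝ × ℝ) × ℝ => (q.1.2, x, q.1.1))
      show Continuous fun q : (ℝ × ℝ) × ℝ =>
        α' (q.1.2, y x t q.1.2 + q.2 * (y x q.1.1 q.1.2 - y x t q.1.2))
      have h4 : Continuous fun q : (ℝ × ℝ) × ℝ => y x t q.1.2 := h2.comp (by fun_prop)
      exact h1.comp ((by fun_prop : Continuous fun q : (ℝ × ℝ) × ℝ => q.1.2).prodMk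
        (h4.add (continuous_snd.mul (h3.sub h4))))
    refine ((hE.tendsto t).mono_left nhdsWithin_le_nhds).congr' ?_
    filter_upwards [self_mem_nhdsWithin] with s hs
    have hs' : s - t ≠ 0 := sub_ne_zero.2 hs
    rw [slope_def_field, hdiff x t s ξ]
    field_simp
  · intro ξ x t
    rw [Real.abs_exp]
    exact hEb _ _ _ _

/-- With `α` of one sign each characteristic is strictly monotone and meets the level `τ` at most
once. This makes the switch at `τ` invisible to integrals along characteristics. -/
lemma IsFlow.ae_ne {α : ℝ × ℝ → ℝ} {K : ℝ} {Ω Ω' : ℝ → ℝ → ℝ → ℝ} (hΩ : IsFlow α K Ω Ω')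
    (hα : (∀ q, 0 < α q) ∨ ∀ q, α q < 0) (x t τ : ℝ) : ∀ᵐ ξ, Ω ξ x t ≠ τ := by
  have hinj : Function.Injective fun ξ => Ω ξ x t := by
    rcases hα with h | h
    · exact (strictMono_of_deriv_pos fun ξ => by rw [(hΩ.deriv ξ x t).deriv]; exact h _).injective
    · exact (strictAnti_of_deriv_neg fun ξ => by rw [(hΩ.deriv ξ x t).deriv]; exact h _).injective
  have hsub : {ξ | Ω ξ x t = τ}.Subsingleton := fun a ha b hb => hinj (ha.trans hb.symm)
  have := hsub.measure_zero (volume : Measure ℝ)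
  rw [ae_iff]
  simpa using this

/-- The integral along characteristics of a source that is switched on at time `τ`. -/
lemma IsFlow.timeC1_integral {α : ℝ × ℝ → ℝ} {K : ℝ} {Ω Ω' : ℝ → ℝ → ℝ → ℝ}
    (hΩ : IsFlow α K Ω Ω') (hα : (∀ q, 0 < α q) ∨ ∀ q, α q < 0) {f f' : ℝ × ℝ → ℝ}
    (hf : TimeC1 f f') (x₀ τ : ℝ) :
    TimeC1 (fun q => ∫ ξ in x₀..q.1, f (ξ, max (Ω ξ q.1 q.2) τ))
      (fun q => ∫ ξ in x₀..q.1, if τ < Ω ξ q.1 q.2 then f' (ξ, Ω ξ q.1 q.2) * Ω' ξ q.1 q.2 else 0)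
      where
  cont := by
    have h1 := hf.cont
    have h2 : Continuous fun q : (ℝ × ℝ) × ℝ => Ω q.2 q.1.1 q.1.2 :=
      hΩ.cont.comp (by fun_prop : Continuous fun q : (ℝ × ℝ) × ℝ => (q.2, q.1.1, q.1.2))
    exact intervalIntegral.continuous_parametric_intervalIntegral_of_continuous
      (f := fun (q : ℝ × ℝ) ξ => f (ξ, max (Ω ξ q.1 q.2) τ))
      (h1.comp (continuous_snd.prodMk (h2.max continuous_const))) continuous_fst
  cont' := by
    have h2 : Continuous fun q : (ℝ × ℝ) × ℝ => Ω q.2 q.1.1 q.1.2 :=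
      hΩ.cont.comp (by fun_prop : Continuous fun q : (ℝ × ℝ) × ℝ => (q.2, q.1.1, q.1.2))
    have h3 : Continuous fun q : (ℝ × ℝ) × ℝ => Ω' q.2 q.1.1 q.1.2 :=
      hΩ.cont'.comp (by fun_prop : Continuous fun q : (ℝ × ℝ) × ℝ => (q.2, q.1.1, q.1.2))
    have h4 : Continuous fun q : (ℝ × ℝ) × ℝ => f' (q.2, Ω q.2 q.1.1 q.1.2) * Ω' q.2 q.1.1 q.1.2 :=
      (hf.cont'.comp (continuous_snd.prodMk h2)).mul h3
    rw [continuous_iff_continuousAt]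
    intro q₀
    set a := min x₀ q₀.1 - 1 with ha
    set b := max x₀ q₀.1 + 1 with hb
    obtain ⟨B, hB⟩ := ((isCompact_closedBall q₀ 1).prod
      (isCompact_Icc (a := a) (b := b))).exists_bound_of_continuousOn h4.continuousOn
    have hab : a ≤ b := by
      have := min_le_left x₀ q₀.1; have := le_max_left x₀ q₀.1; linarith
    -- The integrand jumps only where the characteristic crosses the level `τ`, a null set of `ξ`,
    -- so dominated convergence still yields continuity.
    have key := intervalIntegral.continuousAt_parametric_primitive_of_dominated
      (F := fun (q : ℝ × ℝ) ξ => if τ < Ω ξ q.1 q.2 then f' (ξ, Ω ξ q.1 q.2) * Ω' ξ q.1 q.2 else 0)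
      (μ := volume) (x₀ := q₀) (fun _ => B) a b (a₀ := x₀) (b₀ := q₀.1) ?_ ?_ ?_ ?_ ?_ ?_ ?_
    · exact ContinuousAt.comp (f := fun q : ℝ × ℝ => (q, q.1)) key (by fun_prop)
    · intro q
      have h5 : Continuous fun ξ => f' (ξ, Ω ξ q.1 q.2) * Ω' ξ q.1 q.2 :=
        h4.comp (by fun_prop : Continuous fun ξ : ℝ => (q, ξ))
      have h6 : Continuous fun ξ => Ω ξ q.1 q.2 :=
        h2.comp (by fun_prop : Continuous fun ξ : ℝ => (q, ξ))
      exact (Measurable.ite (measurableSet_lt measurable_const h6.measurable)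
        h5.measurable measurable_const).aestronglyMeasurable
    · filter_upwards [Metric.closedBall_mem_nhds q₀ one_pos] with q hq
      refine (ae_restrict_iff' measurableSet_uIoc).2 (Eventually.of_forall fun ξ hξ => ?_)
      have hξ' : ξ ∈ Icc a b := by
        rw [uIoc_of_le hab] at hξ
        exact Ioc_subset_Icc_self hξ
      have h7 := hB (q, ξ) ⟨hq, hξ'⟩
      split_ifs
      · exact h7
      · simpa using (norm_nonneg _).trans h7
    · exact intervalIntegrable_const
    · refine ae_restrict_of_ae ?_
      filter_upwards [hΩ.ae_ne hα q₀.1 q₀.2 τ] with ξ hξ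
      have h6 : Continuous fun q : ℝ × ℝ => Ω ξ q.1 q.2 :=
        h2.comp (by fun_prop : Continuous fun q : ℝ × ℝ => (q, ξ))
      rcases lt_or_gt_of_ne hξ with h | h
      · refine continuousAt_const.congr (f := fun _ => (0 : ℝ)) ?_
        filter_upwards [h6.continuousAt.eventually (gt_mem_nhds h)] with q hq
        rw [if_neg (not_lt.2 hq.le)]
      · have h8 : Continuous fun q : ℝ × ℝ => f' (ξ, Ω ξ q.1 q.2) * Ω' ξ q.1 q.2 :=
          h4.comp (by fun_prop : Continuous fun q : ℝ × ℝ => (q, ξ))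
        refine h8.continuousAt.congr ?_
        filter_upwards [h6.continuousAt.eventually (lt_mem_nhds h)] with q hq
        rw [if_pos hq]
    · constructor
      · have := min_le_left x₀ q₀.1; linarith
      · have := le_max_left x₀ q₀.1; linarith
    · constructor
      · have := min_le_right x₀ q₀.1; linarith
      · have := le_max_right x₀ q₀.1; linarith
    · simp
  hasDeriv := by
    intro x t₀
    have h2 : Continuous fun q : ℝ × ℝ => Ω q.1 x q.2 :=
      hΩ.cont.comp (by fun_prop : Continuous fun q : ℝ × ℝ => (q.1, x, q.2))
    have h3 : Continuous fun q : ℝ × ℝ => Ω' q.1 x q.2 :=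
      hΩ.cont'.comp (by fun_prop : Continuous fun q : ℝ × ℝ => (q.1, x, q.2))
    have hcpt : IsCompact (uIcc x₀ x ×ˢ Metric.closedBall t₀ 1) :=
      isCompact_uIcc.prod (isCompact_closedBall t₀ 1)
    obtain ⟨R, hR⟩ := hcpt.exists_bound_of_continuousOn h2.continuousOn
    obtain ⟨B₂, hB₂⟩ := hcpt.exists_bound_of_continuousOn h3.continuousOn
    obtain ⟨B₁, hB₁⟩ := ((isCompact_uIcc (a := x₀) (b := x)).prod
      (isCompact_Icc (a := -(max R |τ|)) (b := max R |τ|))).exists_bound_of_continuousOn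
      hf.cont'.continuousOn
    have hFc : ∀ t, Continuous fun ξ => f (ξ, max (Ω ξ x t) τ) := fun t =>
      hf.cont.comp (continuous_id.prodMk
        ((h2.comp (by fun_prop : Continuous fun ξ : ℝ => (ξ, t))).max continuous_const))
    -- Because of the `max` the integrand is Lipschitz in `t` but differentiable only for almost
    -- every `ξ`; the Lipschitz version of differentiation under the integral asks for no more.
    refine (intervalIntegral.hasDerivAt_integral_of_dominated_loc_of_lip (μ := volume)
      (F := fun t ξ => f (ξ, max (Ω ξ x t) τ)) (bound := fun _ => B₁ * B₂)
      (Metric.closedBall_mem_nhds t₀ one_pos) (Eventually.of_forall fun t =>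
        (hFc t).aestronglyMeasurable) ((hFc t₀).intervalIntegrable _ _) ?_ ?_
        intervalIntegrable_const ?_).2
    · have h5 : Continuous fun ξ => f' (ξ, Ω ξ x t₀) * Ω' ξ x t₀ :=
        (hf.cont'.comp (continuous_id.prodMk
          (h2.comp (by fun_prop : Continuous fun ξ : ℝ => (ξ, t₀))))).mul
          (h3.comp (by fun_prop : Continuous fun ξ : ℝ => (ξ, t₀)))
      have h6 : Continuous fun ξ => Ω ξ x t₀ :=
        h2.comp (by fun_prop : Continuous fun ξ : ℝ => (ξ, t₀))
      exact (Measurable.ite (measurableSet_lt measurable_const h6.measurable)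
        h5.measurable measurable_const).aestronglyMeasurable
    · refine Eventually.of_forall fun ξ hξ => ?_
      have hξ' : ξ ∈ uIcc x₀ x := uIoc_subset_uIcc hξ
      refine LipschitzOnWith.of_dist_le_mul fun t₁ ht₁ t₂ ht₂ => ?_
      have hm : ∀ t ∈ Metric.closedBall t₀ 1,
          max (Ω ξ x t) τ ∈ Icc (-(max R |τ|)) (max R |τ|) := by
        intro t ht
        have := hR (ξ, t) ⟨hξ', ht⟩
        rw [Real.norm_eq_abs] at this
        refine _root_.abs_le.1 ?_
        rcases max_choice (Ω ξ x t) τ with h | h <;> rw [h]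
        · exact this.trans (le_max_left _ _)
        · exact le_max_right _ _
      have e1 : |f (ξ, max (Ω ξ x t₁) τ) - f (ξ, max (Ω ξ x t₂) τ)| ≤
          B₁ * |max (Ω ξ x t₁) τ - max (Ω ξ x t₂) τ| :=
        hf.abs_sub_le fun s hs => hB₁ (ξ, s) ⟨hξ', uIcc_subset_Icc (hm _ ht₂) (hm _ ht₁) hs⟩
      have e2 : |max (Ω ξ x t₁) τ - max (Ω ξ x t₂) τ| ≤ |Ω ξ x t₁ - Ω ξ x t₂| :=
        abs_max_sub_max_le_abs _ _ _
      have e3 : |Ω ξ x t₁ - Ω ξ x t₂| ≤ B₂ * |t₁ - t₂| := by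
        have := Convex.norm_image_sub_le_of_norm_hasDerivWithin_le (f := fun s => Ω ξ x s)
          (C := B₂) (fun s (_ : s ∈ Metric.closedBall t₀ 1) => (hΩ.hasDeriv ξ x s).hasDerivWithinAt)
          (fun s hs => hB₂ (ξ, s) ⟨hξ', hs⟩) (convex_closedBall t₀ 1) ht₂ ht₁
        simpa using this
      have hB₁0 : 0 ≤ B₁ := (norm_nonneg _).trans (hB₁ (ξ, max (Ω ξ x t₁) τ) ⟨hξ', hm _ ht₁⟩)
      rw [Real.dist_eq, Real.dist_eq, Real.coe_nnabs]
      calc _ ≤ B₁ * (B₂ * |t₁ - t₂|) :=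
            e1.trans (mul_le_mul_of_nonneg_left (e2.trans e3) hB₁0)
        _ = B₁ * B₂ * |t₁ - t₂| := by ring
        _ ≤ |B₁ * B₂| * |t₁ - t₂| := mul_le_mul_of_nonneg_right (le_abs_self _) (abs_nonneg _)
    · filter_upwards [hΩ.ae_ne hα x t₀ τ] with ξ hξ _
      have h6 : ContinuousAt (fun t => Ω ξ x t) t₀ := (hΩ.hasDeriv ξ x t₀).continuousAt
      rcases lt_or_gt_of_ne hξ with h | h
      · rw [if_neg (not_lt.2 h.le)]
        refine (hasDerivAt_const t₀ (f (ξ, τ))).congr_of_eventuallyEq ?_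
        filter_upwards [h6.eventually (gt_mem_nhds h)] with t ht
        rw [max_eq_right ht.le]
      · rw [if_pos h]
        refine ((hf.hasDeriv ξ (Ω ξ x t₀)).comp t₀ (hΩ.hasDeriv ξ x t₀)).congr_of_eventuallyEq ?_
        filter_upwards [h6.eventually (lt_mem_nhds h)] with t ht
        simp only [Function.comp_apply]
        rw [max_eq_left ht.le]

/-- A function that is differentiable along characteristics and in time is of class `C¹`. -/
lemma IsFlow.hasFDerivAt {α : ℝ × ℝ → ℝ} {K : ℝ} {Ω Ω' : ℝ → ℝ → ℝ → ℝ}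
    (hΩ : IsFlow α K Ω Ω') {V V' h : ℝ × ℝ → ℝ} (hV : TimeC1 V V')
    (hchar : ∀ x t, HasDerivAt (fun y => V (y, Ω y x t)) (h (x, t)) x) (x t : ℝ) :
    HasFDerivAt V ((h (x, t) - α (x, t) * V' (x, t)) • ContinuousLinearMap.fst ℝ ℝ ℝ +
      V' (x, t) • ContinuousLinearMap.snd ℝ ℝ ℝ) (x, t) := by
  -- `V (y, s) = V (y, Ω y x t) + (s - Ω y x t) * slope`, the slope being continuous
  have hΩc : Continuous fun y => Ω y x t :=
    hΩ.cont.comp (by fun_prop : Continuous fun y : ℝ => (y, x, t))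
  have hcont : Continuous fun q : ℝ × ℝ =>
      ∫ θ in (0 : ℝ)..1, V' (q.1, Ω q.1 x t + θ * (q.2 - Ω q.1 x t)) := by
    refine intervalIntegral.continuous_parametric_intervalIntegral_of_continuous'
      (f := fun (q : ℝ × ℝ) θ => V' (q.1, Ω q.1 x t + θ * (q.2 - Ω q.1 x t))) ?_ 0 1
    have h1 : Continuous fun p : (ℝ × ℝ) × ℝ => Ω p.1.1 x t := hΩc.comp (by fun_prop)
    exact hV.cont'.comp ((by fun_prop : Continuous fun p : (ℝ × ℝ) × ℝ => p.1.1).prodMk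
      (h1.add (continuous_snd.mul ((by fun_prop : Continuous fun p : (ℝ × ℝ) × ℝ => p.1.2).sub h1))))
  have e : V = fun q => V (q.1, Ω q.1 x t) + (q.2 - Ω q.1 x t) *
      ∫ θ in (0 : ℝ)..1, V' (q.1, Ω q.1 x t + θ * (q.2 - Ω q.1 x t)) := by
    funext q
    have := hV.sub_eq q.1 (Ω q.1 x t) q.2
    linarith
  have hd1 : HasFDerivAt (fun q : ℝ × ℝ => V (q.1, Ω q.1 x t))
      (h (x, t) • ContinuousLinearMap.fst ℝ ℝ ℝ) (x, t) :=
    HasDerivAt.comp_hasFDerivAt (h₂ := fun y => V (y, Ω y x t)) (f := Prod.fst) (x, t) (hchar x t)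
      (hasFDerivAt_fst (𝕜 := ℝ))
  have hd2 : HasFDerivAt (fun q : ℝ × ℝ => q.2 - Ω q.1 x t)
      (ContinuousLinearMap.snd ℝ ℝ ℝ - α (x, t) • ContinuousLinearMap.fst ℝ ℝ ℝ) (x, t) := by
    have h3 := hΩ.deriv x x t
    rw [hΩ.self] at h3
    exact hasFDerivAt_snd.sub
      (HasDerivAt.comp_hasFDerivAt (h₂ := fun y => Ω y x t) (f := Prod.fst) (x, t) h3
        (hasFDerivAt_fst (𝕜 := ℝ)))
  -- A differentiable function that vanishes at the base point, times a merely continuous one, is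
  -- differentiable there.
  have hd3 : HasFDerivAt (fun q : ℝ × ℝ => (q.2 - Ω q.1 x t) *
      ∫ θ in (0 : ℝ)..1, V' (q.1, Ω q.1 x t + θ * (q.2 - Ω q.1 x t)))
      (V' (x, t) • (ContinuousLinearMap.snd ℝ ℝ ℝ - α (x, t) • ContinuousLinearMap.fst ℝ ℝ ℝ))
      (x, t) := by
    rw [hasFDerivAt_iff_isLittleO] at hd2 ⊢
    have hc0 := hcont.tendsto (x, t)
    simp only [hΩ.self, sub_self, mul_zero, add_zero, intervalIntegral.integral_const,
      sub_zero, one_smul] at hc0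
    simp only [hΩ.self, sub_self, zero_mul, sub_zero] at hd2 ⊢
    have hO : (fun q : ℝ × ℝ => (q.2 - Ω q.1 x t)) =O[𝓝 (x, t)] fun q => q - (x, t) := by
      have h4 := hd2.isBigO.add
        ((ContinuousLinearMap.snd ℝ ℝ ℝ - α (x, t) • ContinuousLinearMap.fst ℝ ℝ ℝ).isBigO_sub
          (𝓝 (x, t)) (x, t))
      refine h4.congr_left fun q => ?_
      ring
    have ho : (fun q : ℝ × ℝ => (∫ θ in (0 : ℝ)..1, V' (q.1, Ω q.1 x t + θ * (q.2 - Ω q.1 x t))) -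
        V' (x, t)) =o[𝓝 (x, t)] fun _ => (1 : ℝ) := by
      rw [Asymptotics.isLittleO_one_iff]
      simpa using hc0.sub_const (V' (x, t))
    have h5 := ho.mul_isBigO hO.norm_right
    simp only [one_mul] at h5
    have h7 := hd2.const_mul_left (V' (x, t))
    refine (h5.of_norm_right.add h7).congr_left fun q => ?_
    simp only [_root_.smul_apply, smul_eq_mul]
    ring
  rw [e]
  refine (hd1.add hd3).congr_fderiv ?_
  ext
  · simp; ring
  · simp

/-! ### The system solved sideways: a Neumann series in a weighted norm. -/

/-- The nearest point of `[0,1]`. -/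
noncomputable def clampUnit (x : ℝ) : ℝ := max 0 (min x 1)

lemma continuous_clampUnit : Continuous clampUnit := by unfold clampUnit; fun_prop

lemma clampUnit_mem (x : ℝ) : clampUnit x ∈ Icc (0 : ℝ) 1 :=
  ⟨le_max_left _ _, max_le zero_le_one (min_le_right _ _)⟩

lemma clampUnit_of_mem {x : ℝ} (hx : x ∈ Icc (0 : ℝ) 1) : clampUnit x = x := by
  rw [clampUnit, min_eq_left hx.2, max_eq_right hx.1]

lemma abs_sub_le_one {x y : ℝ} (hx : x ∈ Icc (0 : ℝ) 1) (hy : y ∈ Icc (0 : ℝ) 1) :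
    |x - y| ≤ 1 := by
  rw [abs_le]; constructor <;> linarith [hx.1, hx.2, hy.1, hy.2]

/-- A diagonal system `∂ₓu_j + α_j ∂ₜu_j + ∑ κ_jk u_k = f_j`, with reflections at the endpoints,
in which the space variable plays the role of the evolution variable. -/
structure CharSystem (n : ℕ) where
  α : Fin n → ℝ × ℝ → ℝ
  κ : Fin n → Fin n → ℝ × ℝ → ℝ
  κ' : Fin n → Fin n → ℝ × ℝ → ℝ
  p : Fin n → Fin n → ℝ
  Ω : Fin n → ℝ → ℝ → ℝ → ℝ
  Ω' : Fin n → ℝ → ℝ → ℝ → ℝ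
  xin : Fin n → ℝ
  xout : Fin n → ℝ
  K : ℝ
  B : ℝ
  δ : ℝ
  K_nonneg : 0 ≤ K
  δ_pos : 0 < δ
  xin_mem : ∀ j, xin j ∈ Icc (0 : ℝ) 1
  xout_mem : ∀ j, xout j ∈ Icc (0 : ℝ) 1
  xout_sub : ∀ j, |xout j - xin j| = 1
  α_sign : ∀ j, (∀ q, 0 < α j q) ∨ ∀ q, α j q < 0
  κ_c1 : ∀ j k, TimeC1 (κ j k) (κ' j k)
  κ_le : ∀ j k q, |κ j k q| ≤ B
  κ'_le : ∀ j k q, |κ' j k q| ≤ B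
  p_le : ∀ j k, |p j k| ≤ B
  flow : ∀ j, IsFlow (α j) K (Ω j) (Ω' j)
  back : ∀ j, ∀ x ∈ Icc (0 : ℝ) 1, ∀ ξ ∈ uIcc (xin j) x, ∀ t, Ω j ξ x t ≤ t - δ * |x - ξ|

namespace CharSystem

variable {n : ℕ} (Y : CharSystem n)

/-- The solution of the `j`-th transport equation with right-hand side `h_j`, switched on at
time `τ`, and boundary values computed from `u`. -/
noncomputable def march (τ : ℝ) (u h : Fin n → ℝ × ℝ → ℝ) (j : Fin n) (q : ℝ × ℝ) : ℝ :=
  (∑ k, Y.p j k * u k (Y.xout k, Y.Ω j (Y.xin j) q.1 q.2)) +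
    ∫ ξ in Y.xin j..q.1, h j (ξ, max (Y.Ω j ξ q.1 q.2) τ)

/-- The time derivative of `march`. -/
noncomputable def march' (τ : ℝ) (u' h' : Fin n → ℝ × ℝ → ℝ) (j : Fin n) (q : ℝ × ℝ) : ℝ :=
  (∑ k, Y.p j k * (u' k (Y.xout k, Y.Ω j (Y.xin j) q.1 q.2) * Y.Ω' j (Y.xin j) q.1 q.2)) +
    ∫ ξ in Y.xin j..q.1, if τ < Y.Ω j ξ q.1 q.2 then
      h' j (ξ, Y.Ω j ξ q.1 q.2) * Y.Ω' j ξ q.1 q.2 else 0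

lemma timeC1_march (τ : ℝ) {u u' h h' : Fin n → ℝ × ℝ → ℝ} (hu : ∀ k, TimeC1 (u k) (u' k))
    (hh : ∀ k, TimeC1 (h k) (h' k)) (j : Fin n) :
    TimeC1 (Y.march τ u h j) (Y.march' τ u' h' j) := by
  refine TimeC1.add (TimeC1.sum fun k => TimeC1.const_mul ⟨?_, ?_, fun x t => ?_⟩ _)
    ((Y.flow j).timeC1_integral (Y.α_sign j) (hh j) _ τ)
  · exact (hu k).cont.comp (continuous_const.prodMk ((Y.flow j).cont.comp
      (by fun_prop : Continuous fun q : ℝ × ℝ => (Y.xin j, q.1, q.2))))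
  · exact ((hu k).cont'.comp (continuous_const.prodMk ((Y.flow j).cont.comp
      (by fun_prop : Continuous fun q : ℝ × ℝ => (Y.xin j, q.1, q.2))))).mul ((Y.flow j).cont'.comp
      (by fun_prop : Continuous fun q : ℝ × ℝ => (Y.xin j, q.1, q.2)))
  · exact ((hu k).hasDeriv (Y.xout k) (Y.Ω j (Y.xin j) x t)).comp t
      ((Y.flow j).hasDeriv (Y.xin j) x t)

/-- The weight that controls the iterates. -/
noncomputable def wt (lam μ τ : ℝ) (k : Fin n) (q : ℝ × ℝ) : ℝ :=
  Real.exp (lam * (q.2 - τ) - μ * |clampUnit q.1 - Y.xin k|)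

/-- A family of functions that vanish before time `τ`, are `C¹` in time and of controlled size. -/
structure Controlled (lam μ τ A : ℝ) (u u' : Fin n → ℝ × ℝ → ℝ) : Prop where
  c1 : ∀ k, TimeC1 (u k) (u' k)
  zero : ∀ k x t, t ≤ τ → u k (x, t) = 0
  zero' : ∀ k x t, t ≤ τ → u' k (x, t) = 0
  le : ∀ k q, |u k q| ≤ A * Y.wt lam μ τ k q
  le' : ∀ k q, |u' k q| ≤ A * Y.wt lam μ τ k q

lemma abs_Ω'_le (j : Fin n) {ξ x : ℝ} (hξ : ξ ∈ Icc (0 : ℝ) 1) (hx : x ∈ Icc (0 : ℝ) 1) (t : ℝ) :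
    |Y.Ω' j ξ x t| ≤ Real.exp Y.K :=
  ((Y.flow j).abs_le ξ x t).trans (Real.exp_le_exp.2
    (mul_le_of_le_one_right Y.K_nonneg (abs_sub_le_one hξ hx)))

end CharSystem

/-- The bound `H / c` is independent of the length of the interval. With `c = lam * δ` it is the
gain that makes the coupling small for large `lam`. -/
lemma abs_intervalIntegral_exp_le {f : ℝ → ℝ} {a x c H : ℝ} (hc : 0 < c) (hH : 0 ≤ H)
    (h : ∀ ξ ∈ uIcc a x, |f ξ| ≤ H * Real.exp (-(c * |x - ξ|))) :
    |∫ ξ in a..x, f ξ| ≤ H / c := by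
  have main : ∀ (g : ℝ → ℝ) (b : ℝ), 0 ≤ b → (∀ r ∈ Icc 0 b, |g r| ≤ H * Real.exp (-(c * r))) →
      |∫ r in (0 : ℝ)..b, g r| ≤ H / c := by
    intro g b hb hg
    have h1 : |∫ r in (0 : ℝ)..b, g r| ≤ ∫ r in (0 : ℝ)..b, H * Real.exp (-(c * r)) := by
      refine intervalIntegral.norm_integral_le_of_norm_le (f := g)
        (g := fun r => H * Real.exp (-(c * r))) hb (Eventually.of_forall fun r hr =>
        hg r (Ioc_subset_Icc_self hr)) (Continuous.intervalIntegrable (by fun_prop) _ _)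
    have h2 : ∀ r ∈ uIcc 0 b, HasDerivAt (fun r => -(H / c) * Real.exp (-(c * r)))
        (H * Real.exp (-(c * r))) r := by
      intro r _
      have h3 : HasDerivAt (fun r : ℝ => -(c * r)) (-c) r := by
        exact (((hasDerivAt_id r).const_mul c).neg).congr_deriv (by simp)
      refine (h3.exp.const_mul (-(H / c))).congr_deriv ?_
      field_simp
    rw [intervalIntegral.integral_eq_sub_of_hasDerivAt h2
      (Continuous.intervalIntegrable (by fun_prop) _ _)] at h1
    have h4 : 0 ≤ H / c * Real.exp (-(c * b)) := by positivity
    simp only [mul_zero, neg_zero, Real.exp_zero] at h1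
    linarith
  rcases le_total a x with hax | hax
  · have e : ∫ ξ in a..x, f ξ = ∫ r in (0 : ℝ)..(x - a), f (x - r) := by
      rw [intervalIntegral.integral_comp_sub_left f x]; simp
    rw [e]
    refine main _ _ (by linarith) fun r hr => ?_
    have := h (x - r) (by rw [uIcc_of_le hax]; constructor <;> linarith [hr.1, hr.2])
    simpa [abs_of_nonneg hr.1] using this
  · have e : ∫ ξ in a..x, f ξ = -∫ r in (0 : ℝ)..(a - x), f (x + r) := by
      rw [intervalIntegral.integral_comp_add_left f x, intervalIntegral.integral_symm]; simp
    rw [e, abs_neg]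
    refine main _ _ (by linarith) fun r hr => ?_
    have := h (x + r) (by rw [uIcc_of_ge hax]; constructor <;> linarith [hr.1, hr.2])
    simpa [abs_of_nonneg hr.1] using this

namespace CharSystem

variable {n : ℕ} (Y : CharSystem n)

/-- The contraction mechanism. At an outflow end the weight carries the full factor `exp (-μ)`,
which beats the reflection coefficients; the delay `δ |x - x_j|` on the way from the inflow end pays
for the weight at `x`, since `μ ≤ lam * δ`. Inside, dropping the `μ` part costs at most `exp μ`, and
integration over `ξ` gains `1 / (lam * δ)`. The factor `E` leaves room for the bound of `Ω'` when
time derivatives are estimated. -/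
lemma abs_sum_integral_le {lam μ τ A H E : ℝ} (hμ : 0 ≤ μ) (hlam : 0 < lam)
    (hlm : μ ≤ lam * Y.δ) (hA : 0 ≤ A) (hH : 0 ≤ H) (hE : 0 ≤ E) (j : Fin n)
    {x : ℝ} (hx : x ∈ Icc (0 : ℝ) 1) (t : ℝ) {v : Fin n → ℝ} {f : ℝ → ℝ}
    (hv : ∀ k, |v k| ≤ A * Real.exp (lam * (Y.Ω j (Y.xin j) x t - τ) - μ) * E)
    (hf : ∀ ξ ∈ uIcc (Y.xin j) x, |f ξ| ≤ H * Real.exp (lam * (Y.Ω j ξ x t - τ)) * E) :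
    |(∑ k, Y.p j k * v k) + ∫ ξ in Y.xin j..x, f ξ| ≤
      (A * (n * Y.B * Real.exp (-μ)) + H * (Real.exp μ / (lam * Y.δ))) * E *
        Real.exp (lam * (t - τ) - μ * |x - Y.xin j|) := by
  have hB : 0 ≤ Y.B := (abs_nonneg _).trans (Y.p_le j j)
  have hd : |x - Y.xin j| ≤ 1 := abs_sub_le_one hx (Y.xin_mem j)
  set W := Real.exp (lam * (t - τ) - μ * |x - Y.xin j|) with hW
  have h1 : |∑ k, Y.p j k * v k| ≤ A * (n * Y.B * Real.exp (-μ)) * E * W := by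
    have hb := Y.back j x hx (Y.xin j) left_mem_uIcc t
    have e1 : Real.exp (lam * (Y.Ω j (Y.xin j) x t - τ) - μ) ≤ Real.exp (-μ) * W := by
      rw [hW, ← Real.exp_add]
      refine Real.exp_le_exp.2 ?_
      have := mul_le_mul_of_nonneg_left hb hlam.le
      have := mul_le_mul_of_nonneg_right hlm (abs_nonneg (x - Y.xin j))
      nlinarith
    calc |∑ k, Y.p j k * v k| ≤ ∑ k, |Y.p j k * v k| := Finset.abs_sum_le_sum_abs _ _
      _ ≤ ∑ _k : Fin n, Y.B * (A * (Real.exp (-μ) * W) * E) := by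
        refine Finset.sum_le_sum fun k _ => ?_
        rw [abs_mul]
        refine mul_le_mul (Y.p_le j k) ((hv k).trans ?_) (abs_nonneg _) hB
        gcongr
      _ = _ := by simp; ring
  have h2 : |∫ ξ in Y.xin j..x, f ξ| ≤ H * (Real.exp μ / (lam * Y.δ)) * E * W := by
    have hc : 0 < lam * Y.δ := mul_pos hlam Y.δ_pos
    have e1 : |∫ ξ in Y.xin j..x, f ξ| ≤ (H * E * Real.exp (lam * (t - τ))) / (lam * Y.δ) := by
      refine abs_intervalIntegral_exp_le hc (by positivity) fun ξ hξ => (hf ξ hξ).trans ?_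
      have hb := Y.back j x hx ξ hξ t
      have e2 : Real.exp (lam * (Y.Ω j ξ x t - τ)) ≤
          Real.exp (lam * (t - τ)) * Real.exp (-(lam * Y.δ * |x - ξ|)) := by
        rw [← Real.exp_add]
        refine Real.exp_le_exp.2 ?_
        have := mul_le_mul_of_nonneg_left hb hlam.le
        nlinarith
      calc _ ≤ H * (Real.exp (lam * (t - τ)) * Real.exp (-(lam * Y.δ * |x - ξ|))) * E := by gcongr
        _ = _ := by ring
    have e3 : Real.exp (lam * (t - τ)) ≤ Real.exp μ * W := by
      rw [hW, ← Real.exp_add]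
      refine Real.exp_le_exp.2 ?_
      nlinarith
    refine e1.trans ?_
    calc _ ≤ (H * E * (Real.exp μ * W)) / (lam * Y.δ) := by gcongr
      _ = _ := by ring
  calc _ ≤ |∑ k, Y.p j k * v k| + |∫ ξ in Y.xin j..x, f ξ| := abs_add_le _ _
    _ ≤ _ := add_le_add h1 h2
    _ = _ := by ring

/-- Characteristics followed towards the inflow end only reach earlier times, so vanishing before
`τ` is preserved. Values and time derivatives obey the same estimate, the latter with the extra
factor `|Ω'| ≤ exp K`. -/
lemma Controlled.march {lam μ τ A H : ℝ} (hμ : 0 ≤ μ) (hlam : 0 < lam)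
    (hlm : μ ≤ lam * Y.δ) (hA : 0 ≤ A) (hH : 0 ≤ H) {u u' h h' : Fin n → ℝ × ℝ → ℝ}
    (hu : Y.Controlled lam μ τ A u u') (hh : ∀ k, TimeC1 (h k) (h' k))
    (h0 : ∀ k x, h k (x, τ) = 0)
    (hle : ∀ k, ∀ x ∈ Icc (0 : ℝ) 1, ∀ t, τ ≤ t →
      |h k (x, t)| ≤ H * Real.exp (lam * (t - τ)) ∧ |h' k (x, t)| ≤ H * Real.exp (lam * (t - τ))) :
    Y.Controlled lam μ τ
      ((A * (n * Y.B * Real.exp (-μ)) + H * (Real.exp μ / (lam * Y.δ))) * Real.exp Y.K)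
      (fun j q => Y.march τ u h j (clampUnit q.1, q.2))
      (fun j q => Y.march' τ u' h' j (clampUnit q.1, q.2)) where
  c1 j := (Y.timeC1_march τ hu.c1 hh j).comp_fst continuous_clampUnit
  zero j x t ht := by
    have hx := clampUnit_mem x
    have hback : ∀ ξ ∈ uIcc (Y.xin j) (clampUnit x), Y.Ω j ξ (clampUnit x) t ≤ τ := fun ξ hξ =>
      (Y.back j _ hx ξ hξ t).trans (by
        have := mul_nonneg Y.δ_pos.le (abs_nonneg (clampUnit x - ξ)); linarith)
    simp only [CharSystem.march]
    rw [Finset.sum_eq_zero fun k _ => by rw [hu.zero k _ _ (hback _ left_mem_uIcc), mul_zero],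
      intervalIntegral.integral_congr (g := fun _ => 0) fun ξ hξ => by
        simp only [max_eq_right (hback ξ hξ), h0]]
    simp
  zero' j x t ht := by
    have hx := clampUnit_mem x
    have hback : ∀ ξ ∈ uIcc (Y.xin j) (clampUnit x), Y.Ω j ξ (clampUnit x) t ≤ τ := fun ξ hξ =>
      (Y.back j _ hx ξ hξ t).trans (by
        have := mul_nonneg Y.δ_pos.le (abs_nonneg (clampUnit x - ξ)); linarith)
    simp only [CharSystem.march']
    rw [Finset.sum_eq_zero fun k _ => by
        rw [hu.zero' k _ _ (hback _ left_mem_uIcc), zero_mul, mul_zero],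
      intervalIntegral.integral_congr (g := fun _ => 0) fun ξ hξ => by
        simp only [if_neg (not_lt.2 (hback ξ hξ))]]
    simp
  le j q := by
    have hx := clampUnit_mem q.1
    have hsub := uIcc_subset_Icc (Y.xin_mem j) hx
    have hE : 1 ≤ Real.exp Y.K := Real.one_le_exp Y.K_nonneg
    refine Y.abs_sum_integral_le hμ hlam hlm hA hH (Real.exp_nonneg _) j hx q.2 (fun k => ?_)
      fun ξ hξ => ?_
    · have := hu.le k (Y.xout k, Y.Ω j (Y.xin j) (clampUnit q.1) q.2)
      rw [wt, clampUnit_of_mem (Y.xout_mem k), Y.xout_sub, mul_one] at this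
      exact this.trans (le_mul_of_one_le_right (by positivity) hE)
    · refine le_trans ?_ (le_mul_of_one_le_right (by positivity) hE)
      rcases le_total (Y.Ω j ξ (clampUnit q.1) q.2) τ with hs | hs
      · rw [max_eq_right hs, h0, abs_zero]; positivity
      · rw [max_eq_left hs]; exact (hle j ξ (hsub hξ) _ hs).1
  le' j q := by
    have hx := clampUnit_mem q.1
    have hsub := uIcc_subset_Icc (Y.xin_mem j) hx
    refine Y.abs_sum_integral_le hμ hlam hlm hA hH (Real.exp_nonneg _) j hx q.2 (fun k => ?_)
      fun ξ hξ => ?_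
    · have := hu.le' k (Y.xout k, Y.Ω j (Y.xin j) (clampUnit q.1) q.2)
      rw [wt, clampUnit_of_mem (Y.xout_mem k), Y.xout_sub, mul_one] at this
      rw [abs_mul]
      exact mul_le_mul this (Y.abs_Ω'_le j (Y.xin_mem j) hx _) (abs_nonneg _) (by positivity)
    · split_ifs with hs
      · rw [abs_mul]
        exact mul_le_mul (hle j ξ (hsub hξ) _ hs.le).2 (Y.abs_Ω'_le j (hsub hξ) hx _)
          (abs_nonneg _) (by positivity)
      · rw [abs_zero]; positivity

/-- The coupling term `-∑ κ_jk u_k`. -/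
noncomputable def coupling (u : Fin n → ℝ × ℝ → ℝ) (j : Fin n) (q : ℝ × ℝ) : ℝ :=
  -∑ k, Y.κ j k q * u k q

/-- The time derivative of the coupling term. -/
noncomputable def coupling' (u u' : Fin n → ℝ × ℝ → ℝ) (j : Fin n) (q : ℝ × ℝ) : ℝ :=
  -∑ k, (Y.κ' j k q * u k q + Y.κ j k q * u' k q)

lemma timeC1_coupling {u u' : Fin n → ℝ × ℝ → ℝ} (hu : ∀ k, TimeC1 (u k) (u' k)) (j : Fin n) :
    TimeC1 (Y.coupling u j) (Y.coupling' u u' j) :=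
  (TimeC1.sum fun k => (Y.κ_c1 j k).mul (hu k)).neg

/-- One step of the iteration halves the weighted norm of the function and of its time derivative
simultaneously. -/
lemma Controlled.step {lam μ τ A : ℝ} (hμ : 0 ≤ μ) (hlam : 0 < lam)
    (hlm : μ ≤ lam * Y.δ) (hA : 0 ≤ A)
    (hq : (n * Y.B * Real.exp (-μ) + 2 * n * Y.B * (Real.exp μ / (lam * Y.δ))) * Real.exp Y.K ≤ 1 / 2)
    {u u' : Fin n → ℝ × ℝ → ℝ} (hu : Y.Controlled lam μ τ A u u') :
    Y.Controlled lam μ τ (A * (1 / 2))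
      (fun j q => Y.march τ u (Y.coupling u) j (clampUnit q.1, q.2))
      (fun j q => Y.march' τ u' (Y.coupling' u u') j (clampUnit q.1, q.2)) := by
  rcases isEmpty_or_nonempty (Fin n) with hn | ⟨⟨j₀⟩⟩
  · exact ⟨hn.elim, hn.elim, hn.elim, hn.elim, hn.elim⟩
  have hB : 0 ≤ Y.B := (abs_nonneg _).trans (Y.p_le j₀ j₀)
  have hw : ∀ k x t, Y.wt lam μ τ k (x, t) ≤ Real.exp (lam * (t - τ)) := fun k x t =>
    Real.exp_le_exp.2 (by
      have := mul_nonneg hμ (abs_nonneg (clampUnit x - Y.xin k)); simp only; linarith)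
  -- The factor `2` in `H` accounts for the two products `κ' u` and `κ u'` in the time derivative of
  -- the coupling.
  have h := hu.march Y hμ hlam hlm hA (H := 2 * n * Y.B * A) (by positivity)
    (Y.timeC1_coupling hu.c1) (fun k x => by simp [coupling, hu.zero]) (fun j x _ t ht => ?_)
  · have hle : (A * (n * Y.B * Real.exp (-μ)) + 2 * n * Y.B * A * (Real.exp μ / (lam * Y.δ))) *
        Real.exp Y.K ≤ A * (1 / 2) := by
      calc _ = A * ((n * Y.B * Real.exp (-μ) + 2 * n * Y.B * (Real.exp μ / (lam * Y.δ))) *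
          Real.exp Y.K) := by ring
        _ ≤ _ := mul_le_mul_of_nonneg_left hq hA
    exact ⟨h.c1, h.zero, h.zero',
      fun k q => (h.le k q).trans (mul_le_mul_of_nonneg_right hle (Real.exp_nonneg _)),
      fun k q => (h.le' k q).trans (mul_le_mul_of_nonneg_right hle (Real.exp_nonneg _))⟩
  · have e : ∀ k, |u k (x, t)| ≤ A * Real.exp (lam * (t - τ)) := fun k =>
      (hu.le k _).trans (mul_le_mul_of_nonneg_left (hw k x t) hA)
    have e' : ∀ k, |u' k (x, t)| ≤ A * Real.exp (lam * (t - τ)) := fun k =>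
      (hu.le' k _).trans (mul_le_mul_of_nonneg_left (hw k x t) hA)
    constructor
    · rw [coupling, abs_neg]
      calc _ ≤ ∑ k, |Y.κ j k (x, t) * u k (x, t)| := Finset.abs_sum_le_sum_abs _ _
        _ ≤ ∑ _k : Fin n, Y.B * (A * Real.exp (lam * (t - τ))) := by
          refine Finset.sum_le_sum fun k _ => ?_
          rw [abs_mul]
          exact mul_le_mul (Y.κ_le _ _ _) (e k) (abs_nonneg _) hB
        _ = n * Y.B * A * Real.exp (lam * (t - τ)) := by simp; ring
        _ ≤ _ := by
          have : 0 ≤ n * Y.B * A * Real.exp (lam * (t - τ)) := by positivity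
          linarith
    · rw [coupling', abs_neg]
      calc _ ≤ ∑ k, |Y.κ' j k (x, t) * u k (x, t) + Y.κ j k (x, t) * u' k (x, t)| :=
            Finset.abs_sum_le_sum_abs _ _
        _ ≤ ∑ _k : Fin n, 2 * (Y.B * (A * Real.exp (lam * (t - τ)))) := by
          refine Finset.sum_le_sum fun k _ => (abs_add_le _ _).trans ?_
          rw [abs_mul, abs_mul]
          have h1 := mul_le_mul (Y.κ'_le j k (x, t)) (e k) (abs_nonneg _) hB
          have h2 := mul_le_mul (Y.κ_le j k (x, t)) (e' k) (abs_nonneg _) hB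
          linarith
        _ = _ := by simp; ring

end CharSystem

/-- The weights grow exponentially in time, so domination is available only on half-planes `t < R`;
continuity and differentiability are local, so this suffices. -/
lemma TimeC1.tsum {F F' : ℕ → ℝ × ℝ → ℝ} (hF : ∀ i, TimeC1 (F i) (F' i))
    (hb : ∀ R : ℝ, ∃ b : ℕ → ℝ, Summable b ∧
      ∀ i q, q.2 < R → |F i q| ≤ b i ∧ |F' i q| ≤ b i) :
    TimeC1 (fun q => ∑' i, F i q) (fun q => ∑' i, F' i q) := by
  have hopen : ∀ R : ℝ, IsOpen {q : ℝ × ℝ | q.2 < R} := fun R =>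
    isOpen_lt continuous_snd continuous_const
  refine ⟨continuous_iff_continuousAt.2 fun q => ?_, continuous_iff_continuousAt.2 fun q => ?_,
    fun x t => ?_⟩
  · obtain ⟨b, hbs, hb⟩ := hb (q.2 + 1)
    exact (continuousOn_tsum (fun i => (hF i).cont.continuousOn) hbs
      fun i r (hr : r.2 < q.2 + 1) => (hb i r hr).1).continuousAt
      ((hopen (q.2 + 1)).mem_nhds (by simp))
  · obtain ⟨b, hbs, hb⟩ := hb (q.2 + 1)
    exact (continuousOn_tsum (fun i => (hF i).cont'.continuousOn) hbs
      fun i r (hr : r.2 < q.2 + 1) => (hb i r hr).2).continuousAt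
      ((hopen (q.2 + 1)).mem_nhds (by simp))
  · obtain ⟨b, hbs, hb⟩ := hb (t + 1)
    exact hasDerivAt_tsum_of_isPreconnected (g := fun i s => F i (x, s))
      (g' := fun i s => F' i (x, s)) hbs isOpen_Iio isPreconnected_Iio
      (fun i s _ => (hF i).hasDeriv x s) (fun i s (hs : s < t + 1) => (hb i (x, s) hs).2)
      (y₀ := t) (by simp) (Summable.of_norm_bounded hbs fun i => (hb i (x, t) (by simp)).1) (by simp)

namespace CharSystem

variable {n : ℕ} (Y : CharSystem n)

/-- The terms of the Neumann series of the system with source `f`, and their time derivatives. -/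
noncomputable def iter (τ : ℝ) (f f' : Fin n → ℝ × ℝ → ℝ) :
    ℕ → (Fin n → ℝ × ℝ → ℝ) × (Fin n → ℝ × ℝ → ℝ)
  | 0 => (fun j q => Y.march τ 0 f j (clampUnit q.1, q.2),
      fun j q => Y.march' τ 0 f' j (clampUnit q.1, q.2))
  | i + 1 =>
    (fun j q => Y.march τ (iter τ f f' i).1 (Y.coupling (iter τ f f' i).1) j (clampUnit q.1, q.2),
      fun j q => Y.march' τ (iter τ f f' i).2 (Y.coupling' (iter τ f f' i).1 (iter τ f f' i).2) j
        (clampUnit q.1, q.2))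

lemma controlled_iter {lam μ τ H : ℝ} (hμ : 0 ≤ μ) (hlam : 0 < lam)
    (hlm : μ ≤ lam * Y.δ) (hH : 0 ≤ H)
    (hq : (n * Y.B * Real.exp (-μ) + 2 * n * Y.B * (Real.exp μ / (lam * Y.δ))) * Real.exp Y.K ≤ 1 / 2)
    {f f' : Fin n → ℝ × ℝ → ℝ} (hf : ∀ k, TimeC1 (f k) (f' k)) (h0 : ∀ k x, f k (x, τ) = 0)
    (hle : ∀ k, ∀ x ∈ Icc (0 : ℝ) 1, ∀ t, τ ≤ t →
      |f k (x, t)| ≤ H * Real.exp (lam * (t - τ)) ∧ |f' k (x, t)| ≤ H * Real.exp (lam * (t - τ)))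
    (i : ℕ) :
    Y.Controlled lam μ τ (H * (Real.exp μ / (lam * Y.δ)) * Real.exp Y.K * (1 / 2) ^ i)
      (Y.iter τ f f' i).1 (Y.iter τ f f' i).2 := by
  have hδ := Y.δ_pos
  induction i with
  | zero =>
    have hz : Y.Controlled lam μ τ 0 0 0 :=
      ⟨fun _ => ⟨continuous_const, continuous_const, fun _ t => hasDerivAt_const t 0⟩,
        fun _ _ _ _ => rfl, fun _ _ _ _ => rfl, fun _ _ => by simp, fun _ _ => by simp⟩
    have := hz.march Y hμ hlam hlm le_rfl hH hf h0 hle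
    simpa [iter] using this
  | succ i ih =>
    have := ih.step Y hμ hlam hlm (by positivity) hq
    rw [pow_succ, ← mul_assoc]
    exact this

/-- The fixed point is the sum of the Neumann series: the zeroth term integrates the source, and
each later term is the march of its predecessor. -/
lemma exists_fixed_point {τ M₀ : ℝ} (hM₀ : 0 ≤ M₀)
    {f f' : Fin n → ℝ × ℝ → ℝ} (hf : ∀ k, TimeC1 (f k) (f' k)) (h0 : ∀ k x, f k (x, τ) = 0)
    (hle : ∀ k, ∀ x ∈ Icc (0 : ℝ) 1, ∀ t, τ ≤ t →
      |f k (x, t)| ≤ M₀ * (1 + (t - τ)) ∧ |f' k (x, t)| ≤ M₀ * (1 + (t - τ))) :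
    ∃ v v' : Fin n → ℝ × ℝ → ℝ, (∀ k, TimeC1 (v k) (v' k)) ∧
      (∀ k x t, t ≤ τ → v k (x, t) = 0) ∧
      ∀ j q, v j q = Y.march τ v (fun j q => f j q + Y.coupling v j q) j (clampUnit q.1, q.2) := by
  rcases isEmpty_or_nonempty (Fin n) with hn | ⟨⟨j₀⟩⟩
  · exact ⟨0, 0, hn.elim, hn.elim, hn.elim⟩
  have hB : 0 ≤ Y.B := (abs_nonneg _).trans (Y.p_le j₀ j₀)
  have hδ := Y.δ_pos
  set E := Real.exp Y.K with hE
  have hE0 : 0 < E := Real.exp_pos _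
  -- First `μ`, so that the reflections contribute at most `1/4`.
  obtain ⟨μ, hμ, hμ'⟩ : ∃ μ : ℝ, 0 ≤ μ ∧ 4 * (n * Y.B * E) ≤ Real.exp μ :=
    ⟨4 * (n * Y.B * E), by positivity, by linarith [Real.add_one_le_exp (4 * (n * Y.B * E))]⟩
  -- Then `lam` in terms of `μ`: large enough for the delay to pay for the spatial weight, for the
  -- coupling to contribute at most `1/4`, and for `exp` to dominate the linear growth of the
  -- source.
  obtain ⟨lam, hl1, hl2, hl3⟩ : ∃ lam : ℝ, 1 ≤ lam ∧ μ ≤ lam * Y.δ ∧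
      8 * (n * Y.B * E * Real.exp μ) ≤ lam * Y.δ := by
    refine ⟨1 + μ / Y.δ + 8 * (n * Y.B * E * Real.exp μ) / Y.δ, ?_, ?_, ?_⟩
    · have : 0 ≤ μ / Y.δ + 8 * (n * Y.B * E * Real.exp μ) / Y.δ := by positivity
      linarith
    all_goals
      have e : (1 + μ / Y.δ + 8 * (n * Y.B * E * Real.exp μ) / Y.δ) * Y.δ =
        Y.δ + μ + 8 * (n * Y.B * E * Real.exp μ) := by field_simp
      have : 0 ≤ 8 * (n * Y.B * E * Real.exp μ) := by positivity
      rw [e]; linarith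
  have hlam : 0 < lam := by linarith
  have hc : 0 < lam * Y.δ := by positivity
  have hq : (n * Y.B * Real.exp (-μ) + 2 * n * Y.B * (Real.exp μ / (lam * Y.δ))) * E ≤ 1 / 2 := by
    have h1 : n * Y.B * Real.exp (-μ) * E ≤ 1 / 4 := by
      rw [Real.exp_neg]
      calc n * Y.B * (Real.exp μ)⁻¹ * E = (n * Y.B * E) / Real.exp μ := by ring
        _ ≤ 1 / 4 := by rw [div_le_iff₀ (Real.exp_pos _)]; linarith
    have h2 : 2 * n * Y.B * (Real.exp μ / (lam * Y.δ)) * E ≤ 1 / 4 := by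
      calc 2 * n * Y.B * (Real.exp μ / (lam * Y.δ)) * E =
          2 * (n * Y.B * E * Real.exp μ) / (lam * Y.δ) := by ring
        _ ≤ 1 / 4 := by rw [div_le_iff₀ hc]; linarith
    linarith
  have hle' : ∀ k, ∀ x ∈ Icc (0 : ℝ) 1, ∀ t, τ ≤ t →
      |f k (x, t)| ≤ M₀ * Real.exp (lam * (t - τ)) ∧
        |f' k (x, t)| ≤ M₀ * Real.exp (lam * (t - τ)) := by
    intro k x hx t ht
    have h1 : 1 + (t - τ) ≤ Real.exp (lam * (t - τ)) := by
      have h2 := Real.add_one_le_exp (lam * (t - τ))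
      have h3 : 1 * (t - τ) ≤ lam * (t - τ) := mul_le_mul_of_nonneg_right hl1 (by linarith)
      linarith
    have h2 := mul_le_mul_of_nonneg_left h1 hM₀
    exact ⟨(hle k x hx t ht).1.trans h2, (hle k x hx t ht).2.trans h2⟩
  have hctl := Y.controlled_iter hμ hlam hl2 hM₀ hq hf h0 hle'
  set A := M₀ * (Real.exp μ / (lam * Y.δ)) * Real.exp Y.K with hA
  have hA0 : 0 ≤ A := by positivity
  set w := Y.iter τ f f' with hw
  have hwt : ∀ R k (q : ℝ × ℝ), q.2 ≤ R → Y.wt lam μ τ k q ≤ Real.exp (lam * (R - τ)) := by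
    intro R k q hq
    refine Real.exp_le_exp.2 ?_
    have h1 := mul_nonneg hμ (abs_nonneg (clampUnit q.1 - Y.xin k))
    have h2 : lam * (q.2 - τ) ≤ lam * (R - τ) := mul_le_mul_of_nonneg_left (by linarith) hlam.le
    linarith
  have hbd : ∀ R i k (q : ℝ × ℝ), q.2 ≤ R →
      |(w i).1 k q| ≤ A * (1 / 2) ^ i * Real.exp (lam * (R - τ)) ∧
      |(w i).2 k q| ≤ A * (1 / 2) ^ i * Real.exp (lam * (R - τ)) := fun R i k q hq =>
    ⟨((hctl i).le k q).trans (mul_le_mul_of_nonneg_left (hwt R k q hq) (by positivity)),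
      ((hctl i).le' k q).trans (mul_le_mul_of_nonneg_left (hwt R k q hq) (by positivity))⟩
  have hsumm : ∀ R, Summable fun i : ℕ => A * (1 / 2) ^ i * Real.exp (lam * (R - τ)) := fun R =>
    ((summable_geometric_of_lt_one (by norm_num) (by norm_num)).mul_left A).mul_right _
  have hvs : ∀ k q, HasSum (fun i => (w i).1 k q) (∑' i, (w i).1 k q) := fun k q =>
    (Summable.of_norm_bounded (hsumm q.2) fun i => (hbd q.2 i k q le_rfl).1).hasSum
  set v : Fin n → ℝ × ℝ → ℝ := fun k q => ∑' i, (w i).1 k q with hv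
  have hvc : ∀ k, TimeC1 (v k) (fun q => ∑' i, (w i).2 k q) := fun k =>
    TimeC1.tsum (fun i => (hctl i).c1 k) fun R =>
      ⟨_, hsumm R, fun i q hq => hbd R i k q hq.le⟩
  refine ⟨v, fun k q => ∑' i, (w i).2 k q, hvc, fun k x t ht => ?_, fun j q => ?_⟩
  · simp only [hv, (hctl _).zero k x t ht, tsum_zero]
  · set x := clampUnit q.1 with hx
    have hxm := clampUnit_mem q.1
    have hΩc : Continuous fun ξ => Y.Ω j ξ x q.2 :=
      (Y.flow j).cont.comp (by fun_prop : Continuous fun ξ : ℝ => (ξ, x, q.2))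
    have hcurve : Continuous fun ξ => (ξ, max (Y.Ω j ξ x q.2) τ) :=
      continuous_id.prodMk (hΩc.max continuous_const)
    -- Marching commutes with the series by dominated convergence; the times met on the way to the
    -- inflow end do not exceed `max t τ`, where the geometric bounds hold.
    have hsum2 : HasSum (fun i => Y.march τ (w i).1 (Y.coupling (w i).1) j (x, q.2))
        (Y.march τ v (Y.coupling v) j (x, q.2)) := by
      refine HasSum.add (hasSum_sum fun k _ => (hvs k _).mul_left _) ?_
      refine intervalIntegral.hasSum_integral_of_dominated_convergence
        (fun i _ => n * (Y.B * (A * (1 / 2) ^ i * Real.exp (lam * (max q.2 τ - τ)))))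
        (fun i => ?_) (fun i => Eventually.of_forall fun ξ hξ => ?_)
        (Eventually.of_forall fun ξ _ => ?_) ?_ (Eventually.of_forall fun ξ _ => ?_)
      · exact ((Y.timeC1_coupling (hctl i).c1 j).cont.comp hcurve).aestronglyMeasurable
      · rw [coupling, norm_neg]
        have hm : max (Y.Ω j ξ x q.2) τ ≤ max q.2 τ := by
          refine max_le_max ?_ le_rfl
          have h1 := Y.back j x hxm ξ (uIoc_subset_uIcc hξ) q.2
          have h2 := mul_nonneg hδ.le (abs_nonneg (x - ξ))
          linarith
        refine (norm_sum_le _ _).trans ((Finset.sum_le_sum fun k _ => ?_).trans_eq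
          (b := ∑ _k : Fin n, Y.B * (A * (1 / 2) ^ i * Real.exp (lam * (max q.2 τ - τ)))) (by simp))
        rw [norm_mul]
        exact mul_le_mul (Y.κ_le _ _ _) (hbd _ i k _ hm).1 (abs_nonneg _) hB
      · exact ((hsumm (max q.2 τ)).mul_left Y.B).mul_left _
      · exact intervalIntegrable_const
      · exact (hasSum_sum fun k _ => (hvs k _).mul_left _).neg
    have h1 : v j q = (w 0).1 j q + ∑' i, (w (i + 1)).1 j q :=
      (hvs j q).summable.tsum_eq_zero_add
    have h2 : ∑' i, (w (i + 1)).1 j q = Y.march τ v (Y.coupling v) j (x, q.2) := hsum2.tsum_eq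
    rw [h1, h2]
    show Y.march τ 0 f j (x, q.2) + Y.march τ v (Y.coupling v) j (x, q.2) = _
    have hi1 : IntervalIntegrable (fun ξ => f j (ξ, max (Y.Ω j ξ x q.2) τ)) volume (Y.xin j) x :=
      ((hf j).cont.comp hcurve).intervalIntegrable _ _
    have hi2 : IntervalIntegrable (fun ξ => Y.coupling v j (ξ, max (Y.Ω j ξ x q.2) τ)) volume
        (Y.xin j) x := ((Y.timeC1_coupling hvc j).cont.comp hcurve).intervalIntegrable _ _
    simp only [march, Pi.zero_apply, mul_zero, Finset.sum_const_zero, zero_add]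
    rw [intervalIntegral.integral_add hi1 hi2]
    ring

/-- Solvability of the sideways problem with zero initial values and a source that vanishes at
the initial time. -/
theorem exists_solution {τ M₀ : ℝ} (hM₀ : 0 ≤ M₀) (hα : ∀ j, Continuous (Y.α j))
    {f f' : Fin n → ℝ × ℝ → ℝ} (hf : ∀ k, TimeC1 (f k) (f' k)) (h0 : ∀ k x, f k (x, τ) = 0)
    (hle : ∀ k, ∀ x ∈ Icc (0 : ℝ) 1, ∀ t, τ ≤ t →
      |f k (x, t)| ≤ M₀ * (1 + (t - τ)) ∧ |f' k (x, t)| ≤ M₀ * (1 + (t - τ))) :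
    ∃ V : Fin n → ℝ × ℝ → ℝ, (∀ j, ContDiff ℝ 1 (V j)) ∧
      (∀ j, ∀ x ∈ Icc (0 : ℝ) 1, V j (x, τ) = 0) ∧
      (∀ j t, V j (Y.xin j, t) = ∑ k, Y.p j k * V k (Y.xout k, t)) ∧
      ∀ j, ∀ x ∈ Icc (0 : ℝ) 1, ∀ t, τ ≤ t → ∃ vx vt,
        HasDerivAt (fun y => V j (y, t)) vx x ∧ HasDerivAt (fun s => V j (x, s)) vt t ∧
        vx + Y.α j (x, t) * vt + ∑ k, Y.κ j k (x, t) * V k (x, t) = f j (x, t) := by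
  obtain ⟨v, v', hv, hv0, hfix⟩ := Y.exists_fixed_point hM₀ hf h0 hle
  set h : Fin n → ℝ × ℝ → ℝ := fun j q => f j q + Y.coupling v j q with hh
  have hh1 : ∀ k, TimeC1 (h k) (fun q => f' k q + Y.coupling' v v' k q) := fun k =>
    (hf k).add (Y.timeC1_coupling hv k)
  -- The same march without clamping `x`: it equals `v` on the strip, but has no kink in `x` at the
  -- two ends.
  set V := Y.march τ v h with hV
  have hV1 := Y.timeC1_march τ hv hh1
  have hVv : ∀ j, ∀ x ∈ Icc (0 : ℝ) 1, ∀ t, V j (x, t) = v j (x, t) := fun j x hx t => by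
    rw [hfix j (x, t)]; simp only [clampUnit_of_mem hx]
  -- Along a fixed characteristic the boundary contribution is constant by the group property, so
  -- only the upper limit of the integral varies.
  have hchar : ∀ j x t, HasDerivAt (fun y => V j (y, Y.Ω j y x t)) (h j (x, max t τ)) x := by
    intro j x t
    have e : (fun y => V j (y, Y.Ω j y x t)) = fun y =>
        (∑ k, Y.p j k * v k (Y.xout k, Y.Ω j (Y.xin j) x t)) +
        ∫ ξ in Y.xin j..y, h j (ξ, max (Y.Ω j ξ x t) τ) := by
      funext y
      simp only [hV, march, (Y.flow j).comp]
    have hc : Continuous fun ξ => h j (ξ, max (Y.Ω j ξ x t) τ) :=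
      (hh1 j).cont.comp (continuous_id.prodMk (((Y.flow j).cont.comp
        (by fun_prop : Continuous fun ξ : ℝ => (ξ, x, t))).max continuous_const))
    rw [e]
    have := intervalIntegral.integral_hasDerivAt_right (hc.intervalIntegrable (Y.xin j) x)
      (hc.stronglyMeasurableAtFilter _ _) hc.continuousAt
    simp only [(Y.flow j).self] at this
    exact this.const_add _
  have hfd := fun j => (Y.flow j).hasFDerivAt (h := fun q => h j (q.1, max q.2 τ)) (hV1 j) (hchar j)
  refine ⟨V, fun j => ?_, fun j x hx => ?_, fun j t => ?_, fun j x hx t ht => ?_⟩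
  · rw [contDiff_one_iff_hasFDerivAt]
    refine ⟨_, ?_, fun q => hfd j q.1 q.2⟩
    have h1 : Continuous fun q : ℝ × ℝ => h j (q.1, max q.2 τ) :=
      (hh1 j).cont.comp (by fun_prop)
    exact ((h1.sub ((hα j).mul (hV1 j).cont')).smul continuous_const).add
      ((hV1 j).cont'.smul continuous_const)
  · rw [hVv j x hx, hv0 j x τ le_rfl]
  · simp only [hVv _ _ (Y.xout_mem _)]
    simp [hV, march, (Y.flow j).self]
  · refine ⟨_, _, HasFDerivAt.comp_hasDerivAt (f := fun y => (y, t)) x (hfd j x t)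
      ((hasDerivAt_id x).prodMk (hasDerivAt_const x t)), (hV1 j).hasDeriv x t, ?_⟩
    simp only [hVv _ x hx, max_eq_left ht, hh, coupling]
    simp

end CharSystem

/-! ### Coefficients of the problem and classical solutions from test functions. -/

/-- `TimeC1` functions that are bounded on the strip together with their time derivative. -/
structure TimeBC1 (f f' : ℝ × ℝ → ℝ) : Prop extends TimeC1 f f' where
  bdd : ∃ M, ∀ x ∈ Icc (0 : ℝ) 1, ∀ t, |f (x, t)| ≤ M ∧ |f' (x, t)| ≤ M

namespace TimeBC1

variable {f f' g g' : ℝ × ℝ → ℝ}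

lemma add (hf : TimeBC1 f f') (hg : TimeBC1 g g') :
    TimeBC1 (fun q => f q + g q) (fun q => f' q + g' q) := by
  obtain ⟨M, hM⟩ := hf.bdd
  obtain ⟨N, hN⟩ := hg.bdd
  exact ⟨hf.toTimeC1.add hg.toTimeC1, M + N, fun x hx t =>
    ⟨(abs_add_le _ _).trans (add_le_add (hM x hx t).1 (hN x hx t).1),
      (abs_add_le _ _).trans (add_le_add (hM x hx t).2 (hN x hx t).2)⟩⟩

lemma neg (hf : TimeBC1 f f') : TimeBC1 (fun q => -f q) (fun q => -f' q) := by
  obtain ⟨M, hM⟩ := hf.bdd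
  exact ⟨hf.toTimeC1.neg, M, fun x hx t => by simpa using hM x hx t⟩

lemma mul (hf : TimeBC1 f f') (hg : TimeBC1 g g') :
    TimeBC1 (fun q => f q * g q) (fun q => f' q * g q + f q * g' q) := by
  obtain ⟨M, hM⟩ := hf.bdd
  obtain ⟨N, hN⟩ := hg.bdd
  have hM0 : 0 ≤ M := (abs_nonneg _).trans (hM 0 (by simp) 0).1
  have hN0 : 0 ≤ N := (abs_nonneg _).trans (hN 0 (by simp) 0).1
  refine ⟨hf.toTimeC1.mul hg.toTimeC1, 2 * (M * N), fun x hx t => ⟨?_, ?_⟩⟩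
  · have := mul_le_mul (hM x hx t).1 (hN x hx t).1 (abs_nonneg _) hM0
    rw [abs_mul]
    have : 0 ≤ M * N := by positivity
    linarith
  · refine (abs_add_le _ _).trans ?_
    rw [abs_mul, abs_mul]
    have := mul_le_mul (hM x hx t).2 (hN x hx t).1 (abs_nonneg _) hM0
    have := mul_le_mul (hM x hx t).1 (hN x hx t).2 (abs_nonneg _) hM0
    linarith

lemma zero : TimeBC1 (fun _ => 0) (fun _ => 0) :=
  ⟨⟨continuous_const, continuous_const, fun _ t => hasDerivAt_const t 0⟩, 0, by simp⟩

lemma sum {ι : Type*} {s : Finset ι} {F F' : ι → ℝ × ℝ → ℝ} (h : ∀ i, TimeBC1 (F i) (F' i)) :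
    TimeBC1 (fun q => ∑ i ∈ s, F i q) (fun q => ∑ i ∈ s, F' i q) := by
  classical
  induction s using Finset.induction_on with
  | empty => simpa using TimeBC1.zero
  | insert i s hi ih => simpa only [Finset.sum_insert hi] using (h i).add ih

lemma of_space {k : ℝ → ℝ} (hk : Continuous k) : TimeBC1 (fun q => k q.1) (fun _ => 0) := by
  obtain ⟨M, hM⟩ := (isCompact_Icc (a := (0 : ℝ)) (b := 1)).exists_bound_of_continuousOn
    hk.continuousOn
  refine ⟨TimeC1.of_space hk, M, fun x hx t => ⟨hM x hx, ?_⟩⟩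
  simpa using (norm_nonneg _).trans (hM x hx)

end TimeBC1

lemma uniqueDiffOn_closedStrip : UniqueDiffOn ℝ closedStrip :=
  (uniqueDiffOn_Icc zero_lt_one).prod uniqueDiffOn_univ

lemma mem_closedStrip {x t : ℝ} : (x, t) ∈ closedStrip ↔ x ∈ Icc (0 : ℝ) 1 := by
  simp [closedStrip]

lemma closedStrip_mem_nhds {x : ℝ} (hx : x ∈ Ioo (0 : ℝ) 1) (t : ℝ) : closedStrip ∈ 𝓝 (x, t) :=
  prod_mem_nhds (Icc_mem_nhds hx.1 hx.2) univ_mem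

/-- The extension of a function on the strip that is constant in `x` outside of the strip. -/
noncomputable def clampExt (f : ℝ × ℝ → ℝ) (q : ℝ × ℝ) : ℝ := f (clampUnit q.1, q.2)

/-- The time derivative of `clampExt f`. -/
noncomputable def clampExt' (f : ℝ × ℝ → ℝ) (q : ℝ × ℝ) : ℝ :=
  fderivWithin ℝ f closedStrip (clampUnit q.1, q.2) (0, 1)

lemma clampExt_of_mem (f : ℝ × ℝ → ℝ) {x : ℝ} (hx : x ∈ Icc (0 : ℝ) 1) (t : ℝ) :
    clampExt f (x, t) = f (x, t) := by simp only [clampExt, clampUnit_of_mem hx]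

lemma IsBC1.timeC1 {f : ℝ × ℝ → ℝ} (hf : IsBC1 f) : TimeC1 (clampExt f) (clampExt' f) := by
  have hc : Continuous fun q : ℝ × ℝ => (clampUnit q.1, q.2) :=
    (continuous_clampUnit.comp continuous_fst).prodMk continuous_snd
  have hm : ∀ q : ℝ × ℝ, (clampUnit q.1, q.2) ∈ closedStrip := fun q =>
    mem_closedStrip.2 (clampUnit_mem q.1)
  refine ⟨hf.1.continuousOn.comp_continuous hc hm, ?_, fun x t => ?_⟩
  · exact ((hf.1.continuousOn_fderivWithin uniqueDiffOn_closedStrip le_rfl).comp_continuous hc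
      hm).clm_apply continuous_const
  · have h1 : HasFDerivWithinAt f (fderivWithin ℝ f closedStrip (clampUnit x, t)) closedStrip
        (clampUnit x, t) :=
      ((hf.1.differentiableOn one_ne_zero) _ (hm (x, t))).hasFDerivWithinAt
    have h2 : HasDerivWithinAt (fun s => (clampUnit x, s)) ((0 : ℝ), (1 : ℝ)) univ t :=
      ((hasDerivAt_const t _).prodMk (hasDerivAt_id t)).hasDerivWithinAt
    have h3 := h1.comp_hasDerivWithinAt t h2 (fun s _ => hm (x, s))
    exact hasDerivWithinAt_univ.1 h3

lemma abs_apply_le {L : ℝ × ℝ →L[ℝ] ℝ} {M : ℝ} (h : ‖L‖ ≤ M) : |L (0, 1)| ≤ M := by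
  have h1 : ‖((0 : ℝ), (1 : ℝ))‖ = 1 := by simp [Prod.norm_def]
  have := L.le_opNorm (0, 1)
  rw [h1, mul_one] at this
  exact this.trans h

/-- Uniform bounds for the coefficients of the problem. -/
structure CoeffBounds {n : ℕ} (S : HyperbolicProblem n) (Λ M : ℝ) : Prop where
  Λ_pos : 0 < Λ
  M_pos : 0 < M
  a_bc : ∀ j, IsBC1 (S.a j)
  b_bc : ∀ j k, IsBC1 (S.b j k)
  a_le : ∀ j, ∀ q ∈ closedStrip, |S.a j q| ≤ M ∧ ‖fderivWithin ℝ (S.a j) closedStrip q‖ ≤ M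
  b_le : ∀ j k, ∀ q ∈ closedStrip, |S.b j k q| ≤ M ∧ ‖fderivWithin ℝ (S.b j k) closedStrip q‖ ≤ M
  p_le : ∀ j k, |S.p j k| ≤ M
  a_pos : ∀ j : Fin n, (j : ℕ) < S.m → ∀ q ∈ closedStrip, Λ ≤ S.a j q
  a_neg : ∀ j : Fin n, S.m ≤ (j : ℕ) → ∀ q ∈ closedStrip, S.a j q ≤ -Λ

lemma exists_coeffBounds {n : ℕ} (S : HyperbolicProblem n)
    (ha : ∀ j, IsBC1 (S.a j)) (hΛ : S.NonDegenerate) (hb : ∀ j k, IsBC1 (S.b j k)) :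
    ∃ Λ M, CoeffBounds S Λ M := by
  obtain ⟨Λ, hΛ0, hΛ⟩ := hΛ
  choose Ma hMa using fun j => (ha j).2
  choose Mb hMb using fun j k => (hb j k).2
  set M := 1 + ∑ j, |Ma j| + ∑ j, ∑ k, |Mb j k| + ∑ j, ∑ k, |S.p j k| with hM
  have s1 : ∀ j, |Ma j| ≤ ∑ j, |Ma j| := fun j =>
    Finset.single_le_sum (f := fun j => |Ma j|) (fun _ _ => abs_nonneg _) (Finset.mem_univ j)
  have s2 : ∀ (F : Fin n → Fin n → ℝ) j k, |F j k| ≤ ∑ j, ∑ k, |F j k| := fun F j k =>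
    (Finset.single_le_sum (f := fun k => |F j k|) (fun _ _ => abs_nonneg _)
      (Finset.mem_univ k)).trans (Finset.single_le_sum (f := fun j => ∑ k, |F j k|)
        (fun _ _ => Finset.sum_nonneg fun _ _ => abs_nonneg _) (Finset.mem_univ j))
  have p1 : 0 ≤ ∑ j, |Ma j| := Finset.sum_nonneg fun _ _ => abs_nonneg _
  have p2 : ∀ F : Fin n → Fin n → ℝ, 0 ≤ ∑ j, ∑ k, |F j k| := fun F =>
    Finset.sum_nonneg fun _ _ => Finset.sum_nonneg fun _ _ => abs_nonneg _
  have e1 : ∀ j, Ma j ≤ M := fun j => by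
    linarith [le_abs_self (Ma j), s1 j, p2 Mb, p2 S.p]
  have e2 : ∀ j k, Mb j k ≤ M := fun j k => by
    linarith [le_abs_self (Mb j k), s2 Mb j k, p1, p2 S.p]
  refine ⟨Λ, M, hΛ0, by linarith [p1, p2 Mb, p2 S.p], ha, hb,
    fun j q hq => ⟨(hMa j q hq).1.trans (e1 j), (hMa j q hq).2.trans (e1 j)⟩,
    fun j k q hq => ⟨(hMb j k q hq).1.trans (e2 j k), (hMb j k q hq).2.trans (e2 j k)⟩,
    fun j k => by linarith [s2 S.p j k, p1, p2 Mb],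
    fun j hj q hq => (hΛ j q hq).1 hj, fun j hj q hq => (hΛ j q hq).2 hj⟩

namespace CoeffBounds

variable {n : ℕ} {S : HyperbolicProblem n} {Λ M : ℝ}

lemma Λ_le (h : CoeffBounds S Λ M) (j : Fin n) {q : ℝ × ℝ} (hq : q ∈ closedStrip) :
    Λ ≤ |S.a j q| := by
  rcases lt_or_ge (j : ℕ) S.m with hj | hj
  · exact (h.a_pos j hj q hq).trans (le_abs_self _)
  · have := h.a_neg j hj q hq
    have := neg_le_abs (S.a j q)
    linarith

lemma a_ne_zero (h : CoeffBounds S Λ M) (j : Fin n) {q : ℝ × ℝ} (hq : q ∈ closedStrip) :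
    S.a j q ≠ 0 := abs_pos.1 (h.Λ_pos.trans_le (h.Λ_le j hq))

lemma abs_inv_le (h : CoeffBounds S Λ M) (j : Fin n) {q : ℝ × ℝ} (hq : q ∈ closedStrip) :
    |(S.a j q)⁻¹| ≤ Λ⁻¹ := by
  rw [abs_inv]
  exact inv_anti₀ h.Λ_pos (h.Λ_le j hq)

end CoeffBounds

lemma mem_strip_clamp (q : ℝ × ℝ) : (clampUnit q.1, q.2) ∈ closedStrip :=
  mem_closedStrip.2 (clampUnit_mem q.1)

/-- Division by `a_j` turns the `j`-th equation into one with unit coefficient of `∂ₓ`. Clamping in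
`x` extends the coefficients to the plane with the same bounds, so that global flows exist. -/
lemma CoeffBounds.exists_charSystem {n : ℕ} {S : HyperbolicProblem n} {Λ M : ℝ}
    (h : CoeffBounds S Λ M) : ∃ Y : CharSystem n,
      (∀ j, Y.α j = fun q => (clampExt (S.a j) q)⁻¹) ∧
      (∀ j k, Y.κ j k = fun q => clampExt (S.b j k) q * (clampExt (S.a j) q)⁻¹) ∧
      Y.p = S.p ∧ (∀ j, Y.xin j = S.inPt j) ∧ (∀ j, Y.xout j = S.outPt j) := by
  have hΛ := h.Λ_pos
  have hM := h.M_pos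
  have hc0 : ∀ j q, clampExt (S.a j) q ≠ 0 := fun j q => h.a_ne_zero j (mem_strip_clamp q)
  have hαc : ∀ j, TimeC1 (fun q => (clampExt (S.a j) q)⁻¹)
      (fun q => -clampExt' (S.a j) q / clampExt (S.a j) q ^ 2) := fun j =>
    (h.a_bc j).timeC1.inv (hc0 j)
  have hαb : ∀ j q, |(clampExt (S.a j) q)⁻¹| ≤ Λ⁻¹ := fun j q =>
    h.abs_inv_le j (mem_strip_clamp q)
  have hαb' : ∀ j q, |-clampExt' (S.a j) q / clampExt (S.a j) q ^ 2| ≤ M * Λ⁻¹ ^ 2 := by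
    intro j q
    rw [div_eq_mul_inv, abs_mul, abs_neg, ← inv_pow, abs_pow]
    refine mul_le_mul (abs_apply_le (h.a_le j _ (mem_strip_clamp q)).2)
      (pow_le_pow_left₀ (abs_nonneg _) (hαb j q) 2) (by positivity) hM.le
  choose Ω Ω' hΩ using fun j => exists_isFlow (hαc j) (hαb j) (hαb' j)
  have hlow : ∀ j : Fin n, (j : ℕ) < S.m → ∀ q, M⁻¹ ≤ (clampExt (S.a j) q)⁻¹ := by
    intro j hj q
    have h1 := h.a_pos j hj _ (mem_strip_clamp q)
    exact inv_anti₀ (hΛ.trans_le h1) ((le_abs_self _).trans (h.a_le j _ (mem_strip_clamp q)).1)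
  have hup : ∀ j : Fin n, S.m ≤ (j : ℕ) → ∀ q, (clampExt (S.a j) q)⁻¹ ≤ -M⁻¹ := by
    intro j hj q
    have h1 := h.a_neg j hj _ (mem_strip_clamp q)
    have h2 : M⁻¹ ≤ (-(clampExt (S.a j) q))⁻¹ := by
      refine inv_anti₀ ?_ ((neg_le_abs _).trans (h.a_le j _ (mem_strip_clamp q)).1)
      simp only [clampExt]; linarith
    rw [inv_neg] at h2
    linarith
  have hMi : 0 < M⁻¹ := inv_pos.2 hM
  refine ⟨{
    α := fun j q => (clampExt (S.a j) q)⁻¹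
    κ := fun j k q => clampExt (S.b j k) q * (clampExt (S.a j) q)⁻¹
    κ' := fun j k q => clampExt' (S.b j k) q * (clampExt (S.a j) q)⁻¹ +
      clampExt (S.b j k) q * (-clampExt' (S.a j) q / clampExt (S.a j) q ^ 2)
    p := S.p
    Ω := Ω
    Ω' := Ω'
    xin := fun j => S.inPt j
    xout := fun j => S.outPt j
    -- `K` bounds `|∂ₜ(1/a)| = |∂ₜa| / a²`, `B` is a common bound for `κ`, `κ'` and `p`, and `δ` is
    -- a lower bound for `|1/a|`.
    K := M * Λ⁻¹ ^ 2
    B := M + M * Λ⁻¹ + M * (M * Λ⁻¹ ^ 2)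
    δ := M⁻¹
    K_nonneg := by positivity
    δ_pos := hMi
    xin_mem := fun j => (S.inPt j).2
    xout_mem := fun j => (S.outPt j).2
    xout_sub := fun j => by
      unfold HyperbolicProblem.inPt HyperbolicProblem.outPt
      split_ifs <;> simp
    α_sign := fun j => by
      rcases lt_or_ge (j : ℕ) S.m with hj | hj
      · exact Or.inl fun q => hMi.trans_le (hlow j hj q)
      · exact Or.inr fun q => (hup j hj q).trans_lt (by linarith)
    κ_c1 := fun j k => (h.b_bc j k).timeC1.mul (hαc j)
    κ_le := fun j k q => by
      have h1 : |clampExt (S.b j k) q| ≤ M := (h.b_le j k _ (mem_strip_clamp q)).1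
      have h2 := mul_le_mul h1 (hαb j q) (abs_nonneg _) hM.le
      rw [abs_mul]
      have : 0 ≤ M * (M * Λ⁻¹ ^ 2) := by positivity
      linarith
    κ'_le := fun j k q => by
      have h1 : |clampExt (S.b j k) q| ≤ M := (h.b_le j k _ (mem_strip_clamp q)).1
      have h3 : |clampExt' (S.b j k) q| ≤ M := abs_apply_le (h.b_le j k _ (mem_strip_clamp q)).2
      refine (abs_add_le _ _).trans ?_
      rw [abs_mul, abs_mul]
      have h2 := mul_le_mul h3 (hαb j q) (abs_nonneg _) hM.le
      have h4 := mul_le_mul h1 (hαb' j q) (abs_nonneg _) hM.le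
      linarith
    p_le := fun j k => by
      have : 0 ≤ M * Λ⁻¹ + M * (M * Λ⁻¹ ^ 2) := by positivity
      linarith [h.p_le j k]
    flow := hΩ
    back := fun j x hx ξ hξ t => by
      have hself := (hΩ j).self x t
      rcases lt_or_ge (j : ℕ) S.m with hj | hj
      · have hin : (S.inPt j : ℝ) = 0 := by simp [HyperbolicProblem.inPt, hj]
        rw [hin, uIcc_of_le hx.1] at hξ
        have := convex_univ.mul_sub_le_image_sub_of_le_deriv (f := fun y => Ω j y x t)
          (C := M⁻¹) (fun y _ => ((hΩ j).deriv y x t).continuousAt.continuousWithinAt)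
          (fun y _ => ((hΩ j).deriv y x t).differentiableAt.differentiableWithinAt)
          (fun y _ => by rw [((hΩ j).deriv y x t).deriv]; exact hlow j hj _)
          ξ (mem_univ _) x (mem_univ _) hξ.2
        rw [abs_of_nonneg (by linarith [hξ.2])]
        simp only [hself] at this
        linarith
      · have hin : (S.inPt j : ℝ) = 1 := by simp [HyperbolicProblem.inPt, not_lt.2 hj]
        rw [hin, uIcc_of_ge hx.2] at hξ
        have := convex_univ.image_sub_le_mul_sub_of_deriv_le (f := fun y => Ω j y x t)
          (C := -M⁻¹) (fun y _ => ((hΩ j).deriv y x t).continuousAt.continuousWithinAt)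
          (fun y _ => ((hΩ j).deriv y x t).differentiableAt.differentiableWithinAt)
          (fun y _ => by rw [((hΩ j).deriv y x t).deriv]; exact hup j hj _)
          x (mem_univ _) ξ (mem_univ _) hξ.1
        rw [abs_of_nonpos (by linarith [hξ.1])]
        simp only [hself] at this
        linarith }, fun j => rfl, fun j k => rfl, rfl, fun j => rfl, fun j => rfl⟩

/-- The coefficient is smooth only on the strip, but the product vanishes near every point outside
the support of `ψ`, which lies in the open interval. -/
lemma contDiff_mul_of_tsupport_subset {a : ℝ × ℝ → ℝ} (ha : IsBC1 a) (τ : ℝ) {ψ : ℝ → ℝ}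
    (hψ : ContDiff ℝ 1 ψ) (hs : tsupport ψ ⊆ Ioo 0 1) :
    ContDiff ℝ 1 fun x => a (x, τ) * ψ x := by
  rw [contDiff_iff_contDiffAt]
  intro x
  by_cases hx : x ∈ tsupport ψ
  · have h1 : ContDiffAt ℝ 1 a (x, τ) := ha.1.contDiffAt (closedStrip_mem_nhds (hs hx) τ)
    have h2 : ContDiffAt ℝ 1 (fun y : ℝ => (y, τ)) x := by fun_prop
    exact (ContDiffAt.comp x (f := fun y : ℝ => (y, τ)) h1 h2).mul hψ.contDiffAt
  · have h0 : (fun x => a (x, τ) * ψ x) =ᶠ[𝓝 x] fun _ => 0 := by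
      filter_upwards [(isClosed_tsupport ψ).isOpen_compl.mem_nhds hx] with y hy
      rw [image_eq_zero_of_notMem_tsupport hy, mul_zero]
    exact contDiffAt_const.congr_of_eventuallyEq h0

/-- Subtracting `φ + (t - τ) g`, with `g` the initial time derivative dictated by the equation,
leaves zero initial values and a source that vanishes at `τ`. The subtracted part is compactly
supported in `x`, so it does not touch the boundary conditions. -/
lemma CoeffBounds.exists_classicalSolution {n : ℕ} {S : HyperbolicProblem n} {Λ M : ℝ}
    (h : CoeffBounds S Λ M) (τ : ℝ) {φ : Fin n → ℝ → ℝ} (hφ : IsTestFunction φ) :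
    ∃ u, S.IsClassicalSolution τ φ u := by
  obtain ⟨Y, hYα, hYκ, hYp, hYin, hYout⟩ := h.exists_charSystem
  have hφ1 : ∀ j, ContDiff ℝ 1 (φ j) := fun j => (hφ j).1.of_le (by exact_mod_cast le_top)
  have hφd1 : ∀ j, ContDiff ℝ 1 (deriv (φ j)) := fun j =>
    ((contDiff_infty_iff_deriv.1 (hφ j).1).2).of_le (by exact_mod_cast le_top)
  have hds : ∀ j, tsupport (deriv (φ j)) ⊆ Ioo 0 1 := fun j =>
    tsupport_deriv_subset.trans (hφ j).2.2
  set g : Fin n → ℝ → ℝ := fun j x =>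
    -(S.a j (x, τ) * deriv (φ j) x + ∑ k, S.b j k (x, τ) * φ k x) with hg
  have hg1 : ∀ j, ContDiff ℝ 1 (g j) := fun j =>
    ((contDiff_mul_of_tsupport_subset (h.a_bc j) τ (hφd1 j) (hds j)).add
      (ContDiff.sum fun k _ =>
        contDiff_mul_of_tsupport_subset (h.b_bc j k) τ (hφ1 k) (hφ k).2.2)).neg
  have hφ0 : ∀ j, ∀ x ∉ Ioo (0 : ℝ) 1, φ j x = 0 := fun j x hx =>
    image_eq_zero_of_notMem_tsupport fun hx' => hx ((hφ j).2.2 hx')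
  have hφd0 : ∀ j, ∀ x ∉ Ioo (0 : ℝ) 1, deriv (φ j) x = 0 := fun j x hx =>
    image_eq_zero_of_notMem_tsupport fun hx' => hx (hds j hx')
  have hg0 : ∀ j, ∀ x ∉ Ioo (0 : ℝ) 1, g j x = 0 := fun j x hx => by
    simp [hg, hφd0 j x hx, hφ0 _ x hx]
  have hgd : ∀ j x, HasDerivAt (g j) (deriv (g j) x) x := fun j x =>
    ((hg1 j).differentiable one_ne_zero x).hasDerivAt
  have hφd : ∀ j x, HasDerivAt (φ j) (deriv (φ j) x) x := fun j x =>
    ((hφ1 j).differentiable one_ne_zero x).hasDerivAt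
  -- the residual of `φ + (t - τ) g` is `F₀ + (t - τ) F₁`
  have hbc : ∀ {f f' : ℝ × ℝ → ℝ} {N : ℝ}, TimeC1 f f' → (∀ q, |f q| ≤ N) → (∀ q, |f' q| ≤ N) →
      TimeBC1 f f' := fun hf h1 h2 => ⟨hf, _, fun x _ t => ⟨h1 _, h2 _⟩⟩
  have hκ : ∀ j k, TimeBC1 (Y.κ j k) (Y.κ' j k) := fun j k =>
    hbc (Y.κ_c1 j k) (Y.κ_le j k) (Y.κ'_le j k)
  have hα : ∀ j, TimeBC1 (Y.α j) (fun q => -clampExt' (S.a j) q / clampExt (S.a j) q ^ 2) := by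
    intro j
    rw [hYα j]
    refine ⟨(h.a_bc j).timeC1.inv fun q => h.a_ne_zero j (mem_strip_clamp q),
      Λ⁻¹ + M * Λ⁻¹ ^ 2, fun x _ t => ⟨?_, ?_⟩⟩
    · have h1 := h.abs_inv_le j (mem_strip_clamp (x, t))
      have := h.M_pos
      exact h1.trans (le_add_of_nonneg_right (by positivity))
    · have h1 := h.abs_inv_le j (mem_strip_clamp (x, t))
      rw [div_eq_mul_inv, abs_mul, abs_neg, ← inv_pow, abs_pow]
      have h2 : |clampExt' (S.a j) (x, t)| * |(clampExt (S.a j) (x, t))⁻¹| ^ 2 ≤ M * Λ⁻¹ ^ 2 :=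
        mul_le_mul (abs_apply_le (h.a_le j _ (mem_strip_clamp (x, t))).2)
          (pow_le_pow_left₀ (abs_nonneg _) h1 2) (by positivity) h.M_pos.le
      exact h2.trans (le_add_of_nonneg_left (inv_nonneg.2 h.Λ_pos.le))
  have hF0 := fun j => (((TimeBC1.of_space (hφd1 j).continuous).add
    ((hα j).mul (TimeBC1.of_space (hg1 j).continuous))).add (TimeBC1.sum (s := Finset.univ)
      fun k => (hκ j k).mul (TimeBC1.of_space (hφ1 k).continuous))).neg
  have hF1 := fun j => ((TimeBC1.of_space ((hg1 j).continuous_deriv_one)).add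
    (TimeBC1.sum (s := Finset.univ)
      fun k => (hκ j k).mul (TimeBC1.of_space (hg1 k).continuous))).neg
  set F0 : Fin n → ℝ × ℝ → ℝ := fun j q =>
    -(deriv (φ j) q.1 + Y.α j q * g j q.1 + ∑ k, Y.κ j k q * φ k q.1) with hF0d
  set F1 : Fin n → ℝ × ℝ → ℝ := fun j q => -(deriv (g j) q.1 + ∑ k, Y.κ j k q * g k q.1) with hF1d
  obtain ⟨F0', hF0'⟩ : ∃ F0' : Fin n → ℝ × ℝ → ℝ, ∀ j, TimeBC1 (F0 j) (F0' j) := ⟨_, hF0⟩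
  obtain ⟨F1', hF1'⟩ : ∃ F1' : Fin n → ℝ × ℝ → ℝ, ∀ j, TimeBC1 (F1 j) (F1' j) := ⟨_, hF1⟩
  have hlin : TimeC1 (fun q : ℝ × ℝ => q.2 - τ) (fun _ => 1) :=
    TimeC1.of_time (k := fun t => t - τ) (k' := fun _ => 1) continuous_const
      fun t => (hasDerivAt_id t).sub_const τ
  have hf : ∀ j, TimeC1 (fun q => F0 j q + (q.2 - τ) * F1 j q)
      (fun q => F0' j q + (1 * F1 j q + (q.2 - τ) * F1' j q)) := fun j =>
    (hF0' j).toTimeC1.add (hlin.mul (hF1' j).toTimeC1)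
  have hαa : ∀ j x t, x ∈ Icc (0 : ℝ) 1 → Y.α j (x, t) = (S.a j (x, t))⁻¹ := fun j x t hx => by
    rw [hYα]; simp only [clampExt_of_mem _ hx]
  have hκa : ∀ j k x t, x ∈ Icc (0 : ℝ) 1 → Y.κ j k (x, t) = S.b j k (x, t) * (S.a j (x, t))⁻¹ :=
    fun j k x t hx => by rw [hYκ]; simp only [clampExt_of_mem _ hx]
  choose N0 hN0 using fun j => (hF0' j).bdd
  choose N1 hN1 using fun j => (hF1' j).bdd
  set N := ∑ j, (|N0 j| + |N1 j|) with hN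
  have hNj : ∀ j, |N0 j| + |N1 j| ≤ N := fun j =>
    Finset.single_le_sum (f := fun j => |N0 j| + |N1 j|) (fun _ _ => by positivity)
      (Finset.mem_univ j)
  have hNnn : 0 ≤ N := Finset.sum_nonneg fun _ _ => by positivity
  -- This is the choice of `g`; outside the open interval all terms vanish with the test functions.
  have hsrc0 : ∀ j x, F0 j (x, τ) + (τ - τ) * F1 j (x, τ) = 0 := by
    intro j x
    simp only [sub_self, zero_mul, add_zero, hF0d]
    by_cases hx : x ∈ Ioo (0 : ℝ) 1
    · have hx' : x ∈ Icc (0 : ℝ) 1 := Ioo_subset_Icc_self hx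
      have ha0 : S.a j (x, τ) ≠ 0 := h.a_ne_zero j (mem_closedStrip.2 hx')
      simp only [hαa j x τ hx', hκa j _ x τ hx', hg]
      have e1 : ∑ k, S.b j k (x, τ) * (S.a j (x, τ))⁻¹ * φ k x =
          (S.a j (x, τ))⁻¹ * ∑ k, S.b j k (x, τ) * φ k x := by
        rw [Finset.mul_sum]
        exact Finset.sum_congr rfl fun k _ => by ring
      rw [e1]
      field_simp
      ring
    · simp [hφd0 j x hx, hg0 j x hx, hφ0 _ x hx]
  have hsrc : ∀ j, ∀ x ∈ Icc (0 : ℝ) 1, ∀ t, τ ≤ t →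
      |F0 j (x, t) + (t - τ) * F1 j (x, t)| ≤ N * (1 + (t - τ)) ∧
        |F0' j (x, t) + (1 * F1 j (x, t) + (t - τ) * F1' j (x, t))| ≤ N * (1 + (t - τ)) := by
    intro j x hx t ht
    have a0 := hN0 j x hx t
    have a1 := hN1 j x hx t
    have b0 := le_abs_self (N0 j)
    have b1 := le_abs_self (N1 j)
    have c := hNj j
    have ht' : 0 ≤ t - τ := by linarith
    have d := abs_nonneg (N0 j)
    have d' := abs_nonneg (N1 j)
    have hb : ∀ z, |z| ≤ N1 j → |(t - τ) * z| ≤ (t - τ) * N := fun z hz => by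
      rw [abs_mul, abs_of_nonneg ht']
      exact mul_le_mul_of_nonneg_left (by linarith) ht'
    constructor
    · refine (abs_add_le _ _).trans ?_
      have := hb _ a1.1
      linarith [a0.1]
    · refine (abs_add_le _ _).trans ((add_le_add_right (abs_add_le _ _) _).trans ?_)
      have := hb _ a1.2
      simp only [one_mul]
      linarith [a0.2, a1.1]
  obtain ⟨V, hVc, hV0, hVb, hVe⟩ := Y.exists_solution (τ := τ) (M₀ := N)
    (f := fun j q => F0 j q + (q.2 - τ) * F1 j q) hNnn (fun j => (hα j).cont) hf hsrc0 hsrc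
  refine ⟨fun j q => φ j q.1 + (q.2 - τ) * g j q.1 + V j q, ?_, ?_, ?_, ?_⟩
  · intro j
    have h1 := hφ1 j
    have h2 := hg1 j
    have h3 := hVc j
    exact ContDiff.contDiffOn (by fun_prop)
  · intro j x hx t ht
    have hx' : x ∈ Icc (0 : ℝ) 1 := Ioo_subset_Icc_self hx
    obtain ⟨vx, vt, hvx, hvt, heq⟩ := hVe j x hx' t ht.le
    have d1 : HasDerivAt (fun s => φ j x + (s - τ) * g j x + V j (x, s)) (g j x + vt) t := by
      have := (((hasDerivAt_id t).sub_const τ).mul_const (g j x)).const_add (φ j x)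
      exact (this.add hvt).congr_deriv (by simp)
    have d2 : HasDerivAt (fun y => φ j y + (t - τ) * g j y + V j (y, t))
        (deriv (φ j) x + (t - τ) * deriv (g j) x + vx) x :=
      ((hφd j x).add ((hgd j x).const_mul (t - τ))).add hvx
    simp only [d1.deriv, d2.deriv]
    have ha0 : S.a j (x, t) ≠ 0 := h.a_ne_zero j (mem_closedStrip.2 hx')
    simp only [hF0d, hF1d, hαa j x t hx', hκa j _ x t hx'] at heq
    have e1 : ∀ w : Fin n → ℝ, S.a j (x, t) * ∑ k, S.b j k (x, t) * (S.a j (x, t))⁻¹ * w k =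
        ∑ k, S.b j k (x, t) * w k := fun w => by
      rw [Finset.mul_sum]
      refine Finset.sum_congr rfl fun k _ => ?_
      field_simp
    -- The sideways equation has unit coefficient at `∂ₓ`; multiplication by `a_j` returns to the
    -- original form.
    have heq2 := congrArg (fun z => S.a j (x, t) * z) heq
    simp only [mul_add, mul_neg, ← mul_assoc, mul_comm (S.a j (x, t)) (t - τ)] at heq2
    simp only [mul_assoc, mul_inv_cancel₀ ha0, one_mul] at heq2
    have e2 := e1 fun k => V k (x, t)
    have e3 := e1 fun k => φ k x
    have e4 := e1 fun k => g k x
    simp only [mul_assoc] at e2 e3 e4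
    rw [e2, e3, e4] at heq2
    have e5 : ∑ k, S.b j k (x, t) * (φ k x + (t - τ) * g k x + V k (x, t)) =
        ∑ k, S.b j k (x, t) * φ k x + (t - τ) * ∑ k, S.b j k (x, t) * g k x +
        ∑ k, S.b j k (x, t) * V k (x, t) := by
      rw [Finset.mul_sum, ← Finset.sum_add_distrib, ← Finset.sum_add_distrib]
      exact Finset.sum_congr rfl fun k _ => by ring
    rw [e5]
    linarith
  · intro j x hx
    simp [hV0 j x hx]
  · intro j t _
    -- At both ends `φ` and `g` vanish, so the boundary conditions reduce to those of `V`.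
    have hout : ∀ k, (S.outPt k : ℝ) ∉ Ioo (0 : ℝ) 1 := fun k => by
      unfold HyperbolicProblem.outPt; split_ifs <;> simp
    have hin : (S.inPt j : ℝ) ∉ Ioo (0 : ℝ) 1 := by
      unfold HyperbolicProblem.inPt; split_ifs <;> simp
    simp only [HyperbolicProblem.P, hφ0 _ _ hin, hg0 _ _ hin, hφ0 _ _ (hout _), hg0 _ _ (hout _),
      mul_zero, add_zero, zero_add]
    rw [← hYin j, hVb, hYp]
    simp only [hYout]

/-! ### Energy identities, traces and the energy estimate. -/

/-- The given partial derivatives matter only inside; the derivative within the closed rectangle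
provides the version that is continuous up to the boundary, hence integrable. -/
lemma integral2_divergence_rect {f g fx gt : ℝ × ℝ → ℝ} {x₁ x₂ t₁ t₂ : ℝ} (hx : x₁ ≤ x₂)
    (ht : t₁ ≤ t₂) (hf : ContDiffOn ℝ 1 f (Icc x₁ x₂ ×ˢ Icc t₁ t₂))
    (hg : ContDiffOn ℝ 1 g (Icc x₁ x₂ ×ˢ Icc t₁ t₂))
    (hfx : ∀ x ∈ Ioo x₁ x₂, ∀ t ∈ Ioo t₁ t₂, HasDerivAt (fun y => f (y, t)) (fx (x, t)) x)
    (hgt : ∀ x ∈ Ioo x₁ x₂, ∀ t ∈ Ioo t₁ t₂, HasDerivAt (fun s => g (x, s)) (gt (x, t)) t) :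
    ∫ x in x₁..x₂, ∫ t in t₁..t₂, fx (x, t) + gt (x, t) =
      (∫ x in x₁..x₂, g (x, t₂)) - (∫ x in x₁..x₂, g (x, t₁)) + (∫ t in t₁..t₂, f (x₂, t)) -
        ∫ t in t₁..t₂, f (x₁, t) := by
  rcases hx.eq_or_lt with rfl | hx'
  · simp
  rcases ht.eq_or_lt with rfl | ht'
  · simp
  set R := Icc x₁ x₂ ×ˢ Icc t₁ t₂ with hR
  have hu : UniqueDiffOn ℝ R := (uniqueDiffOn_Icc hx').prod (uniqueDiffOn_Icc ht')
  have hnhds : ∀ q ∈ Ioo x₁ x₂ ×ˢ Ioo t₁ t₂, R ∈ 𝓝 q := fun q hq =>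
    prod_mem_nhds (Icc_mem_nhds hq.1.1 hq.1.2) (Icc_mem_nhds hq.2.1 hq.2.2)
  have hsub : Ioo x₁ x₂ ×ˢ Ioo t₁ t₂ ⊆ R := prod_mono Ioo_subset_Icc_self Ioo_subset_Icc_self
  have hfd : ∀ {k : ℝ × ℝ → ℝ}, ContDiffOn ℝ 1 k R → ∀ q ∈ Ioo x₁ x₂ ×ˢ Ioo t₁ t₂,
      HasFDerivAt k (fderivWithin ℝ k R q) q := fun hk q hq =>
    ((hk.differentiableOn one_ne_zero) q (hsub hq)).hasFDerivWithinAt.hasFDerivAt (hnhds q hq)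
  have key := integral2_divergence_prod_of_hasFDerivAt f g (fderivWithin ℝ f R)
    (fderivWithin ℝ g R) x₁ t₁ x₂ t₂
    (by rw [uIcc_of_le hx, uIcc_of_le ht]; exact hf.continuousOn)
    (by rw [uIcc_of_le hx, uIcc_of_le ht]; exact hg.continuousOn)
    (by rw [min_eq_left hx, max_eq_right hx, min_eq_left ht, max_eq_right ht]; exact hfd hf)
    (by rw [min_eq_left hx, max_eq_right hx, min_eq_left ht, max_eq_right ht]; exact hfd hg)
    (by
      rw [uIcc_of_le hx, uIcc_of_le ht]
      refine ContinuousOn.integrableOn_compact (isCompact_Icc.prod isCompact_Icc) ?_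
      exact ((hf.continuousOn_fderivWithin hu le_rfl).clm_apply continuousOn_const).add
        ((hg.continuousOn_fderivWithin hu le_rfl).clm_apply continuousOn_const))
  rw [← key]
  refine intervalIntegral.integral_congr_Ioo_of_le hx fun x hxm => ?_
  refine intervalIntegral.integral_congr_Ioo_of_le ht fun t htm => ?_
  have d1 := HasFDerivAt.comp_hasDerivAt (f := fun y => (y, t)) x (hfd hf (x, t) ⟨hxm, htm⟩)
    ((hasDerivAt_id x).prodMk (hasDerivAt_const x t))
  have d2 := HasFDerivAt.comp_hasDerivAt (f := fun s => (x, s)) t (hfd hg (x, t) ⟨hxm, htm⟩)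
    ((hasDerivAt_const t x).prodMk (hasDerivAt_id t))
  simp only [(hfx x hxm t htm).unique d1, (hgt x hxm t htm).unique d2]

lemma abs_integral2_le {G H : ℝ × ℝ → ℝ} {x₁ x₂ t₁ t₂ : ℝ} (hx : x₁ ≤ x₂) (ht : t₁ ≤ t₂)
    (hH : Continuous H)
    (h : ∀ x ∈ Ioo x₁ x₂, ∀ t ∈ Ioo t₁ t₂, |G (x, t)| ≤ H (x, t)) :
    |∫ x in x₁..x₂, ∫ t in t₁..t₂, G (x, t)| ≤ ∫ x in x₁..x₂, ∫ t in t₁..t₂, H (x, t) := by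
  have hHx : Continuous fun x => ∫ t in t₁..t₂, H (x, t) :=
    intervalIntegral.continuous_parametric_intervalIntegral_of_continuous'
      (f := fun x t => H (x, t)) (by exact hH) _ _
  refine intervalIntegral.norm_integral_le_of_norm_le (f := fun x => ∫ t in t₁..t₂, G (x, t)) hx ?_
    (hHx.intervalIntegrable _ _)
  filter_upwards [Measure.ae_ne volume x₂] with x hxne hxm
  refine intervalIntegral.norm_integral_le_of_norm_le (f := fun t => G (x, t)) ht ?_
    ((hH.comp (by fun_prop : Continuous fun t : ℝ => (x, t))).intervalIntegrable _ _)
  filter_upwards [Measure.ae_ne volume t₂] with t htne htm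
  exact h x ⟨hxm.1, lt_of_le_of_ne hxm.2 hxne⟩ t ⟨htm.1, lt_of_le_of_ne htm.2 htne⟩

lemma integral2_swap {H : ℝ × ℝ → ℝ} (hH : Continuous H) (x₁ x₂ t₁ t₂ : ℝ) :
    ∫ x in x₁..x₂, ∫ t in t₁..t₂, H (x, t) = ∫ t in t₁..t₂, ∫ x in x₁..x₂, H (x, t) := by
  refine intervalIntegral_intervalIntegral_swap (F := fun x t => H (x, t)) ?_
  have h1 : IntegrableOn H (uIcc x₁ x₂ ×ˢ uIcc t₁ t₂) volume :=
    hH.continuousOn.integrableOn_compact (isCompact_uIcc.prod isCompact_uIcc)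
  exact h1.mono_set (prod_mono uIoc_subset_uIcc uIoc_subset_uIcc)

lemma gronwall_integral {E : ℝ → ℝ} (hE : Continuous E) {τ A c D : ℝ} (hc : 0 ≤ c) (hD : 0 ≤ D)
    (h : ∀ t, τ ≤ t → E t ≤ A + ∫ s in τ..t, (c * E s + D)) {t : ℝ} (ht : τ ≤ t) :
    E t ≤ (A + D * (t - τ)) * Real.exp (c * (t - τ)) := by
  set H : ℝ → ℝ := fun t => A + ∫ s in τ..t, (c * E s + D) with hH
  have hcE : Continuous fun s => c * E s + D := by fun_prop
  have hHd : ∀ t, HasDerivAt H (c * E t + D) t := fun t =>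
    (intervalIntegral.integral_hasDerivAt_right (hcE.intervalIntegrable _ _)
      (hcE.stronglyMeasurableAtFilter _ _) hcE.continuousAt).const_add A
  -- `G` is nonincreasing. Removing `D (t - τ)` directly, rather than with a quotient `D / c`,
  -- allows `c = 0`.
  set G : ℝ → ℝ := fun t => H t * Real.exp (-(c * (t - τ))) - D * (t - τ) with hG
  have hlin : ∀ t : ℝ, HasDerivAt (fun t => -(c * (t - τ))) (-c) t := fun t =>
    ((((hasDerivAt_id t).sub_const τ).const_mul c).neg).congr_deriv (by simp)
  have hGd : ∀ t, HasDerivAt G ((c * E t + D) * Real.exp (-(c * (t - τ))) +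
      H t * (Real.exp (-(c * (t - τ))) * -c) - D) t := fun t =>
    (((hHd t).mul (hlin t).exp).sub (((hasDerivAt_id t).sub_const τ).const_mul D)).congr_deriv
      (by simp)
  have hanti : AntitoneOn G (Ici τ) := by
    refine antitoneOn_of_deriv_nonpos (convex_Ici τ)
      (fun t _ => (hGd t).continuousAt.continuousWithinAt)
      (fun t _ => (hGd t).differentiableAt.differentiableWithinAt) fun t ht => ?_
    rw [interior_Ici] at ht
    rw [(hGd t).deriv]
    have h1 := h t (le_of_lt ht)
    have h2 : 0 < Real.exp (-(c * (t - τ))) := Real.exp_pos _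
    have h3 : Real.exp (-(c * (t - τ))) ≤ 1 := by
      rw [Real.exp_le_one_iff]
      have : 0 ≤ c * (t - τ) := mul_nonneg hc (by linarith [mem_Ioi.1 ht])
      linarith
    have h4 : c * E t ≤ c * H t := mul_le_mul_of_nonneg_left h1 hc
    have h5 := mul_le_mul_of_nonneg_right h4 h2.le
    have h6 := mul_le_mul_of_nonneg_left h3 hD
    nlinarith
  have h1 : G t ≤ G τ := hanti self_mem_Ici ht ht
  have h2 : G τ = A := by simp [hG, hH]
  have h3 : H t * Real.exp (-(c * (t - τ))) ≤ A + D * (t - τ) := by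
    rw [h2] at h1; simp only [hG] at h1; linarith
  have h4 := mul_le_mul_of_nonneg_right h3 (Real.exp_nonneg (c * (t - τ)))
  rw [mul_assoc, ← Real.exp_add, neg_add_cancel, Real.exp_zero, mul_one] at h4
  exact (h t ht).trans h4

/-- The continuous extension of a function on the half-strip `t ≥ τ`. -/
noncomputable def halfExt {n : ℕ} (τ : ℝ) (u : Fin n → ℝ × ℝ → ℝ) (k : Fin n) (q : ℝ × ℝ) : ℝ :=
  u k (clampUnit q.1, max q.2 τ)

section halfExt

variable {n : ℕ} {τ : ℝ} {u : Fin n → ℝ × ℝ → ℝ}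

lemma halfExt_of_mem (u : Fin n → ℝ × ℝ → ℝ) {x t : ℝ} (hx : x ∈ Icc (0 : ℝ) 1) (ht : τ ≤ t)
    (k : Fin n) : halfExt τ u k (x, t) = u k (x, t) := by
  simp only [halfExt, clampUnit_of_mem hx, max_eq_left ht]

lemma continuous_halfExt (hu : ∀ j, ContDiffOn ℝ 1 (u j) (Icc (0 : ℝ) 1 ×ˢ Ici τ)) (k : Fin n) :
    Continuous (halfExt τ u k) :=
  (hu k).continuousOn.comp_continuous
    ((continuous_clampUnit.comp continuous_fst).prodMk (continuous_snd.max continuous_const))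
    fun q => ⟨clampUnit_mem q.1, le_max_right q.2 τ⟩

/-- The sum of squares of the components. -/
noncomputable def sqSum (τ : ℝ) (u : Fin n → ℝ × ℝ → ℝ) (q : ℝ × ℝ) : ℝ :=
  ∑ k, halfExt τ u k q ^ 2

/-- The square of the norm in `L²(0,1)ⁿ` at time `t`. -/
noncomputable def energy (τ : ℝ) (u : Fin n → ℝ × ℝ → ℝ) (t : ℝ) : ℝ :=
  ∫ x in (0 : ℝ)..1, sqSum τ u (x, t)

lemma continuous_sqSum (hu : ∀ j, ContDiffOn ℝ 1 (u j) (Icc (0 : ℝ) 1 ×ˢ Ici τ)) :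
    Continuous (sqSum τ u) :=
  continuous_finsetSum _ fun k _ => (continuous_halfExt hu k).pow 2

lemma sqSum_nonneg (q : ℝ × ℝ) : 0 ≤ sqSum τ u q := Finset.sum_nonneg fun _ _ => sq_nonneg _

lemma energy_nonneg (t : ℝ) : 0 ≤ energy τ u t :=
  intervalIntegral.integral_nonneg zero_le_one fun _ _ => sqSum_nonneg _

lemma continuous_energy (hu : ∀ j, ContDiffOn ℝ 1 (u j) (Icc (0 : ℝ) 1 ×ˢ Ici τ)) :
    Continuous (energy τ u) :=
  intervalIntegral.continuous_parametric_intervalIntegral_of_continuous'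
    (f := fun t x => sqSum τ u (x, t)) ((continuous_sqSum hu).comp continuous_swap) _ _

lemma sq_le_sqSum (k : Fin n) {x t : ℝ} (hx : x ∈ Icc (0 : ℝ) 1) (ht : τ ≤ t) :
    u k (x, t) ^ 2 ≤ sqSum τ u (x, t) := by
  rw [← halfExt_of_mem u hx ht]
  exact Finset.single_le_sum (f := fun k => halfExt τ u k (x, t) ^ 2) (fun _ _ => sq_nonneg _)
    (Finset.mem_univ k)

end halfExt

/-- A `C¹` function that satisfies the boundary conditions and, up to an error of size `R`, the
differential equations. -/
structure IsNearSolution {n : ℕ} (S : HyperbolicProblem n) (τ R : ℝ) (u : Fin n → ℝ × ℝ → ℝ) :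
    Prop where
  contDiffOn : ∀ j, ContDiffOn ℝ 1 (u j) (Icc (0 : ℝ) 1 ×ˢ Ici τ)
  residual : ∀ j, ∀ x ∈ Ioo (0 : ℝ) 1, ∀ t, τ < t →
    |deriv (fun s => u j (x, s)) t + S.a j (x, t) * deriv (fun y => u j (y, t)) x
      + ∑ k, S.b j k (x, t) * u k (x, t)| ≤ R
  boundary : ∀ j, ∀ t, τ ≤ t → u j ((S.inPt j : ℝ), t) = S.P u j t

lemma HyperbolicProblem.IsClassicalSolution.isNearSolution {n : ℕ} {S : HyperbolicProblem n}
    {τ : ℝ} {φ : Fin n → ℝ → ℝ} {u : Fin n → ℝ × ℝ → ℝ} (hu : S.IsClassicalSolution τ φ u) :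
    IsNearSolution S τ 0 u :=
  ⟨hu.contDiffOn, fun j x hx t ht => by rw [hu.equation j x hx t ht, abs_zero], hu.boundary⟩

lemma hasDerivAt_of_contDiffOn_half {τ : ℝ} {v : ℝ × ℝ → ℝ}
    (hv : ContDiffOn ℝ 1 v (Icc (0 : ℝ) 1 ×ˢ Ici τ)) {x t : ℝ} (hx : x ∈ Ioo (0 : ℝ) 1)
    (ht : τ < t) :
    HasFDerivAt v (deriv (fun y => v (y, t)) x • ContinuousLinearMap.fst ℝ ℝ ℝ +
      deriv (fun s => v (x, s)) t • ContinuousLinearMap.snd ℝ ℝ ℝ) (x, t) ∧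
    HasDerivAt (fun y => v (y, t)) (deriv (fun y => v (y, t)) x) x ∧
    HasDerivAt (fun s => v (x, s)) (deriv (fun s => v (x, s)) t) t := by
  have hn : Icc (0 : ℝ) 1 ×ˢ Ici τ ∈ 𝓝 (x, t) :=
    prod_mem_nhds (Icc_mem_nhds hx.1 hx.2) (Ici_mem_nhds ht)
  have h0 : HasFDerivAt v (fderiv ℝ v (x, t)) (x, t) :=
    ((hv.contDiffAt hn).differentiableAt one_ne_zero).hasFDerivAt
  have d1 := HasFDerivAt.comp_hasDerivAt (f := fun y => (y, t)) x h0
    ((hasDerivAt_id x).prodMk (hasDerivAt_const x t))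
  have d2 := HasFDerivAt.comp_hasDerivAt (f := fun s => (x, s)) t h0
    ((hasDerivAt_const t x).prodMk (hasDerivAt_id t))
  have e1 : deriv (fun y => v (y, t)) x = fderiv ℝ v (x, t) (1, 0) := d1.deriv
  have e2 : deriv (fun s => v (x, s)) t = fderiv ℝ v (x, t) (0, 1) := d2.deriv
  refine ⟨h0.congr_fderiv ?_, by rw [e1]; exact d1, by rw [e2]; exact d2⟩
  rw [e1, e2]
  ext <;> simp

lemma IsBC1.hasDerivAt_fst {a : ℝ × ℝ → ℝ} (ha : IsBC1 a) {x : ℝ} (hx : x ∈ Ioo (0 : ℝ) 1)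
    (t : ℝ) :
    HasDerivAt (fun y => a (y, t)) (fderivWithin ℝ a closedStrip (x, t) (1, 0)) x := by
  have h0 : HasFDerivAt a (fderivWithin ℝ a closedStrip (x, t)) (x, t) :=
    ((ha.1.differentiableOn one_ne_zero) _
      (mem_closedStrip.2 (Ioo_subset_Icc_self hx))).hasFDerivWithinAt.hasFDerivAt
      (closedStrip_mem_nhds hx t)
  exact HasFDerivAt.comp_hasDerivAt (f := fun y => (y, t)) x h0
    ((hasDerivAt_id x).prodMk (hasDerivAt_const x t))

lemma abs_apply_fst_le {L : ℝ × ℝ →L[ℝ] ℝ} {M : ℝ} (h : ‖L‖ ≤ M) : |L (1, 0)| ≤ M := by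
  have h1 : ‖((1 : ℝ), (0 : ℝ))‖ = 1 := by simp [Prod.norm_def]
  have := L.le_opNorm (1, 0)
  rw [h1, mul_one] at this
  exact this.trans h

/-- With `A = a_j`, weight `W` and `ρ = ∂ₜu_j + a_j ∂ₓu_j`, the left-hand side is the divergence of
`(A W u_j², W u_j²)`. Derivatives of `u` enter only through `ρ`, which the equation replaces by
terms of order zero up to the error `R`. -/
lemma abs_energy_density_le {n : ℕ} {M R A A' W W' ρ : ℝ} (hM : 0 < M)
    {v b : Fin n → ℝ} (j : Fin n) (hA : |A| ≤ M) (hA' : |A'| ≤ M) (hW : |W| ≤ 1) (hW' : |W'| ≤ 1)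
    (hb : ∀ k, |b k| ≤ M) (hρ : |ρ + ∑ k, b k * v k| ≤ R) :
    |(A' * W + A * W') * v j ^ 2 + 2 * W * v j * ρ| ≤
      (2 * M + 1 + n * M + M) * ∑ k, v k ^ 2 + R ^ 2 := by
  set s := ∑ k, v k ^ 2 with hs
  have hj : v j ^ 2 ≤ s :=
    Finset.single_le_sum (f := fun k => v k ^ 2) (fun _ _ => sq_nonneg _) (Finset.mem_univ j)
  have h1 : |(A' * W + A * W') * v j ^ 2| ≤ 2 * M * s := by
    rw [abs_mul, abs_of_nonneg (sq_nonneg (v j))]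
    refine mul_le_mul ?_ hj (sq_nonneg _) (by positivity)
    refine (abs_add_le _ _).trans ?_
    rw [abs_mul, abs_mul]
    have e1 := mul_le_mul hA' hW (abs_nonneg _) hM.le
    have e2 := mul_le_mul hA hW' (abs_nonneg _) hM.le
    linarith
  have h2 : |ρ| ≤ R + M * ∑ k, |v k| := by
    have e1 : |∑ k, b k * v k| ≤ M * ∑ k, |v k| := by
      refine (Finset.abs_sum_le_sum_abs _ _).trans ?_
      rw [Finset.mul_sum]
      refine Finset.sum_le_sum fun k _ => ?_
      rw [abs_mul]
      exact mul_le_mul_of_nonneg_right (hb k) (abs_nonneg _)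
    calc |ρ| = |(ρ + ∑ k, b k * v k) - ∑ k, b k * v k| := by ring_nf
      _ ≤ _ := (abs_sub _ _).trans (add_le_add hρ e1)
  have h3 : 2 * |v j| * |ρ| ≤ (1 + n * M + M) * s + R ^ 2 := by
    have e1 : 2 * |v j| * |ρ| ≤ 2 * |v j| * (R + M * ∑ k, |v k|) :=
      mul_le_mul_of_nonneg_left h2 (by positivity)
    have e2 : 2 * |v j| * R ≤ v j ^ 2 + R ^ 2 := by
      have := two_mul_le_add_sq |v j| R
      rwa [sq_abs] at this
    have e3 : 2 * |v j| * ∑ k, |v k| ≤ n * v j ^ 2 + s := by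
      rw [Finset.mul_sum]
      have : ∀ k, 2 * |v j| * |v k| ≤ v j ^ 2 + v k ^ 2 := fun k => by
        have := two_mul_le_add_sq |v j| |v k|
        rwa [sq_abs, sq_abs] at this
      refine (Finset.sum_le_sum fun k _ => this k).trans_eq ?_
      rw [Finset.sum_add_distrib]; simp [hs]
    have e4 := mul_le_mul_of_nonneg_left e3 hM.le
    have e5 : n * M * v j ^ 2 ≤ n * M * s := mul_le_mul_of_nonneg_left hj (by positivity)
    nlinarith
  have h4 : |2 * W * v j * ρ| ≤ 2 * |v j| * |ρ| := by
    rw [abs_mul, abs_mul, abs_mul, abs_two]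
    have : 2 * |W| * |v j| * |ρ| = |W| * (2 * |v j| * |ρ|) := by ring
    rw [this]
    exact mul_le_of_le_one_left (by positivity) hW
  refine (abs_add_le _ _).trans ?_
  linarith

/-- The divergence theorem for `(a_j w u_j², w u_j²)` on a rectangle. The affine weight `w` is free:
it is used to remove one lateral side when a trace is isolated, and to discount the inflow end in
the energy estimate. -/
lemma IsNearSolution.abs_flux_le {n : ℕ} {S : HyperbolicProblem n} {Λ M τ R : ℝ}
    (h : CoeffBounds S Λ M) {u : Fin n → ℝ × ℝ → ℝ} (hu : IsNearSolution S τ R u)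
    (j : Fin n) {w₀ w₁ x₁ x₂ t₁ t₂ : ℝ} (hw₁ : |w₁| ≤ 1)
    (hw : ∀ x ∈ Icc (0 : ℝ) 1, |w₀ + w₁ * x| ≤ 1) (hx₁ : 0 ≤ x₁) (hx : x₁ ≤ x₂) (hx₂ : x₂ ≤ 1)
    (ht₁ : τ ≤ t₁) (ht : t₁ ≤ t₂) :
    |(∫ x in x₁..x₂, (w₀ + w₁ * x) * u j (x, t₂) ^ 2) -
        (∫ x in x₁..x₂, (w₀ + w₁ * x) * u j (x, t₁) ^ 2) +
        (∫ t in t₁..t₂, S.a j (x₂, t) * (w₀ + w₁ * x₂) * u j (x₂, t) ^ 2) -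
        ∫ t in t₁..t₂, S.a j (x₁, t) * (w₀ + w₁ * x₁) * u j (x₁, t) ^ 2| ≤
      ∫ t in t₁..t₂, ((2 * M + 1 + n * M + M) * energy τ u t + R ^ 2) := by
  have hsub : Icc x₁ x₂ ×ˢ Icc t₁ t₂ ⊆ Icc (0 : ℝ) 1 ×ˢ Ici τ :=
    prod_mono (Icc_subset_Icc hx₁ hx₂) fun s hs => mem_Ici.2 (ht₁.trans hs.1)
  have hsub' : Icc x₁ x₂ ×ˢ Icc t₁ t₂ ⊆ closedStrip := fun q hq => ⟨(hsub hq).1, trivial⟩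
  have hu1 := (hu.contDiffOn j).mono hsub
  have ha1 := (h.a_bc j).1.mono hsub'
  have hw1 : ContDiff ℝ 1 fun q : ℝ × ℝ => w₀ + w₁ * q.1 := by fun_prop
  set FX : ℝ × ℝ → ℝ := fun q => (fderivWithin ℝ (S.a j) closedStrip q (1, 0) * (w₀ + w₁ * q.1) +
      S.a j q * w₁) * u j q ^ 2 + S.a j q * (w₀ + w₁ * q.1) *
        (2 * u j q * deriv (fun y => u j (y, q.2)) q.1) with hFX
  set GT : ℝ × ℝ → ℝ := fun q =>
    (w₀ + w₁ * q.1) * (2 * u j q * deriv (fun s => u j (q.1, s)) q.2) with hGT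
  have hdiv := integral2_divergence_rect (f := fun q => S.a j q * (w₀ + w₁ * q.1) * u j q ^ 2)
    (g := fun q => (w₀ + w₁ * q.1) * u j q ^ 2)
    (fx := FX) (gt := GT)
    hx ht ((ha1.mul hw1.contDiffOn).mul (hu1.pow 2)) (hw1.contDiffOn.mul (hu1.pow 2))
    (fun x hxm t htm => ?_) (fun x hxm t htm => ?_)
  · rw [← hdiv]
    have hmem : ∀ x ∈ Ioo x₁ x₂, x ∈ Ioo (0 : ℝ) 1 := fun x hx =>
      ⟨hx₁.trans_lt hx.1, hx.2.trans_le hx₂⟩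
    have hHc : Continuous fun q => (2 * M + 1 + n * M + M) * sqSum τ u q + R ^ 2 := by
      have := continuous_sqSum hu.contDiffOn
      fun_prop
    refine (abs_integral2_le (G := fun q => FX q + GT q) hx ht hHc fun x hxm t htm => ?_).trans ?_
    · have hx' := hmem x hxm
      have hxc := Ioo_subset_Icc_self hx'
      have ht' : τ < t := ht₁.trans_lt htm.1
      have hq : (x, t) ∈ closedStrip := mem_closedStrip.2 hxc
      have := abs_energy_density_le h.M_pos (v := fun k => u k (x, t))
        (b := fun k => S.b j k (x, t)) j (h.a_le j _ hq).1
        (abs_apply_fst_le (h.a_le j _ hq).2) (hw x hxc) hw₁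
        (fun k => (h.b_le j k _ hq).1) (hu.residual j x hx' t ht')
      simp only [sqSum, halfExt_of_mem u hxc ht'.le]
      refine le_trans (le_of_eq ?_) this
      congr 1
      simp only [hFX, hGT]
      ring
    · rw [integral2_swap hHc]
      have hcx : Continuous fun t => ∫ x in x₁..x₂,
          ((2 * M + 1 + n * M + M) * sqSum τ u (x, t) + R ^ 2) :=
        intervalIntegral.continuous_parametric_intervalIntegral_of_continuous'
          (f := fun t x => (2 * M + 1 + n * M + M) * sqSum τ u (x, t) + R ^ 2)
          (hHc.comp continuous_swap) _ _
      have hce : Continuous fun t => (2 * M + 1 + n * M + M) * energy τ u t + R ^ 2 := by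
        have := continuous_energy hu.contDiffOn
        fun_prop
      refine intervalIntegral.integral_mono_on ht (hcx.intervalIntegrable _ _)
        (hce.intervalIntegrable _ _) fun t _ => ?_
      have hM := h.M_pos
      have hline : Continuous fun x => (2 * M + 1 + n * M + M) * sqSum τ u (x, t) + R ^ 2 :=
        hHc.comp (by fun_prop : Continuous fun x : ℝ => (x, t))
      have hs : Continuous fun x => sqSum τ u (x, t) :=
        (continuous_sqSum hu.contDiffOn).comp (by fun_prop : Continuous fun x : ℝ => (x, t))
      calc ∫ x in x₁..x₂, ((2 * M + 1 + n * M + M) * sqSum τ u (x, t) + R ^ 2)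
          ≤ ∫ x in (0 : ℝ)..1, ((2 * M + 1 + n * M + M) * sqSum τ u (x, t) + R ^ 2) := by
            refine intervalIntegral.integral_mono_interval hx₁ hx hx₂
              (Eventually.of_forall fun x => ?_) (hline.intervalIntegrable _ _)
            have := sqSum_nonneg (τ := τ) (u := u) (x, t)
            simp only [Pi.zero_apply]
            positivity
        _ = _ := by
            rw [intervalIntegral.integral_add ((hs.const_mul _).intervalIntegrable _ _)
              intervalIntegrable_const, intervalIntegral.integral_const_mul]
            simp [energy]
  · have hx' : x ∈ Ioo (0 : ℝ) 1 := ⟨hx₁.trans_lt hxm.1, hxm.2.trans_le hx₂⟩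
    have d1 := (h.a_bc j).hasDerivAt_fst hx' t
    have d2 := (hasDerivAt_of_contDiffOn_half (hu.contDiffOn j) hx' (ht₁.trans_lt htm.1)).2.1
    have d3 : HasDerivAt (fun y : ℝ => w₀ + w₁ * y) w₁ x := by
      simpa using ((hasDerivAt_id x).const_mul w₁).const_add w₀
    refine ((d1.mul d3).mul (d2.pow 2)).congr_deriv ?_
    simp [hFX]
  · have hx' : x ∈ Ioo (0 : ℝ) 1 := ⟨hx₁.trans_lt hxm.1, hxm.2.trans_le hx₂⟩
    have d2 := (hasDerivAt_of_contDiffOn_half (hu.contDiffOn j) hx' (ht₁.trans_lt htm.1)).2.2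
    refine ((d2.pow 2).const_mul (w₀ + w₁ * x)).congr_deriv ?_
    simp [hGT]

lemma continuousOn_const_mk {τ : ℝ} {v : ℝ × ℝ → ℝ} (hv : ContinuousOn v (Icc (0 : ℝ) 1 ×ˢ Ici τ))
    {x t₁ t₂ : ℝ} (hx : x ∈ Icc (0 : ℝ) 1) (ht₁ : τ ≤ t₁) (ht : t₁ ≤ t₂) :
    ContinuousOn (fun t => v (x, t)) (uIcc t₁ t₂) :=
  hv.comp (by fun_prop) fun t h => ⟨hx, by rw [uIcc_of_le ht] at h; exact ht₁.trans h.1⟩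

lemma continuousOn_mk_const {τ : ℝ} {v : ℝ × ℝ → ℝ} (hv : ContinuousOn v (Icc (0 : ℝ) 1 ×ˢ Ici τ))
    {t x₁ x₂ : ℝ} (ht : τ ≤ t) (hx₁ : 0 ≤ x₁) (hx : x₁ ≤ x₂) (hx₂ : x₂ ≤ 1) :
    ContinuousOn (fun x => v (x, t)) (uIcc x₁ x₂) :=
  hv.comp (by fun_prop) fun x h => ⟨by
    rw [uIcc_of_le hx] at h; exact ⟨hx₁.trans h.1, h.2.trans hx₂⟩, ht⟩

lemma integral_sq_le_energy {n : ℕ} {τ : ℝ} {u : Fin n → ℝ × ℝ → ℝ}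
    (hu : ∀ j, ContDiffOn ℝ 1 (u j) (Icc (0 : ℝ) 1 ×ˢ Ici τ)) (j : Fin n) {t : ℝ} (ht : τ ≤ t)
    {x₁ x₂ : ℝ} (hx₁ : 0 ≤ x₁) (hx : x₁ ≤ x₂) (hx₂ : x₂ ≤ 1) {w : ℝ → ℝ}
    (hw : ∀ x ∈ Icc (0 : ℝ) 1, |w x| ≤ 1) :
    |∫ x in x₁..x₂, w x * u j (x, t) ^ 2| ≤ energy τ u t := by
  have hs : Continuous fun x => sqSum τ u (x, t) :=
    (continuous_sqSum hu).comp (by fun_prop : Continuous fun x : ℝ => (x, t))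
  have h1 : |∫ x in x₁..x₂, w x * u j (x, t) ^ 2| ≤ ∫ x in x₁..x₂, sqSum τ u (x, t) := by
    refine intervalIntegral.norm_integral_le_of_norm_le (f := fun x => w x * u j (x, t) ^ 2) hx
      (Eventually.of_forall fun x hxm => ?_) (hs.intervalIntegrable _ _)
    have hx' : x ∈ Icc (0 : ℝ) 1 := ⟨hx₁.trans hxm.1.le, hxm.2.trans hx₂⟩
    rw [norm_mul, Real.norm_eq_abs, Real.norm_eq_abs, abs_of_nonneg (sq_nonneg (u j (x, t)))]
    exact (mul_le_of_le_one_left (sq_nonneg _) (hw x hx')).trans (sq_le_sqSum j hx' ht)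
  exact h1.trans (intervalIntegral.integral_mono_interval hx₁ hx hx₂
    (Eventually.of_forall fun x => sqSum_nonneg _) (hs.intervalIntegrable _ _))

/-- The trace of a near solution on a time-like segment is controlled by the energy. -/
lemma IsNearSolution.trace_le {n : ℕ} {S : HyperbolicProblem n} {Λ M τ : ℝ}
    (h : CoeffBounds S Λ M) {u : Fin n → ℝ × ℝ → ℝ} (hu : IsNearSolution S τ 0 u)
    (j : Fin n) {x t₁ t₂ B : ℝ} (hx : x ∈ Icc (0 : ℝ) 1) (ht₁ : τ ≤ t₁) (ht : t₁ ≤ t₂)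
    (hB : ∀ t ∈ Icc t₁ t₂, energy τ u t ≤ B) :
    Λ * ∫ t in t₁..t₂, u j (x, t) ^ 2 ≤
      (4 + 2 * (2 * M + 1 + n * M + M) * (t₂ - t₁)) * B := by
  have hM := h.M_pos
  set c := 2 * M + 1 + n * M + M with hc
  have hc0 : 0 ≤ c := by positivity
  have hu1 := hu.contDiffOn
  have hce := continuous_energy hu1
  have hI : ∫ t in t₁..t₂, (c * energy τ u t + 0 ^ 2) ≤ c * (t₂ - t₁) * B := by
    have h1 : ∫ t in t₁..t₂, (c * energy τ u t + 0 ^ 2) ≤ ∫ _t in t₁..t₂, c * B := by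
      refine intervalIntegral.integral_mono_on ht
        (Continuous.intervalIntegrable (by fun_prop) _ _) intervalIntegrable_const fun t htm => ?_
      have := mul_le_mul_of_nonneg_left (hB t htm) hc0
      linarith
    refine h1.trans_eq ?_
    simp; ring
  -- The weight `x` on `[0,x]` kills the side at `0`, the weight `x - 1` on `[x,1]` the side at `1`.
  -- The fluxes through the common side are `x J` and `-(x - 1) J`, which add up to `J`.
  have f1 := hu.abs_flux_le h j (w₀ := 0) (w₁ := 1) (x₁ := 0) (x₂ := x) (by simp)
    (fun y hy => by rw [abs_of_nonneg (by linarith [hy.1])]; linarith [hy.2]) le_rfl hx.1 hx.2 ht₁ ht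
  have f2 := hu.abs_flux_le h j (w₀ := -1) (w₁ := 1) (x₁ := x) (x₂ := 1) (by simp)
    (fun y hy => by rw [abs_of_nonpos (by linarith [hy.2])]; linarith [hy.1]) hx.1 hx.2 le_rfl ht₁ ht
  have g : ∀ (w₀ : ℝ), (∀ y ∈ Icc (0 : ℝ) 1, |w₀ + 1 * y| ≤ 1) → ∀ x₁ x₂ t, 0 ≤ x₁ → x₁ ≤ x₂ →
      x₂ ≤ 1 → t ∈ Icc t₁ t₂ → |∫ x in x₁..x₂, (w₀ + 1 * x) * u j (x, t) ^ 2| ≤ B :=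
    fun w₀ hw x₁ x₂ t h1 h2 h3 h4 => (integral_sq_le_energy hu1 j (ht₁.trans h4.1) h1 h2 h3
      hw).trans (hB t h4)
  have w0 : ∀ y ∈ Icc (0 : ℝ) 1, |0 + 1 * y| ≤ 1 := fun y hy => by
    rw [abs_of_nonneg (by linarith [hy.1])]; linarith [hy.2]
  have w1 : ∀ y ∈ Icc (0 : ℝ) 1, |-1 + 1 * y| ≤ 1 := fun y hy => by
    rw [abs_of_nonpos (by linarith [hy.2])]; linarith [hy.1]
  have g1 := g 0 w0 0 x t₂ le_rfl hx.1 hx.2 (right_mem_Icc.2 ht)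
  have g2 := g 0 w0 0 x t₁ le_rfl hx.1 hx.2 (left_mem_Icc.2 ht)
  have g3 := g (-1) w1 x 1 t₂ hx.1 hx.2 le_rfl (right_mem_Icc.2 ht)
  have g4 := g (-1) w1 x 1 t₁ hx.1 hx.2 le_rfl (left_mem_Icc.2 ht)
  have z1 : ∫ t in t₁..t₂, S.a j (0, t) * (0 + 1 * 0) * u j (0, t) ^ 2 = 0 := by simp
  have z2 : ∫ t in t₁..t₂, S.a j (1, t) * (-1 + 1 * 1) * u j (1, t) ^ 2 = 0 := by simp
  set J := ∫ t in t₁..t₂, S.a j (x, t) * u j (x, t) ^ 2 with hJ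
  have z3 : ∫ t in t₁..t₂, S.a j (x, t) * (0 + 1 * x) * u j (x, t) ^ 2 = x * J := by
    rw [hJ, ← intervalIntegral.integral_const_mul]
    exact intervalIntegral.integral_congr fun t _ => by ring
  have z4 : ∫ t in t₁..t₂, S.a j (x, t) * (-1 + 1 * x) * u j (x, t) ^ 2 = (x - 1) * J := by
    rw [hJ, ← intervalIntegral.integral_const_mul]
    exact intervalIntegral.integral_congr fun t _ => by ring
  rw [z1, z3] at f1
  rw [z2, z4] at f2
  rw [abs_le] at f1 f2 g1 g2 g3 g4
  have hJabs : |J| ≤ (4 + 2 * c * (t₂ - t₁)) * B := by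
    rw [abs_le]; constructor <;> linarith [f1.1, f1.2, f2.1, f2.2, g1.1, g1.2, g2.1, g2.2, g3.1,
      g3.2, g4.1, g4.2]
  refine le_trans ?_ hJabs
  have hq : ∀ t, (x, t) ∈ closedStrip := fun t => mem_closedStrip.2 hx
  have hcu := (continuousOn_const_mk (hu1 j).continuousOn hx ht₁ ht).pow 2
  have hca : ContinuousOn (fun t => S.a j (x, t)) (uIcc t₁ t₂) :=
    (h.a_bc j).1.continuousOn.comp (by fun_prop) fun t _ => hq t
  rw [← intervalIntegral.integral_const_mul]
  rcases lt_or_ge (j : ℕ) S.m with hj | hj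
  · refine le_trans ?_ (le_abs_self _)
    refine intervalIntegral.integral_mono_on ht (hcu.const_smul Λ).intervalIntegrable
      (hca.mul hcu).intervalIntegrable fun t _ => ?_
    exact mul_le_mul_of_nonneg_right (h.a_pos j hj _ (hq t)) (sq_nonneg _)
  · refine le_trans ?_ (neg_le_abs _)
    rw [hJ, ← intervalIntegral.integral_neg]
    refine intervalIntegral.integral_mono_on ht (hcu.const_smul Λ).intervalIntegrable
      (hca.mul hcu).neg.intervalIntegrable fun t _ => ?_
    have := mul_le_mul_of_nonneg_right (h.a_neg j hj _ (hq t)) (sq_nonneg (u j (x, t)))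
    linarith

/-- The energy estimate, uniform with respect to the initial time. -/
theorem CoeffBounds.exists_energy_estimate {n : ℕ} {S : HyperbolicProblem n} {Λ M : ℝ}
    (h : CoeffBounds S Λ M) : ∃ C c : ℝ, 0 < C ∧ 0 ≤ c ∧ ∀ (τ R : ℝ) (u : Fin n → ℝ × ℝ → ℝ),
      IsNearSolution S τ R u → ∀ t, τ ≤ t →
        energy τ u t ≤ C * (energy τ u τ + R ^ 2 * (t - τ)) * Real.exp (c * (t - τ)) := by
  have hM := h.M_pos
  have hΛ := h.Λ_pos
  set c := 2 * M + 1 + n * M + M with hc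
  have hc0 : 0 ≤ c := by positivity
  -- The weight is `ε` at the inflow end and `1` at the outflow end. The reflected energy is at most
  -- `n² M²` times the outgoing one and enters with speed at most `M`, so `ε n² M³ ≤ Λ` lets the
  -- outflow absorb the inflow.
  set ε := Λ / (Λ + n ^ 2 * M ^ 3) with hε
  have hε0 : 0 < ε := by positivity
  have hε1 : ε ≤ 1 := by
    rw [hε, div_le_one (by positivity)]
    have : 0 ≤ n ^ 2 * M ^ 3 := by positivity
    linarith
  have hεM : ε * (n ^ 2 * M ^ 3) ≤ Λ := by
    rw [hε, div_mul_eq_mul_div, div_le_iff₀ (by positivity)]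
    nlinarith [sq_nonneg Λ]
  let w₀ : Fin n → ℝ := fun j => if (j : ℕ) < S.m then ε else 1
  let w₁ : Fin n → ℝ := fun j => if (j : ℕ) < S.m then 1 - ε else ε - 1
  have hw₁ : ∀ j, |w₁ j| ≤ 1 := fun j => by
    simp only [w₁]; split_ifs <;> rw [abs_le] <;> constructor <;> linarith
  have hwlo : ∀ j, ∀ x ∈ Icc (0 : ℝ) 1, ε ≤ w₀ j + w₁ j * x := fun j x hx => by
    simp only [w₀, w₁]; split_ifs <;> nlinarith [hx.1, hx.2]
  have hwhi : ∀ j, ∀ x ∈ Icc (0 : ℝ) 1, w₀ j + w₁ j * x ≤ 1 := fun j x hx => by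
    simp only [w₀, w₁]; split_ifs <;> nlinarith [hx.1, hx.2]
  have hw : ∀ j, ∀ x ∈ Icc (0 : ℝ) 1, |w₀ j + w₁ j * x| ≤ 1 := fun j x hx => by
    rw [abs_of_nonneg (hε0.le.trans (hwlo j x hx))]; exact hwhi j x hx
  have hn0 : (0 : ℝ) ≤ n := Nat.cast_nonneg n
  -- The argument gives `n / ε`; the additional `1` keeps the constant positive for `n = 0`.
  refine ⟨(n + 1) / ε, ε⁻¹ * n * c, by positivity, by positivity, fun τ R u hu t ht => ?_⟩
  have hu1 := hu.contDiffOn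
  have hce := continuous_energy hu1
  have key : ∀ t, τ ≤ t → energy τ u t ≤ ε⁻¹ * n * energy τ u τ +
      ∫ s in τ..t, (ε⁻¹ * n * c * energy τ u s + ε⁻¹ * n * R ^ 2) := by
    intro t ht
    set D := ∫ s in τ..t, (c * energy τ u s + R ^ 2) with hD
    have hflux := fun j => hu.abs_flux_le h j (hw₁ j) (hw j) le_rfl zero_le_one le_rfl le_rfl ht
    have hcu : ∀ j, ∀ x ∈ Icc (0 : ℝ) 1,
        ContinuousOn (fun s => S.a j (x, s) * (w₀ j + w₁ j * x) * u j (x, s) ^ 2) (uIcc τ t) :=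
      fun j x hx => ((((h.a_bc j).1.continuousOn.comp (by fun_prop)
        fun s _ => mem_closedStrip.2 hx).mul continuousOn_const)).mul
        ((continuousOn_const_mk (hu1 j).continuousOn hx le_rfl ht).pow 2)
    -- the boundary terms have a sign
    have hbd : ∑ j, ((∫ s in τ..t, S.a j (0, s) * (w₀ j + w₁ j * 0) * u j (0, s) ^ 2) -
        ∫ s in τ..t, S.a j (1, s) * (w₀ j + w₁ j * 1) * u j (1, s) ^ 2) ≤ 0 := by
      have e1 : ∀ j, (∫ s in τ..t, S.a j (0, s) * (w₀ j + w₁ j * 0) * u j (0, s) ^ 2) -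
          (∫ s in τ..t, S.a j (1, s) * (w₀ j + w₁ j * 1) * u j (1, s) ^ 2) =
          ∫ s in τ..t, (S.a j (0, s) * (w₀ j + w₁ j * 0) * u j (0, s) ^ 2 -
            S.a j (1, s) * (w₀ j + w₁ j * 1) * u j (1, s) ^ 2) := fun j =>
        (intervalIntegral.integral_sub (hcu j 0 (by simp)).intervalIntegrable
          (hcu j 1 (by simp)).intervalIntegrable).symm
      simp only [e1]
      have e0 : ∀ j ∈ Finset.univ, IntervalIntegrable (fun s =>
          S.a j (0, s) * (w₀ j + w₁ j * 0) * u j (0, s) ^ 2 -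
            S.a j (1, s) * (w₀ j + w₁ j * 1) * u j (1, s) ^ 2) volume τ t := fun j _ =>
        ((hcu j 0 (by simp)).sub (hcu j 1 (by simp))).intervalIntegrable
      rw [← intervalIntegral.integral_finsetSum e0]
      rw [← neg_nonneg, ← intervalIntegral.integral_neg]
      refine intervalIntegral.integral_nonneg ht fun s hs => neg_nonneg.2 ?_
      have hq0 : ((0 : ℝ), s) ∈ closedStrip := mem_closedStrip.2 (by simp)
      have hq1 : ((1 : ℝ), s) ∈ closedStrip := mem_closedStrip.2 (by simp)
      have e2 : ∀ j, S.a j (0, s) * (w₀ j + w₁ j * 0) * u j (0, s) ^ 2 -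
          S.a j (1, s) * (w₀ j + w₁ j * 1) * u j (1, s) ^ 2 ≤
          ε * M * u j (S.inPt j, s) ^ 2 - Λ * u j (S.outPt j, s) ^ 2 := by
        intro j
        have a0 := abs_le.1 (h.a_le j _ hq0).1
        have a1 := abs_le.1 (h.a_le j _ hq1).1
        have s0 := sq_nonneg (u j (0, s))
        have s1 := sq_nonneg (u j (1, s))
        simp only [w₀, w₁, HyperbolicProblem.inPt, HyperbolicProblem.outPt]
        split_ifs with hj
        · have b1 := mul_le_mul_of_nonneg_right (h.a_pos j hj _ hq1) s1
          have b0 := mul_le_mul_of_nonneg_left (mul_le_mul_of_nonneg_right a0.2 s0) hε0.le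
          simp only [Set.Icc.coe_zero, Set.Icc.coe_one]
          linarith
        · have b1 := mul_le_mul_of_nonneg_right (h.a_neg j (not_lt.1 hj) _ hq0) s0
          have b0 := mul_le_mul_of_nonneg_left (mul_le_mul_of_nonneg_right a1.1 s1) hε0.le
          simp only [Set.Icc.coe_zero, Set.Icc.coe_one]
          linarith
      refine (Finset.sum_le_sum fun j _ => e2 j).trans ?_
      set Q := ∑ k, u k (S.outPt k, s) ^ 2 with hQ
      have hQ0 : 0 ≤ Q := Finset.sum_nonneg fun _ _ => sq_nonneg _
      -- Cauchy–Schwarz in the reflection conditions.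
      have e3 : ∀ j, u j (S.inPt j, s) ^ 2 ≤ n * M ^ 2 * Q := by
        intro j
        rw [hu.boundary j s hs.1, HyperbolicProblem.P]
        refine (Finset.sum_mul_sq_le_sq_mul_sq _ _ _).trans ?_
        refine mul_le_mul_of_nonneg_right ?_ hQ0
        calc ∑ k, S.p j k ^ 2 ≤ ∑ _k : Fin n, M ^ 2 :=
              Finset.sum_le_sum fun k _ => sq_le_sq' (abs_le.1 (h.p_le j k)).1
                (abs_le.1 (h.p_le j k)).2
          _ = n * M ^ 2 := by simp
      rw [Finset.sum_sub_distrib, ← Finset.mul_sum, ← Finset.mul_sum]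
      have e4 : ∑ j, u j (S.inPt j, s) ^ 2 ≤ n * (n * M ^ 2 * Q) :=
        (Finset.sum_le_sum fun j _ => e3 j).trans_eq (by simp)
      have e5 := mul_le_mul_of_nonneg_left e4 (by positivity : 0 ≤ ε * M)
      have e6 := mul_le_mul_of_nonneg_right hεM hQ0
      nlinarith
    have hsumflux : ∑ j, ∫ x in (0 : ℝ)..1, (w₀ j + w₁ j * x) * u j (x, t) ^ 2 ≤
        ∑ j, (∫ x in (0 : ℝ)..1, (w₀ j + w₁ j * x) * u j (x, τ) ^ 2) + n * D := by
      have e1 : ∀ j, (∫ x in (0 : ℝ)..1, (w₀ j + w₁ j * x) * u j (x, t) ^ 2) ≤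
          (∫ x in (0 : ℝ)..1, (w₀ j + w₁ j * x) * u j (x, τ) ^ 2) +
          ((∫ s in τ..t, S.a j (0, s) * (w₀ j + w₁ j * 0) * u j (0, s) ^ 2) -
          ∫ s in τ..t, S.a j (1, s) * (w₀ j + w₁ j * 1) * u j (1, s) ^ 2) + D := fun j => by
        have := (abs_le.1 (hflux j)).2
        linarith
      refine (Finset.sum_le_sum fun j _ => e1 j).trans ?_
      rw [Finset.sum_add_distrib, Finset.sum_add_distrib]
      simp only [Finset.sum_const, Finset.card_univ, Fintype.card_fin, nsmul_eq_mul]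
      linarith
    have hlow : ε * energy τ u t ≤ ∑ j, ∫ x in (0 : ℝ)..1, (w₀ j + w₁ j * x) * u j (x, t) ^ 2 := by
      have hcj : ∀ j, ContinuousOn (fun x => u j (x, t) ^ 2) (uIcc 0 1) := fun j =>
        (continuousOn_mk_const (hu1 j).continuousOn ht le_rfl zero_le_one le_rfl).pow 2
      have e1 : energy τ u t = ∑ j, ∫ x in (0 : ℝ)..1, u j (x, t) ^ 2 := by
        rw [← intervalIntegral.integral_finsetSum fun j _ => (hcj j).intervalIntegrable]
        refine intervalIntegral.integral_congr fun x hx => ?_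
        rw [uIcc_of_le zero_le_one] at hx
        simp only [sqSum, halfExt_of_mem u hx ht]
      rw [e1, Finset.mul_sum]
      refine Finset.sum_le_sum fun j _ => ?_
      rw [← intervalIntegral.integral_const_mul]
      refine intervalIntegral.integral_mono_on zero_le_one
        ((hcj j).const_smul ε).intervalIntegrable
        (ContinuousOn.mul (by fun_prop) (hcj j)).intervalIntegrable fun x hx => ?_
      exact mul_le_mul_of_nonneg_right (hwlo j x hx) (sq_nonneg _)
    have hup : ∑ j, (∫ x in (0 : ℝ)..1, (w₀ j + w₁ j * x) * u j (x, τ) ^ 2) ≤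
        n * energy τ u τ := by
      refine (Finset.sum_le_sum fun j _ => (le_abs_self _).trans (integral_sq_le_energy hu1 j le_rfl
        le_rfl zero_le_one le_rfl (w := fun x => w₀ j + w₁ j * x) (hw j))).trans_eq ?_
      simp
    have e2 : ∫ s in τ..t, (ε⁻¹ * n * c * energy τ u s + ε⁻¹ * n * R ^ 2) = ε⁻¹ * n * D := by
      rw [hD, ← intervalIntegral.integral_const_mul]
      exact intervalIntegral.integral_congr fun s _ => by ring
    rw [e2]
    have e3 : ε * energy τ u t ≤ n * energy τ u τ + n * D := by linarith
    have e4 := mul_le_mul_of_nonneg_left e3 (inv_nonneg.2 hε0.le)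
    rw [← mul_assoc, inv_mul_cancel₀ hε0.ne', one_mul] at e4
    linarith
  refine (gronwall_integral hce (by positivity) (by positivity) key ht).trans ?_
  refine mul_le_mul_of_nonneg_right ?_ (Real.exp_nonneg _)
  have hE := energy_nonneg (τ := τ) (u := u) τ
  have ht' : 0 ≤ t - τ := by linarith
  have : 0 ≤ R ^ 2 * (t - τ) := by positivity
  calc ε⁻¹ * n * energy τ u τ + ε⁻¹ * n * R ^ 2 * (t - τ)
      = n / ε * (energy τ u τ + R ^ 2 * (t - τ)) := by ring
    _ ≤ _ := by gcongr; linarith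

/-! ### Classes in `L²` and density of test functions. -/

/-- `φ ∈ L²(0,1)ⁿ` is the class of the function `f`. -/
def Represents {n : ℕ} (φ : L2n n) (f : Fin n → ℝ → ℝ) : Prop :=
  ∀ j, φ j =ᵐ[volume] fun x : I => f j x

namespace Represents

variable {n : ℕ} {φ ψ : L2n n} {f g : Fin n → ℝ → ℝ}

lemma add (hφ : Represents φ f) (hψ : Represents ψ g) : Represents (φ + ψ) (f + g) := fun j => by
  filter_upwards [Lp.coeFn_add (φ j) (ψ j), hφ j, hψ j] with x h1 h2 h3
  simp only [Pi.add_apply] at h1 ⊢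
  rw [h1, h2, h3]

lemma sub (hφ : Represents φ f) (hψ : Represents ψ g) : Represents (φ - ψ) (f - g) := fun j => by
  filter_upwards [Lp.coeFn_sub (φ j) (ψ j), hφ j, hψ j] with x h1 h2 h3
  simp only [Pi.sub_apply] at h1 ⊢
  rw [h1, h2, h3]

lemma smul (c : ℝ) (hφ : Represents φ f) : Represents (c • φ) (c • f) := fun j => by
  filter_upwards [Lp.coeFn_smul c (φ j), hφ j] with x h1 h2
  simp only [Pi.smul_apply] at h1 ⊢
  rw [h1, h2]

lemma zero : Represents (0 : L2n n) 0 := fun j => by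
  filter_upwards [Lp.coeFn_zero ℝ 2 (volume : Measure I)] with x h1
  simp

lemma congr (hφ : Represents φ f) (h : ∀ j, ∀ x ∈ Icc (0 : ℝ) 1, f j x = g j x) :
    Represents φ g := fun j => by
  filter_upwards [hφ j] with x h1
  rw [h1, h j x x.2]

lemma norm_sq (hφ : Represents φ f) (j : Fin n) :
    ‖φ j‖ ^ 2 = ∫ x in (0 : ℝ)..1, f j x ^ 2 := by
  rw [← real_inner_self_eq_norm_sq, MeasureTheory.L2.inner_def]
  have h1 : ∫ a, inner ℝ (φ j a) (φ j a) = ∫ a : I, f j a ^ 2 := by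
    refine integral_congr_ae ?_
    filter_upwards [hφ j] with x hx
    rw [hx]
    simp [sq]
  rw [h1, intervalIntegral.integral_of_le zero_le_one, ← integral_Icc_eq_integral_Ioc]
  exact integral_subtype_comap measurableSet_Icc fun x => f j x ^ 2

lemma eLpNorm_sub (hψ : Represents ψ f) (φ : L2n n) (j : Fin n) :
    eLpNorm (fun x : I => φ j x - f j x) 2 volume = ENNReal.ofReal ‖φ j - ψ j‖ := by
  have h1 : (fun x : I => φ j x - f j x) =ᵐ[volume] (φ j - ψ j : Lp ℝ 2 (volume : Measure I)) := by
    filter_upwards [Lp.coeFn_sub (φ j) (ψ j), hψ j] with x h1 h2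
    rw [h1, Pi.sub_apply, h2]
  rw [eLpNorm_congr_ae h1, Lp.norm_def, ENNReal.ofReal_toReal (Lp.eLpNorm_ne_top _)]

/-- The energy sums the squared component norms, whereas `L2n` carries their maximum; hence no
factor in this direction and a factor `n` in the converse one. -/
lemma norm_sq_le_energy {τ t : ℝ} {u : Fin n → ℝ × ℝ → ℝ}
    (hu : ∀ j, ContDiffOn ℝ 1 (u j) (Icc (0 : ℝ) 1 ×ˢ Ici τ)) (ht : τ ≤ t)
    (hφ : Represents φ fun j x => u j (x, t)) : ‖φ‖ ^ 2 ≤ energy τ u t := by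
  have h0 : ∀ j, ‖φ j‖ ≤ √(energy τ u t) := fun j => by
    refine Real.le_sqrt_of_sq_le ?_
    rw [hφ.norm_sq j]
    have := integral_sq_le_energy hu j ht le_rfl zero_le_one le_rfl (w := fun _ => 1) (by simp)
    simp only [one_mul] at this
    exact (le_abs_self _).trans this
  have h1 : ‖φ‖ ≤ √(energy τ u t) := (pi_norm_le_iff_of_nonneg (Real.sqrt_nonneg _)).2 h0
  calc ‖φ‖ ^ 2 ≤ √(energy τ u t) ^ 2 := pow_le_pow_left₀ (norm_nonneg _) h1 2
    _ = _ := Real.sq_sqrt (energy_nonneg t)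

lemma energy_le {τ t : ℝ} {u : Fin n → ℝ × ℝ → ℝ}
    (hu : ∀ j, ContDiffOn ℝ 1 (u j) (Icc (0 : ℝ) 1 ×ˢ Ici τ)) (ht : τ ≤ t)
    (hφ : Represents φ fun j x => u j (x, t)) : energy τ u t ≤ n * ‖φ‖ ^ 2 := by
  have h1 : energy τ u t = ∑ k, ‖φ k‖ ^ 2 := by
    simp only [energy, sqSum]
    rw [intervalIntegral.integral_finsetSum]
    · refine Finset.sum_congr rfl fun k _ => ?_
      rw [hφ.norm_sq k]
      refine intervalIntegral.integral_congr fun x hx => ?_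
      rw [uIcc_of_le zero_le_one] at hx
      simp only [halfExt_of_mem u hx ht]
    · intro k _
      refine Continuous.intervalIntegrable ?_ _ _
      exact ((continuous_halfExt hu k).comp (by fun_prop : Continuous fun x : ℝ => (x, t))).pow 2
  rw [h1]
  calc ∑ k, ‖φ k‖ ^ 2 ≤ ∑ _k : Fin n, ‖φ‖ ^ 2 :=
        Finset.sum_le_sum fun k _ => pow_le_pow_left₀ (norm_nonneg _) (norm_le_pi_norm φ k) 2
    _ = _ := by simp

end Represents

lemma exists_represents {n : ℕ} {f : Fin n → ℝ → ℝ} (hf : ∀ j, ContinuousOn (f j) (Icc 0 1)) :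
    ∃ φ : L2n n, Represents φ f := by
  refine ⟨fun j => ContinuousMap.toLp 2 (volume : Measure I) ℝ ⟨fun x : I => f j x,
    (continuousOn_iff_continuous_domRestrict.1 (hf j))⟩, fun j => ?_⟩
  exact ContinuousMap.coeFn_toLp (p := 2) (𝕜 := ℝ) volume _

/-- A smooth function on the unit interval is close in `L²` to a test function. -/
lemma exists_cutoff {p : ℝ → ℝ} (hp : ContDiff ℝ ∞ p) {ε : ℝ} (hε : 0 < ε) :
    ∃ f : ℝ → ℝ, ContDiff ℝ ∞ f ∧ HasCompactSupport f ∧ tsupport f ⊆ Ioo 0 1 ∧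
      ∫ x in (0 : ℝ)..1, (p x - f x) ^ 2 ≤ ε := by
  obtain ⟨B, hB⟩ := isCompact_Icc.exists_bound_of_continuousOn (s := Icc (0 : ℝ) 1)
    hp.continuous.continuousOn
  -- The error of the cutoff lives on two end layers of width `δ` and is bounded there by `B`.
  obtain ⟨δ, hδ0, hδ1, hδ⟩ : ∃ δ : ℝ, 0 < δ ∧ δ < 1 / 2 ∧ 2 * δ * B ^ 2 ≤ ε := by
    refine ⟨min (1 / 4) (ε / (2 * (B ^ 2 + 1))), by positivity,
      (min_le_left _ _).trans_lt (by norm_num), ?_⟩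
    have h1 : min (1 / 4) (ε / (2 * (B ^ 2 + 1))) ≤ ε / (2 * (B ^ 2 + 1)) := min_le_right _ _
    calc 2 * min (1 / 4) (ε / (2 * (B ^ 2 + 1))) * B ^ 2
        ≤ 2 * (ε / (2 * (B ^ 2 + 1))) * (B ^ 2 + 1) := by gcongr; linarith
      _ = ε := by field_simp
  -- The bump equals `1` on `[δ, 1 - δ]` and is supported in `[δ/2, 1 - δ/2]`.
  let η : ContDiffBump (1 / 2 : ℝ) := ⟨1 / 2 - δ, 1 / 2 - δ / 2, by linarith, by linarith⟩
  have hts : tsupport (η : ℝ → ℝ) ⊆ Ioo 0 1 := by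
    rw [η.tsupport_eq, Real.closedBall_eq_Icc]
    intro x hx
    have h1 := hx.1
    have h2 := hx.2
    simp only [η] at h1 h2
    constructor <;> linarith
  have hηc : Continuous (η : ℝ → ℝ) := (η.contDiff (n := 1)).continuous
  refine ⟨fun x => η x * p x, η.contDiff.mul hp, η.hasCompactSupport.mul_right,
    (tsupport_mul_subset_left).trans hts, ?_⟩
  have hc : Continuous fun x => (p x - η x * p x) ^ 2 := by
    have := hp.continuous; fun_prop
  have hii : ∀ a b, IntervalIntegrable (fun x => (p x - η x * p x) ^ 2) volume a b := fun a b =>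
    hc.intervalIntegrable a b
  rw [← intervalIntegral.integral_add_adjacent_intervals (hii 0 δ) (hii δ 1),
    ← intervalIntegral.integral_add_adjacent_intervals (hii δ (1 - δ)) (hii (1 - δ) 1)]
  have hbd : ∀ x ∈ Icc (0 : ℝ) 1, (p x - η x * p x) ^ 2 ≤ B ^ 2 := fun x hx => by
    have h1 : p x - η x * p x = (1 - η x) * p x := by ring
    have h2 := hB x hx
    have h3 : |p x - η x * p x| ≤ B := by
      rw [h1, abs_mul]
      have h4 : |1 - η x| ≤ 1 := abs_le.2 ⟨by linarith [η.le_one (x := x)],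
        by linarith [η.nonneg (x := x)]⟩
      exact (mul_le_of_le_one_left (abs_nonneg _) h4).trans h2
    exact sq_le_sq' (abs_le.1 h3).1 (abs_le.1 h3).2
  have hmid : ∫ x in δ..(1 - δ), (p x - η x * p x) ^ 2 = 0 := by
    rw [intervalIntegral.integral_congr (g := fun _ => (0 : ℝ)), intervalIntegral.integral_zero]
    intro x hx
    rw [uIcc_of_le (by linarith)] at hx
    have : η x = 1 := η.one_of_mem_closedBall (by
      rw [Real.closedBall_eq_Icc]
      simp only [η]
      exact ⟨by linarith [hx.1], by linarith [hx.2]⟩)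
    simp [this]
  have h1 : ∫ x in (0 : ℝ)..δ, (p x - η x * p x) ^ 2 ≤ ∫ _ in (0 : ℝ)..δ, B ^ 2 :=
    intervalIntegral.integral_mono_on hδ0.le (hii _ _) intervalIntegrable_const fun x hx =>
      hbd x ⟨hx.1, by linarith [hx.2]⟩
  have h2 : ∫ x in (1 - δ)..1, (p x - η x * p x) ^ 2 ≤ ∫ _ in (1 - δ)..1, B ^ 2 :=
    intervalIntegral.integral_mono_on (by linarith) (hii _ _) intervalIntegrable_const fun x hx =>
      hbd x ⟨by linarith [hx.1], hx.2⟩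
  rw [intervalIntegral.integral_const, smul_eq_mul] at h1 h2
  rw [hmid]
  linarith

/-- Three approximations in a row: continuous functions are dense in `L²`, polynomials are uniformly
dense among them, and a polynomial may be cut off near the ends at small cost in `L²`. -/
lemma exists_testFunction_near {n : ℕ} (φ : L2n n) {ε : ℝ} (hε : 0 < ε) :
    ∃ (f : Fin n → ℝ → ℝ) (ψ : L2n n), IsTestFunction f ∧ Represents ψ f ∧ ‖φ - ψ‖ < ε := by
  have key : ∀ j, ∃ (f : ℝ → ℝ) (χ : Lp ℝ 2 (volume : Measure I)),
      (ContDiff ℝ ∞ f ∧ HasCompactSupport f ∧ tsupport f ⊆ Ioo 0 1) ∧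
      χ =ᵐ[volume] (fun x : I => f x) ∧ ‖φ j - χ‖ < ε := fun j => by
    obtain ⟨g, hg⟩ := (ContinuousMap.toLp_denseRange ℝ (p := 2) volume ℝ
      (by norm_num : (2 : ENNReal) ≠ ⊤)).exists_dist_lt (φ j) (by positivity : 0 < ε / 3)
    obtain ⟨p, hp⟩ := exists_polynomial_near_of_continuousOn 0 1
      (fun x => g (projIcc 0 1 zero_le_one x)) (by fun_prop) (ε / 3) (by positivity)
    obtain ⟨f, hf1, hf2, hf3, hf4⟩ := exists_cutoff (p := fun x => p.eval x)
      (by simpa using p.contDiff_aeval (𝕜 := ℝ) ∞) (by positivity : 0 < (ε / 4) ^ 2)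
    obtain ⟨χ, hχ⟩ := exists_represents (n := 1) (f := fun _ => f) fun _ => hf1.continuous.continuousOn
    obtain ⟨π, hπ⟩ := exists_represents (n := 1) (f := fun _ x => p.eval x) fun _ => by fun_prop
    obtain ⟨γ, hγ⟩ := exists_represents (n := 1) (f := fun _ x => g (projIcc 0 1 zero_le_one x))
      fun _ => by fun_prop
    have hγ' : γ 0 = ContinuousMap.toLp 2 volume ℝ g := by
      refine Lp.ext ((hγ 0).trans ?_)
      filter_upwards [ContinuousMap.coeFn_toLp (p := 2) (𝕜 := ℝ) volume g] with x hx
      rw [hx, projIcc_val]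
    refine ⟨f, χ 0, ⟨hf1, hf2, hf3⟩, hχ 0, ?_⟩
    have e1 : ‖γ 0 - π 0‖ ≤ ε / 3 := by
      refine abs_le_of_sq_le_sq' ?_ (by positivity) |>.2
      have := (hγ.sub hπ).norm_sq 0
      simp only [Pi.sub_apply] at this
      rw [this]
      have h1 : ∀ x ∈ uIoc (0 : ℝ) 1,
          ‖(g (projIcc 0 1 zero_le_one x) - p.eval x) ^ 2‖ ≤ (ε / 3) ^ 2 := fun x hx => by
        rw [uIoc_of_le zero_le_one] at hx
        have := hp x (Ioc_subset_Icc_self hx)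
        rw [norm_pow, Real.norm_eq_abs, abs_sub_comm]
        exact pow_le_pow_left₀ (abs_nonneg _) this.le 2
      have := intervalIntegral.norm_integral_le_of_norm_le_const h1
      simp only [sub_zero, abs_one, mul_one] at this
      exact (le_abs_self _).trans this
    have e2 : ‖π 0 - χ 0‖ ≤ ε / 4 := by
      refine abs_le_of_sq_le_sq' ?_ (by positivity) |>.2
      have := (hπ.sub hχ).norm_sq 0
      simp only [Pi.sub_apply] at this
      rw [this]
      exact hf4
    have e3 : ‖φ j - γ 0‖ < ε / 3 := by rw [hγ', ← dist_eq_norm]; exact hg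
    calc ‖φ j - χ 0‖ = ‖(φ j - γ 0) + (γ 0 - π 0) + (π 0 - χ 0)‖ := by abel_nf
      _ ≤ ‖φ j - γ 0‖ + ‖γ 0 - π 0‖ + ‖π 0 - χ 0‖ := norm_add₃_le
      _ < ε := by linarith
  choose f χ h1 h2 h3 using key
  exact ⟨f, χ, h1, h2, (pi_norm_lt_iff hε).2 fun j => h3 j⟩

/-! ### Linear combinations of near solutions and the energy estimate in norms. -/

namespace IsNearSolution

variable {n : ℕ} {S : HyperbolicProblem n} {τ R R₁ R₂ : ℝ} {u v : Fin n → ℝ × ℝ → ℝ}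

lemma add (hu : IsNearSolution S τ R₁ u) (hv : IsNearSolution S τ R₂ v) :
    IsNearSolution S τ (R₁ + R₂) (u + v) where
  contDiffOn j := (hu.contDiffOn j).add (hv.contDiffOn j)
  residual j x hx t ht := by
    have du := hasDerivAt_of_contDiffOn_half (hu.contDiffOn j) hx ht
    have dv := hasDerivAt_of_contDiffOn_half (hv.contDiffOn j) hx ht
    have e1 : deriv (fun s => (u + v) j (x, s)) t = _ := (du.2.2.add dv.2.2).deriv
    have e2 : deriv (fun y => (u + v) j (y, t)) x = _ := (du.2.1.add dv.2.1).deriv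
    rw [e1, e2]
    refine le_trans (le_of_eq ?_) ((abs_add_le _ _).trans
      (add_le_add (hu.residual j x hx t ht) (hv.residual j x hx t ht)))
    congr 1
    simp only [Pi.add_apply, mul_add, Finset.sum_add_distrib]
    ring
  boundary j t ht := by
    simp only [Pi.add_apply, HyperbolicProblem.P, mul_add, Finset.sum_add_distrib]
    rw [hu.boundary j t ht, hv.boundary j t ht]
    rfl

lemma smul (c : ℝ) (hu : IsNearSolution S τ R u) : IsNearSolution S τ (|c| * R) (c • u) where
  contDiffOn j := (hu.contDiffOn j).const_smul c
  residual j x hx t ht := by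
    have du := hasDerivAt_of_contDiffOn_half (hu.contDiffOn j) hx ht
    have e1 : deriv (fun s => (c • u) j (x, s)) t = _ := (du.2.2.const_mul c).deriv
    have e2 : deriv (fun y => (c • u) j (y, t)) x = _ := (du.2.1.const_mul c).deriv
    rw [e1, e2]
    refine le_trans (le_of_eq ?_) (mul_le_mul_of_nonneg_left (hu.residual j x hx t ht)
      (abs_nonneg c))
    rw [← abs_mul]
    congr 1
    simp only [Pi.smul_apply, smul_eq_mul, mul_add, Finset.mul_sum]
    congr 1
    · ring
    · exact Finset.sum_congr rfl fun k _ => by ring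
  boundary j t ht := by
    simp only [Pi.smul_apply, smul_eq_mul, HyperbolicProblem.P]
    rw [hu.boundary j t ht, HyperbolicProblem.P, Finset.mul_sum]
    exact Finset.sum_congr rfl fun k _ => by ring

lemma sub (hu : IsNearSolution S τ R₁ u) (hv : IsNearSolution S τ R₂ v) :
    IsNearSolution S τ (R₁ + R₂) (u - v) := by
  have := hu.add (hv.smul (-1))
  rwa [abs_neg, abs_one, one_mul, neg_one_smul, ← sub_eq_add_neg] at this

lemma mono_time (hu : IsNearSolution S τ R u) {s : ℝ} (hs : τ ≤ s) : IsNearSolution S s R u where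
  contDiffOn j := (hu.contDiffOn j).mono (prod_mono le_rfl (Ici_subset_Ici.2 hs))
  residual j x hx t ht := hu.residual j x hx t (hs.trans_lt ht)
  boundary j t ht := hu.boundary j t (hs.trans ht)

lemma zero : IsNearSolution S τ 0 0 where
  contDiffOn j := contDiffOn_const
  residual j x hx t ht := by simp
  boundary j t ht := by simp [HyperbolicProblem.P]

lemma exists_represents (hu : IsNearSolution S τ R u) {t : ℝ} (ht : τ ≤ t) :
    ∃ ψ : L2n n, Represents ψ fun j x => u j (x, t) :=
  _root_.exists_represents fun j => by
    have := continuousOn_mk_const (hu.contDiffOn j).continuousOn ht le_rfl zero_le_one le_rfl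
    rwa [uIcc_of_le zero_le_one] at this

end IsNearSolution

namespace CoeffBounds

variable {n : ℕ} {S : HyperbolicProblem n} {Λ M : ℝ}

/-- A test function, considered as a function independent of time, is a near solution. -/
lemma exists_isNearSolution_testFunction (h : CoeffBounds S Λ M) {f : Fin n → ℝ → ℝ}
    (hf : IsTestFunction f) :
    ∃ R, ∀ τ, IsNearSolution S τ R fun j q => f j q.1 := by
  have hb : ∀ j, ∃ B, 0 ≤ B ∧ ∀ x ∈ Icc (0 : ℝ) 1, |f j x| ≤ B ∧ |deriv (f j) x| ≤ B := fun j => by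
    obtain ⟨B₁, h1⟩ := isCompact_Icc.exists_bound_of_continuousOn (s := Icc (0 : ℝ) 1)
      (hf j).1.continuous.continuousOn
    obtain ⟨B₂, h2⟩ := isCompact_Icc.exists_bound_of_continuousOn (s := Icc (0 : ℝ) 1)
      ((hf j).1.continuous_deriv (by simp)).continuousOn
    exact ⟨max 0 (max B₁ B₂), le_max_left _ _, fun x hx =>
      ⟨(h1 x hx).trans ((le_max_left _ _).trans (le_max_right _ _)),
      (h2 x hx).trans ((le_max_right _ _).trans (le_max_right _ _))⟩⟩
  choose B hB0 hB using hb
  have hM := h.M_pos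
  have hout : ∀ j, ∀ x : ℝ, x ∉ Ioo (0 : ℝ) 1 → f j x = 0 := fun j x hx =>
    image_eq_zero_of_notMem_tsupport fun hx' => hx ((hf j).2.2 hx')
  have hend : ∀ j (k : Fin n), f j (S.inPt k) = 0 ∧ f j (S.outPt k) = 0 := fun j k => by
    constructor
    · apply hout
      unfold HyperbolicProblem.inPt
      split_ifs <;> simp
    · apply hout
      unfold HyperbolicProblem.outPt
      split_ifs <;> simp
  -- The residual is `a φ' + b φ`, bounded uniformly in time; hence one `R` serves all initial
  -- times.
  refine ⟨∑ j, M * B j + ∑ k, M * B k, fun τ => ⟨fun j => ?_, fun j x hx t _ => ?_, fun j t _ => ?_⟩⟩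
  · exact (((hf j).1.of_le (by simp)).comp contDiff_fst).contDiffOn
  · have hq : (x, t) ∈ closedStrip := mem_closedStrip.2 (Ioo_subset_Icc_self hx)
    have hx' := Ioo_subset_Icc_self hx
    simp only [deriv_const, zero_add]
    refine (abs_add_le _ _).trans (add_le_add ?_ ?_)
    · rw [abs_mul]
      refine (mul_le_mul (h.a_le j _ hq).1 (hB j x hx').2 (abs_nonneg _) hM.le).trans ?_
      exact Finset.single_le_sum (f := fun j => M * B j) (fun k _ => mul_nonneg hM.le (hB0 k))
        (Finset.mem_univ j)
    · refine (Finset.abs_sum_le_sum_abs _ _).trans (Finset.sum_le_sum fun k _ => ?_)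
      rw [abs_mul]
      exact mul_le_mul (h.b_le j k _ hq).1 (hB k x hx').1 (abs_nonneg _) hM.le
  · simp [HyperbolicProblem.P, hend]

/-- The square root of the energy estimate. The residual contributes only `|R| √(t - τ)`, which
later yields continuity at the initial time. -/
lemma exists_norm_estimate (h : CoeffBounds S Λ M) : ∃ C c : ℝ, 0 < C ∧ 0 ≤ c ∧
    ∀ (τ R : ℝ) (u : Fin n → ℝ × ℝ → ℝ) (φ ψ : L2n n) (t : ℝ), IsNearSolution S τ R u → τ ≤ t →
      Represents φ (fun j x => u j (x, τ)) → Represents ψ (fun j x => u j (x, t)) →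
      ‖ψ‖ ≤ C * (‖φ‖ + |R| * √(t - τ)) * Real.exp (c * (t - τ)) := by
  obtain ⟨C, c, hC, hc, hE⟩ := h.exists_energy_estimate
  -- Taking roots is avoided by `z ≤ (z + 1)²` with `z = C (n + 1)`.
  refine ⟨C * (n + 1) + 1, c, by positivity, hc, fun τ R u φ ψ t hu ht hφ hψ => ?_⟩
  have h1 := hψ.norm_sq_le_energy hu.contDiffOn ht
  have h2 := hφ.energy_le hu.contDiffOn le_rfl
  have h3 := hE τ R u hu t ht
  have hs : R ^ 2 * (t - τ) = (|R| * √(t - τ)) ^ 2 := by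
    rw [mul_pow, sq_abs, Real.sq_sqrt (sub_nonneg.2 ht)]
  set X := ‖φ‖ with hX
  set Y := |R| * √(t - τ) with hY
  have hX0 : 0 ≤ X := norm_nonneg _
  have hY0 : 0 ≤ Y := by positivity
  set e := Real.exp (c * (t - τ)) with he
  have he1 : 1 ≤ e := Real.one_le_exp (mul_nonneg hc (sub_nonneg.2 ht))
  refine (abs_le_of_sq_le_sq' ?_ (by positivity)).2
  calc ‖ψ‖ ^ 2 ≤ C * (energy τ u τ + R ^ 2 * (t - τ)) * e := h1.trans h3
    _ ≤ C * (n * X ^ 2 + Y ^ 2) * e := by rw [hs]; gcongr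
    _ ≤ C * ((n + 1) * (X + Y) ^ 2) * e ^ 2 := by
        have e1 : (n : ℝ) * X ^ 2 + Y ^ 2 ≤ (n + 1) * (X + Y) ^ 2 := by
          have hn : (0 : ℝ) ≤ n := Nat.cast_nonneg n
          have : X ^ 2 ≤ (X + Y) ^ 2 := by gcongr; linarith
          have : Y ^ 2 ≤ (X + Y) ^ 2 := by gcongr; linarith
          nlinarith
        have e2 : e ≤ e ^ 2 := by nlinarith
        gcongr
    _ ≤ ((C * (n + 1) + 1) * (X + Y) * e) ^ 2 := by
        have : C * (n + 1) ≤ (C * (n + 1) + 1) ^ 2 := by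
          have : 0 < C * ((n : ℝ) + 1) := by positivity
          nlinarith
        calc C * ((n + 1) * (X + Y) ^ 2) * e ^ 2 = C * (n + 1) * ((X + Y) ^ 2 * e ^ 2) := by ring
          _ ≤ (C * (n + 1) + 1) ^ 2 * ((X + Y) ^ 2 * e ^ 2) := by gcongr
          _ = _ := by ring

end CoeffBounds

/-! ### The evolution family as an extension by density. -/

/-- `U(t,τ)` maps the initial values of classical solutions at time `τ` to their values at
time `t`, and it is bounded locally uniformly in `t - τ`. -/
structure IsPropagator {n : ℕ} (S : HyperbolicProblem n) (C c : ℝ)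
    (U : ℝ → ℝ → L2n n →L[ℝ] L2n n) : Prop where
  C_pos : 0 < C
  c_nonneg : 0 ≤ c
  norm_le : ∀ τ t, τ ≤ t → ∀ φ, ‖U t τ φ‖ ≤ C * Real.exp (c * (t - τ)) * ‖φ‖
  near : ∀ (τ t R : ℝ) (u : Fin n → ℝ × ℝ → ℝ) (φ ψ : L2n n), IsNearSolution S τ R u → τ ≤ t →
      Represents φ (fun j x => u j (x, τ)) → Represents ψ (fun j x => u j (x, t)) →
      ‖ψ‖ ≤ C * (‖φ‖ + |R| * √(t - τ)) * Real.exp (c * (t - τ))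
  apply : ∀ (τ t : ℝ) (u : Fin n → ℝ × ℝ → ℝ) (φ ψ : L2n n), τ ≤ t → IsNearSolution S τ 0 u →
    Represents φ (fun j x => u j (x, τ)) → Represents ψ (fun j x => u j (x, t)) → U t τ φ = ψ

/-- The pairs of values at the times `τ` and `t` of the classical solutions. -/
def solutionGraph {n : ℕ} (S : HyperbolicProblem n) (τ t : ℝ) : Submodule ℝ (L2n n × L2n n) where
  carrier := {z | ∃ u, IsNearSolution S τ 0 u ∧ Represents z.1 (fun j x => u j (x, τ)) ∧
    Represents z.2 (fun j x => u j (x, t))}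
  add_mem' := by
    rintro z w ⟨u, hu, hu1, hu2⟩ ⟨v, hv, hv1, hv2⟩
    exact ⟨u + v, by simpa using hu.add hv, hu1.add hv1, hu2.add hv2⟩
  zero_mem' := ⟨0, .zero, .zero, .zero⟩
  smul_mem' := by
    rintro c z ⟨u, hu, hu1, hu2⟩
    exact ⟨c • u, by simpa using hu.smul c, hu1.smul c, hu2.smul c⟩

namespace CoeffBounds

variable {n : ℕ} {S : HyperbolicProblem n} {Λ M : ℝ}

lemma exists_solution_near (h : CoeffBounds S Λ M) (τ : ℝ) (φ : L2n n) {ε : ℝ} (hε : 0 < ε) :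
    ∃ (f : Fin n → ℝ → ℝ) (ψ : L2n n) (u : Fin n → ℝ × ℝ → ℝ), IsTestFunction f ∧
      IsNearSolution S τ 0 u ∧ Represents ψ f ∧ Represents ψ (fun j x => u j (x, τ)) ∧
      ‖φ - ψ‖ < ε := by
  obtain ⟨f, ψ, hf, hψ, hn⟩ := exists_testFunction_near φ hε
  obtain ⟨u, hu⟩ := h.exists_classicalSolution τ hf
  exact ⟨f, ψ, u, hf, hu.isNearSolution, hψ,
    hψ.congr fun j x hx => (hu.initial j x hx).symm, hn⟩

/-- The norm estimate says that the second component of the solution graph is controlled by the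
first. This contains uniqueness, so the graph is that of a bounded operator, and the first
components are dense by solvability for test functions. -/
theorem exists_isPropagator (h : CoeffBounds S Λ M) : ∃ C c U, IsPropagator S C c U := by
  obtain ⟨C, c, hC, hc, hE⟩ := h.exists_norm_estimate
  let e : ∀ τ t, solutionGraph S τ t →ₗ[ℝ] L2n n := fun τ t =>
    (LinearMap.fst ℝ _ _).comp (solutionGraph S τ t).subtype
  let g : ∀ τ t, solutionGraph S τ t →ₗ[ℝ] L2n n := fun τ t =>
    (LinearMap.snd ℝ _ _).comp (solutionGraph S τ t).subtype
  have hd : ∀ τ t, τ ≤ t → DenseRange (e τ t) := fun τ t ht φ => by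
    rw [Metric.mem_closure_iff]
    intro ε hε
    obtain ⟨f, ψ, u, -, hu, -, hψ, hn⟩ := h.exists_solution_near τ φ hε
    obtain ⟨χ, hχ⟩ := hu.exists_represents ht
    exact ⟨ψ, ⟨⟨(ψ, χ), u, hu, hψ, hχ⟩, rfl⟩, by rwa [dist_eq_norm]⟩
  have hb : ∀ τ t, τ ≤ t → ∀ z, ‖g τ t z‖ ≤ C * Real.exp (c * (t - τ)) * ‖e τ t z‖ := by
    rintro τ t ht ⟨z, u, hu, h1, h2⟩
    have := hE τ 0 u z.1 z.2 t hu ht h1 h2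
    simp only [abs_zero, zero_mul, add_zero] at this
    calc ‖z.2‖ ≤ _ := this
      _ = _ := by simp only [e, LinearMap.comp_apply, Submodule.subtype_apply, LinearMap.fst_apply]; ring
  refine ⟨C, c, fun t τ => (g τ t).extendOfNorm (e τ t), hC, hc, fun τ t ht φ => ?_,
    fun τ t R u φ ψ hu ht h1 h2 => hE τ R u φ ψ t hu ht h1 h2, fun τ t u φ ψ ht hu h1 h2 => ?_⟩
  · exact LinearMap.norm_extendOfNorm_apply_le (hd τ t ht) _ (hb τ t ht) φ
  · exact LinearMap.extendOfNorm_eq (hd τ t ht) ⟨_, hb τ t ht⟩ ⟨(φ, ψ), u, hu, h1, h2⟩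

end CoeffBounds

/-- The class in `L²` of a `C¹` function depends continuously on time. -/
lemma continuousOn_of_represents {n : ℕ} {τ : ℝ} {u : Fin n → ℝ × ℝ → ℝ} {w : ℝ → L2n n}
    (hu : ∀ j, ContDiffOn ℝ 1 (u j) (Icc (0 : ℝ) 1 ×ˢ Ici τ))
    (hw : ∀ t, τ ≤ t → Represents (w t) fun j x => u j (x, t)) : ContinuousOn w (Ici τ) := by
  refine continuousOn_pi.2 fun j s hs => ?_
  set G : ℝ → ℝ := fun t => ∫ x in (0 : ℝ)..1, (halfExt τ u j (x, t) - halfExt τ u j (x, s)) ^ 2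
    with hG
  have hGc : Continuous G := by
    have := continuous_halfExt hu j
    exact intervalIntegral.continuous_parametric_intervalIntegral_of_continuous'
      (f := fun t x => (halfExt τ u j (x, t) - halfExt τ u j (x, s)) ^ 2) (by fun_prop) _ _
  have hG0 : G s = 0 := by simp [hG]
  have hdist : ∀ t ∈ Ici τ, ‖w t j - w s j‖ = √(G t) := fun t ht => by
    have h1 := ((hw t ht).sub (hw s hs)).norm_sq j
    simp only [Pi.sub_apply] at h1
    rw [← Real.sqrt_sq (norm_nonneg (w t j - w s j)), h1]
    congr 1
    refine intervalIntegral.integral_congr fun x hx => ?_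
    rw [uIcc_of_le zero_le_one] at hx
    simp only [halfExt_of_mem u hx ht, halfExt_of_mem u hx hs]
  have h0 : Tendsto (fun t => √(G t)) (𝓝[Ici τ] s) (𝓝 0) := by
    have := (hGc.sqrt).continuousWithinAt (s := Ici τ) (x := s)
    rw [ContinuousWithinAt, hG0, Real.sqrt_zero] at this
    exact this
  refine tendsto_iff_norm_sub_tendsto_zero.2 (h0.congr' ?_)
  filter_upwards [self_mem_nhdsWithin] with t ht
  rw [hdist t ht]

namespace IsPropagator

variable {n : ℕ} {S : HyperbolicProblem n} {Λ M C c : ℝ} {U : ℝ → ℝ → L2n n →L[ℝ] L2n n}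

/-- Initial values of classical solutions are dense, so bounded operators may be compared on them.
-/
lemma eq_of_near (h : CoeffBounds S Λ M) {X : Type*} [NormedAddCommGroup X] [NormedSpace ℝ X]
    {A B : L2n n →L[ℝ] X} (τ : ℝ)
    (hAB : ∀ (u : Fin n → ℝ × ℝ → ℝ) (ψ : L2n n), IsNearSolution S τ 0 u →
      Represents ψ (fun j x => u j (x, τ)) → A ψ = B ψ) : A = B := by
  have hd : Dense {ψ : L2n n | A ψ = B ψ} := fun φ => by
    rw [Metric.mem_closure_iff]
    intro ε hε
    obtain ⟨f, ψ, u, -, hu, -, hψ, hn⟩ := h.exists_solution_near τ φ hε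
    exact ⟨ψ, hAB u ψ hu hψ, by rwa [dist_eq_norm]⟩
  refine ContinuousLinearMap.ext fun φ => ?_
  exact congrFun (Continuous.ext_on hd A.continuous B.continuous fun ψ hψ => hψ) φ

lemma refl (hU : IsPropagator S C c U) (h : CoeffBounds S Λ M) (τ : ℝ) :
    U τ τ = ContinuousLinearMap.id ℝ (L2n n) :=
  eq_of_near h τ fun u ψ hu hψ => hU.apply τ τ u ψ ψ le_rfl hu hψ hψ

/-- A classical solution restarted at time `s` is again classical, though its value there is in
general no test function. This is why the solution graph admits all classical solutions, whatever
their initial values. -/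
lemma comp (hU : IsPropagator S C c U) (h : CoeffBounds S Λ M) (τ s t : ℝ) (hs : τ ≤ s)
    (ht : s ≤ t) : (U t s).comp (U s τ) = U t τ :=
  eq_of_near h τ fun u ψ hu hψ => by
    obtain ⟨χ, hχ⟩ := hu.exists_represents hs
    obtain ⟨ρ, hρ⟩ := hu.exists_represents (hs.trans ht)
    rw [ContinuousLinearMap.comp_apply, hU.apply τ s u ψ χ hs hu hψ hχ,
      hU.apply s t u χ ρ ht (hu.mono_time hs) hχ hρ,
      hU.apply τ t u ψ ρ (hs.trans ht) hu hψ hρ]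

lemma continuousOn_time (hU : IsPropagator S C c U) {τ : ℝ} {u : Fin n → ℝ × ℝ → ℝ} {ψ : L2n n}
    (hu : IsNearSolution S τ 0 u) (hψ : Represents ψ (fun j x => u j (x, τ))) :
    ContinuousOn (fun t => U t τ ψ) (Ici τ) :=
  continuousOn_of_represents hu.contDiffOn fun t ht => by
    obtain ⟨χ, hχ⟩ := hu.exists_represents ht
    rwa [hU.apply τ t u ψ χ ht hu hψ hχ]

/-- On test functions the propagator converges to the identity uniformly in the initial time. -/
lemma exists_norm_sub_le (hU : IsPropagator S C c U) (h : CoeffBounds S Λ M)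
    {f : Fin n → ℝ → ℝ} {ψ : L2n n} (hf : IsTestFunction f) (hψ : Represents ψ f) :
    ∃ R, 0 ≤ R ∧ ∀ τ t, τ ≤ t → ‖U t τ ψ - ψ‖ ≤ R * √(t - τ) * Real.exp (c * (t - τ)) := by
  obtain ⟨R, hR⟩ := h.exists_isNearSolution_testFunction hf
  refine ⟨C * |R|, mul_nonneg hU.C_pos.le (abs_nonneg _), fun τ t ht => ?_⟩
  obtain ⟨u, hu⟩ := h.exists_classicalSolution τ hf
  have hus := hu.isNearSolution
  have hψ' : Represents ψ (fun j x => u j (x, τ)) :=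
    hψ.congr fun j x hx => (hu.initial j x hx).symm
  obtain ⟨χ, hχ⟩ := hus.exists_represents ht
  rw [hU.apply τ t u ψ χ ht hus hψ' hχ]
  -- The classical solution minus the frozen test function is a near solution with zero initial
  -- value, so only the residual term of the estimate remains.
  have := hU.near τ t _ _ (ψ - ψ) (χ - ψ) (hus.sub (hR τ)) ht (hψ'.sub hψ) (hχ.sub hψ)
  simpa [mul_assoc] using this

/-- Moving the initial time from `τ₀` to `τ` changes `U(t,τ)ψ` by a bounded operator applied to the
deviation from the identity over the interval between them, which is small uniformly. Then only
continuity in `t` for fixed `τ₀` is left, which classical solutions provide. -/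
lemma continuousOn_of_testFunction (hU : IsPropagator S C c U) (h : CoeffBounds S Λ M)
    {f : Fin n → ℝ → ℝ} {ψ : L2n n} (hf : IsTestFunction f) (hψ : Represents ψ f) :
    ContinuousOn (fun q : ℝ × ℝ => U q.1 q.2 ψ) {q | q.2 ≤ q.1} := by
  obtain ⟨R, hR0, hR⟩ := hU.exists_norm_sub_le h hf hψ
  have hC := hU.C_pos
  have hc := hU.c_nonneg
  rintro ⟨t₀, τ₀⟩ hq₀
  obtain ⟨u, hu⟩ := h.exists_classicalSolution τ₀ hf
  have hψ' : Represents ψ (fun j x => u j (x, τ₀)) :=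
    hψ.congr fun j x hx => (hu.initial j x hx).symm
  have hg : Continuous fun t => U (max t τ₀) τ₀ ψ :=
    (hU.continuousOn_time hu.isNearSolution hψ').comp_continuous (by fun_prop)
      fun t => le_max_right t τ₀
  set μ : ℝ → ℝ := fun s => R * √s * Real.exp (c * s) with hμ
  have hμm : ∀ {s s'}, s ≤ s' → μ s ≤ μ s' := fun hs => by
    simp only [hμ]
    gcongr
  set B : ℝ × ℝ → ℝ := fun q =>
    (1 + C * Real.exp (c * (|q.1| + |q.2| + |τ₀|))) * μ |q.2 - τ₀| with hB
  have hBc : Continuous B := by simp only [hB, hμ]; fun_prop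
  have hB0 : B (t₀, τ₀) = 0 := by simp [hB, hμ]
  have hμ0 : ∀ s, 0 ≤ μ s := fun s => by positivity
  have key : ∀ q ∈ {q : ℝ × ℝ | q.2 ≤ q.1}, ‖U q.1 q.2 ψ - U (max q.1 τ₀) τ₀ ψ‖ ≤ B q := by
    rintro ⟨t, τ⟩ hq
    simp only [mem_ofPred_eq] at hq
    simp only [hB]
    rcases le_or_gt τ₀ t with ht | ht
    · rw [max_eq_left ht]
      rcases le_total τ₀ τ with hτ | hτ
      · rw [← hU.comp h τ₀ τ t hτ hq, ContinuousLinearMap.comp_apply, ← map_sub, ← norm_neg, ← map_neg,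
          neg_sub]
        refine (hU.norm_le τ t hq _).trans ?_
        refine mul_le_mul ?_ ?_ (norm_nonneg _) (by positivity)
        · have : t - τ ≤ |t| + |τ| + |τ₀| := by
            linarith [le_abs_self t, neg_le_abs τ, abs_nonneg τ₀]
          have : C * Real.exp (c * (t - τ)) ≤ C * Real.exp (c * (|t| + |τ| + |τ₀|)) := by gcongr
          linarith
        · rw [abs_of_nonneg (sub_nonneg.2 hτ)]
          exact hR τ₀ τ hτ
      · rw [← hU.comp h τ τ₀ t hτ ht, ContinuousLinearMap.comp_apply, ← map_sub]
        refine (hU.norm_le τ₀ t ht _).trans ?_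
        refine mul_le_mul ?_ ?_ (norm_nonneg _) (by positivity)
        · have : t - τ₀ ≤ |t| + |τ| + |τ₀| := by
            linarith [le_abs_self t, neg_le_abs τ₀, abs_nonneg τ]
          have : C * Real.exp (c * (t - τ₀)) ≤ C * Real.exp (c * (|t| + |τ| + |τ₀|)) := by gcongr
          linarith
        · rw [abs_sub_comm, abs_of_nonneg (sub_nonneg.2 hτ)]
          exact hR τ τ₀ hτ
    -- Here `τ ≤ t < τ₀`, so there is nothing to restart: both `t - τ` and the deviation from the
    -- identity are controlled by `|τ - τ₀|`.
    · rw [max_eq_right ht.le, hU.refl h τ₀, ContinuousLinearMap.id_apply]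
      refine (hR τ t hq).trans ?_
      have h1 : μ (t - τ) ≤ μ |τ - τ₀| := hμm (by
        rw [abs_sub_comm]; exact le_trans (by linarith) (le_abs_self _))
      have h2 : 0 ≤ C * Real.exp (c * (|t| + |τ| + |τ₀|)) * μ |τ - τ₀| :=
        mul_nonneg (by positivity) (hμ0 _)
      simp only [hμ] at h1 h2 ⊢
      linarith
  have h1 : Tendsto (fun q : ℝ × ℝ => U q.1 q.2 ψ - U (max q.1 τ₀) τ₀ ψ)
      (𝓝[{q | q.2 ≤ q.1}] (t₀, τ₀)) (𝓝 0) := by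
    have hBt : Tendsto B (𝓝[{q | q.2 ≤ q.1}] (t₀, τ₀)) (𝓝 0) := by
      have := hBc.continuousWithinAt (s := {q | q.2 ≤ q.1}) (x := (t₀, τ₀))
      rwa [ContinuousWithinAt, hB0] at this
    refine squeeze_zero_norm' ?_ hBt
    filter_upwards [self_mem_nhdsWithin] with q hq using key q hq
  have h2 : Tendsto (fun q : ℝ × ℝ => U (max q.1 τ₀) τ₀ ψ)
      (𝓝[{q | q.2 ≤ q.1}] (t₀, τ₀)) (𝓝 (U t₀ τ₀ ψ)) := by
    have := (hg.comp continuous_fst).continuousWithinAt (s := {q | q.2 ≤ q.1}) (x := (t₀, τ₀))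
    simp only [ContinuousWithinAt, Function.comp_def] at this
    rwa [max_eq_left hq₀] at this
  have := h1.add h2
  simpa [ContinuousWithinAt] using this

/-- Locally uniform limit of the orbits of test functions. -/
lemma strongly_continuous (hU : IsPropagator S C c U) (h : CoeffBounds S Λ M) (v : L2n n) :
    ContinuousOn (fun q : ℝ × ℝ => U q.1 q.2 v) {q | q.2 ≤ q.1} := by
  have hC := hU.C_pos
  have hc := hU.c_nonneg
  refine continuousOn_of_locally_uniform_approx_of_continuousWithinAt fun q₀ hq₀ V hV => ?_
  obtain ⟨ε, hε, hεV⟩ := Metric.mem_uniformity_dist.1 hV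
  -- On the unit ball around `q₀` each of the two times moves by less than `1`, so `t - τ` grows by
  -- less than `2`.
  set D := C * Real.exp (c * (q₀.1 - q₀.2 + 2)) with hD
  have hD0 : 0 < D := by positivity
  obtain ⟨f, ψ, u, hf, -, hψ, -, hn⟩ := h.exists_solution_near 0 v (by positivity : 0 < ε / D)
  refine ⟨{q | q.2 ≤ q.1} ∩ Metric.ball q₀ 1, ?_, fun q => U q.1 q.2 ψ,
    hU.continuousOn_of_testFunction h hf hψ q₀ hq₀, fun q hq => ?_⟩
  · exact inter_mem_nhdsWithin _ (Metric.ball_mem_nhds _ one_pos)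
  · apply hεV
    rw [dist_eq_norm, ← map_sub]
    have hd : q.1 - q.2 ≤ q₀.1 - q₀.2 + 2 := by
      have h0 := hq.2
      rw [Metric.mem_ball, Prod.dist_eq, max_lt_iff, Real.dist_eq, Real.dist_eq, abs_lt,
        abs_lt] at h0
      linarith [h0.1.2, h0.2.1]
    calc ‖U q.1 q.2 (v - ψ)‖ ≤ C * Real.exp (c * (q.1 - q.2)) * ‖v - ψ‖ := hU.norm_le _ _ hq.1 _
      _ ≤ D * ‖v - ψ‖ := by rw [hD]; gcongr
      _ < D * (ε / D) := by gcongr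
      _ = ε := by field_simp

lemma isEvolutionFamily (hU : IsPropagator S C c U) (h : CoeffBounds S Λ M) :
    IsEvolutionFamily U :=
  ⟨hU.refl h, hU.comp h, hU.strongly_continuous h⟩

/-- On approximating data the family is the classical solution itself, so convergence, uniform on
bounded time intervals, follows from the operator bound. -/
theorem generates (hU : IsPropagator S C c U) (h : CoeffBounds S Λ M) : S.Generates U := by
  refine ⟨hU.isEvolutionFamily h, fun τ φ => ⟨?_, fun φl hφl hlim => ?_⟩⟩
  · exact (hU.strongly_continuous h φ).comp (f := fun t : ℝ => (t, τ)) (by fun_prop) fun t ht => ht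
  choose ul hul using fun l => h.exists_classicalSolution τ (hφl l)
  choose ψ hψ using fun l => exists_represents (n := n) (f := φl l)
    fun j => (hφl l j).1.continuous.continuousOn
  have hψ' : ∀ l, Represents (ψ l) fun j x => ul l j (x, τ) := fun l =>
    (hψ l).congr fun j x hx => ((hul l).initial j x hx).symm
  have hconv : Tendsto (fun l => ‖φ - ψ l‖) atTop (𝓝 0) := by
    have h1 : ∀ j, Tendsto (fun l => ‖φ j - ψ l j‖) atTop (𝓝 0) := fun j => by
      have h2 := (ENNReal.tendsto_toReal ENNReal.zero_ne_top).comp (hlim j)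
      refine h2.congr fun l => ?_
      rw [Function.comp_apply, (hψ l).eLpNorm_sub φ j, ENNReal.toReal_ofReal (norm_nonneg _)]
    refine squeeze_zero (fun l => norm_nonneg _) (fun l => ?_)
      (by simpa using tendsto_finsetSum Finset.univ fun j _ => h1 j)
    refine (pi_norm_le_iff_of_nonneg (Finset.sum_nonneg fun j _ => norm_nonneg _)).2 fun j => ?_
    exact Finset.single_le_sum (f := fun j => ‖φ j - ψ l j‖) (fun _ _ => norm_nonneg _)
      (Finset.mem_univ j)
  refine ⟨ul, hul, fun T hT ε hε => ?_⟩
  have hC := hU.C_pos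
  have hc := hU.c_nonneg
  set D := C * Real.exp (c * (T - τ)) with hD
  have hD0 : 0 < D := by positivity
  filter_upwards [hconv.eventually (gt_mem_nhds (by positivity : 0 < ε / D))] with l hl t ht j
  obtain ⟨χ, hχ⟩ := (hul l).isNearSolution.exists_represents ht.1
  rw [hχ.eLpNorm_sub (U t τ φ) j, ← hU.apply τ t _ _ _ ht.1 (hul l).isNearSolution (hψ' l) hχ]
  refine ENNReal.ofReal_le_ofReal ((norm_le_pi_norm (U t τ φ - U t τ (ψ l)) j).trans ?_)
  rw [← map_sub]
  calc ‖U t τ (φ - ψ l)‖ ≤ C * Real.exp (c * (t - τ)) * ‖φ - ψ l‖ := hU.norm_le _ _ ht.1 _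
    _ ≤ D * (ε / D) := by
        have := ht.2
        rw [hD]
        gcongr
    _ = ε := by field_simp

end IsPropagator

/-! ### Smoothing: integration along transversal curves. -/

lemma IsBC1.hasDerivAt_snd {a : ℝ × ℝ → ℝ} (ha : IsBC1 a) {x : ℝ} (hx : x ∈ Icc (0 : ℝ) 1)
    (t : ℝ) :
    HasDerivAt (fun s => a (x, s)) (fderivWithin ℝ a closedStrip (x, t) (0, 1)) t := by
  have := ha.timeC1.hasDeriv x t
  simpa only [clampExt, clampExt', clampUnit_of_mem hx] using this

lemma integral_comp_sub_le {v : ℝ → ℝ} (hv : Continuous v) (hv0 : ∀ s, 0 ≤ v s) {y t₁ t₂ T : ℝ}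
    (h1 : t₁ + 1 ≤ y) (h2 : y ≤ t₂) (hT : ∫ s in t₁..t₂, v s ≤ T) :
    ∫ r in (0 : ℝ)..1, v (y - r) ≤ T := by
  rw [intervalIntegral.integral_comp_sub_left (fun s => v s) y]
  refine le_trans ?_ hT
  exact intervalIntegral.integral_mono_interval (by linarith) (by linarith) (by linarith)
    (Eventually.of_forall fun s => hv0 s) (hv.intervalIntegrable _ _)

/-- Integration along a curve that is transversal to the `k`-th characteristics gains one
derivative: the integral of `u_k` is controlled by the traces on time-like segments. -/
lemma IsNearSolution.abs_integral_curve_le {n : ℕ} {S : HyperbolicProblem n} {Λ M τ : ℝ}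
    (h : CoeffBounds S Λ M) {u : Fin n → ℝ × ℝ → ℝ} (hu : IsNearSolution S τ 0 u)
    (k : Fin n) {x₁ x₂ t₁ t₂ F T : ℝ} (hx₁ : 0 ≤ x₁) (hx : x₁ ≤ x₂) (hx₂ : x₂ ≤ 1)
    (ht₁ : τ ≤ t₁) {y g f f' : ℝ → ℝ}
    (hy : ContDiffOn ℝ 1 y (Icc 0 1)) (hg : ContDiffOn ℝ 1 g (Icc 0 1))
    (hf : ContDiffOn ℝ 1 f (Icc 0 1))
    (hyd : ∀ ξ ∈ Ioo (0 : ℝ) 1, HasDerivAt y (g ξ) ξ)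
    (hfd : ∀ ξ ∈ Ioo (0 : ℝ) 1, HasDerivAt f (f' ξ) ξ)
    (hyI : ∀ ξ ∈ Icc x₁ x₂, y ξ ∈ Icc (t₁ + 1) t₂)
    (hgb : ∀ ξ ∈ Icc (0 : ℝ) 1, |g ξ| ≤ Λ⁻¹) (hfb : ∀ ξ ∈ Icc (0 : ℝ) 1, |f ξ| ≤ F)
    (hfb' : ∀ ξ ∈ Ioo (0 : ℝ) 1, |f' ξ| ≤ F)
    (hT : ∀ x ∈ Icc (0 : ℝ) 1, ∀ l, ∫ s in t₁..t₂, |halfExt τ u l (x, s)| ≤ T) :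
    |∫ ξ in x₁..x₂, f ξ * (g ξ - (S.a k (ξ, y ξ))⁻¹) * u k (ξ, y ξ)| ≤
      F * (2 + (1 + 2 * Λ⁻¹ + M * Λ⁻¹ ^ 2 + Λ⁻¹ * M) * n) * T := by
  have hM := h.M_pos
  have hΛ := h.Λ_pos
  have hF : 0 ≤ F := (abs_nonneg _).trans (hfb 0 (by simp))
  have hsub : Icc x₁ x₂ ⊆ Icc (0 : ℝ) 1 := Icc_subset_Icc hx₁ hx₂
  set Rc := Icc x₁ x₂ ×ˢ Icc (0 : ℝ) 1 with hRc
  -- The second coordinate `r ∈ [0,1]` translates the curve back in time; `r = 0` is the curve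
  -- itself.
  set m : ℝ × ℝ → ℝ × ℝ := fun q => (q.1, y q.1 - q.2) with hm
  have hfst : MapsTo (Prod.fst : ℝ × ℝ → ℝ) Rc (Icc 0 1) := fun q hq => hsub hq.1
  have hmc : ContDiffOn ℝ 1 m Rc :=
    contDiffOn_fst.prodMk ((hy.comp contDiffOn_fst hfst).sub contDiffOn_snd)
  have hmh : MapsTo m Rc (Icc (0 : ℝ) 1 ×ˢ Ici τ) := fun q hq =>
    ⟨hsub hq.1, by
      have := (hyI _ hq.1).1
      have := hq.2.2
      simp only [hm, mem_Ici]; linarith⟩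
  have hms : MapsTo m Rc closedStrip := fun q hq => mem_closedStrip.2 (hsub hq.1)
  have hu1 : ContDiffOn ℝ 1 (fun q => u k (m q)) Rc := (hu.contDiffOn k).comp hmc hmh
  have ha1 : ContDiffOn ℝ 1 (fun q => (S.a k (m q))⁻¹) Rc :=
    ((h.a_bc k).1.comp hmc hms).inv fun q hq => h.a_ne_zero k (hms hq)
  have hf1 : ContDiffOn ℝ 1 (fun q : ℝ × ℝ => f q.1) Rc := hf.comp contDiffOn_fst hfst
  have hg1 : ContDiffOn ℝ 1 (fun q : ℝ × ℝ => g q.1) Rc := hg.comp contDiffOn_fst hfst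
  have hχ : ContDiffOn ℝ 1 (fun q : ℝ × ℝ => 1 - q.2) Rc := by fun_prop
  set ux : ℝ × ℝ → ℝ := fun q => deriv (fun y => u k (y, q.2)) q.1 with hux
  set ut : ℝ × ℝ → ℝ := fun q => deriv (fun s => u k (q.1, s)) q.2 with hut
  set at' : ℝ × ℝ → ℝ := fun q => fderivWithin ℝ (S.a k) closedStrip q (0, 1) with hat
  set PX : ℝ × ℝ → ℝ := fun q => f' q.1 * (1 - q.2) * u k (m q) +
    f q.1 * (1 - q.2) * (ux (m q) + g q.1 * ut (m q)) with hPX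
  set QR : ℝ × ℝ → ℝ := fun q => (-f q.1 * (g q.1 - (S.a k (m q))⁻¹) +
      f q.1 * (1 - q.2) * (-(at' (m q) / S.a k (m q) ^ 2))) * u k (m q) +
    f q.1 * (1 - q.2) * (g q.1 - (S.a k (m q))⁻¹) * (-ut (m q)) with hQR
  -- The factor `1 - r` is `1` on the curve and `0` on the last translate, so the only flux in the
  -- `r` direction is the integral to be estimated. The field is chosen so that the terms with `g
  -- ∂ₜu_k` cancel and `∂ₓu_k + a_k⁻¹ ∂ₜu_k` remains.
  have hdiv := integral2_divergence_rect (f := fun q => f q.1 * (1 - q.2) * u k (m q))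
    (g := fun q => f q.1 * (1 - q.2) * (g q.1 - (S.a k (m q))⁻¹) * u k (m q))
    (fx := PX) (gt := QR) hx zero_le_one ((hf1.mul hχ).mul hu1)
    (((hf1.mul hχ).mul (hg1.sub ha1)).mul hu1) (fun x hxm t htm => ?_) (fun x hxm t htm => ?_)
  · set D := F * (1 + 2 * Λ⁻¹ + M * Λ⁻¹ ^ 2 + Λ⁻¹ * M) with hD
    have hD0 : 0 ≤ D := by positivity
    set H : ℝ × ℝ → ℝ := fun q => D * ∑ l, |halfExt τ u l (q.1, y (clampUnit q.1) - q.2)| with hH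
    have hyc : Continuous fun ξ => y (clampUnit ξ) :=
      hy.continuousOn.comp_continuous continuous_clampUnit clampUnit_mem
    have hHc : Continuous H := by
      have := continuous_halfExt hu.contDiffOn
      have hmap : Continuous fun q : ℝ × ℝ => (q.1, y (clampUnit q.1) - q.2) :=
        continuous_fst.prodMk ((hyc.comp continuous_fst).sub continuous_snd)
      exact continuous_const.mul
        (continuous_finsetSum _ fun l _ => ((this l).comp hmap).abs)
    have hbound : |∫ x in x₁..x₂, ∫ r in (0 : ℝ)..1, PX (x, r) + QR (x, r)| ≤ D * (n * T) := by
      refine (abs_integral2_le (G := fun q => PX q + QR q) hx zero_le_one hHc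
        fun x hxm r hr => ?_).trans ?_
      · have hx' : x ∈ Ioo (0 : ℝ) 1 := ⟨hx₁.trans_lt hxm.1, hxm.2.trans_le hx₂⟩
        have hxc := Ioo_subset_Icc_self hx'
        have hyx := (hyI x (Ioo_subset_Icc_self hxm)).1
        have ht' : τ < y x - r := by linarith [hr.2]
        have hq : (x, y x - r) ∈ closedStrip := mem_closedStrip.2 hxc
        have hres := hu.residual k x hx' _ ht'
        have hres0 := abs_eq_zero.1 (le_antisymm hres (abs_nonneg _))
        have ha0 := h.a_ne_zero k hq
        have hai := h.abs_inv_le k hq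
        have hat1 : |at' (x, y x - r)| ≤ M := abs_apply_le (h.a_le k _ hq).2
        set A := S.a k (x, y x - r) with hA
        set s := ∑ l, |u l (x, y x - r)| with hs
        have hus : |u k (x, y x - r)| ≤ s :=
          Finset.single_le_sum (f := fun l => |u l (x, y x - r)|) (fun _ _ => abs_nonneg _)
            (Finset.mem_univ k)
        have hbs : |∑ l, S.b k l (x, y x - r) * u l (x, y x - r)| ≤ M * s := by
          refine (Finset.abs_sum_le_sum_abs _ _).trans ?_
          rw [hs, Finset.mul_sum]
          refine Finset.sum_le_sum fun l _ => ?_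
          rw [abs_mul]
          exact mul_le_mul_of_nonneg_right (h.b_le k l _ hq).1 (abs_nonneg _)
        have hHe : H (x, r) = D * s := by
          simp only [hH, clampUnit_of_mem hxc, halfExt_of_mem u hxc ht'.le, hs]
        rw [hHe]
        have hr1 : |1 - r| ≤ 1 := abs_le.2 ⟨by linarith [hr.2], by linarith [hr.1]⟩
        -- By the `k`-th equation the divergence contains no derivatives of `u`.
        have hid : PX (x, r) + QR (x, r) =
            (f' x * (1 - r) - f x * (g x - A⁻¹) - f x * (1 - r) * (at' (x, y x - r) * A⁻¹ ^ 2)) *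
              u k (x, y x - r) -
            f x * (1 - r) * A⁻¹ * ∑ l, S.b k l (x, y x - r) * u l (x, y x - r) := by
          have e1 : ∑ l, S.b k l (x, y x - r) * u l (x, y x - r) =
              -(ut (x, y x - r) + A * ux (x, y x - r)) := by linarith
          rw [e1]
          simp only [hPX, hQR, hm, ← hA]
          field_simp
          ring
        rw [hid]
        have g1 : |f' x * (1 - r)| ≤ F := by
          rw [abs_mul]
          exact (mul_le_mul (hfb' x hx') hr1 (abs_nonneg _) hF).trans_eq (mul_one F)
        have g2 : |f x * (g x - A⁻¹)| ≤ F * (2 * Λ⁻¹) := by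
          rw [abs_mul]
          refine mul_le_mul (hfb x hxc) ?_ (abs_nonneg _) hF
          exact (abs_sub _ _).trans (by linarith [hgb x hxc])
        have g0 : |f x * (1 - r)| ≤ F := by
          rw [abs_mul]
          exact (mul_le_mul (hfb x hxc) hr1 (abs_nonneg _) hF).trans_eq (mul_one F)
        have g3 : |f x * (1 - r) * (at' (x, y x - r) * A⁻¹ ^ 2)| ≤ F * (M * Λ⁻¹ ^ 2) := by
          rw [abs_mul]
          refine mul_le_mul g0 ?_ (abs_nonneg _) hF
          rw [abs_mul, abs_pow]
          exact mul_le_mul hat1 (pow_le_pow_left₀ (abs_nonneg _) hai 2) (by positivity) hM.le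
        have g4 : |f x * (1 - r) * A⁻¹ * ∑ l, S.b k l (x, y x - r) * u l (x, y x - r)| ≤
            F * Λ⁻¹ * (M * s) := by
          rw [abs_mul, abs_mul (f x * (1 - r))]
          exact mul_le_mul (mul_le_mul g0 hai (abs_nonneg _) hF) hbs (abs_nonneg _) (by positivity)
        have g5 : |f' x * (1 - r) - f x * (g x - A⁻¹) -
            f x * (1 - r) * (at' (x, y x - r) * A⁻¹ ^ 2)| ≤
            F + F * (2 * Λ⁻¹) + F * (M * Λ⁻¹ ^ 2) :=
          (abs_sub _ _).trans (add_le_add ((abs_sub _ _).trans (add_le_add g1 g2)) g3)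
        have g6 := mul_le_mul g5 hus (abs_nonneg _) (by positivity)
        rw [← abs_mul] at g6
        refine (abs_sub _ _).trans ((add_le_add g6 g4).trans_eq ?_)
        rw [hD]; ring
      -- For fixed `x` the variable `r` sweeps a unit time segment inside `[t₁, t₂]`; this is why
      -- the curve must stay above `t₁ + 1`.
      · have h1 : ∀ x ∈ Icc x₁ x₂, ∫ r in (0 : ℝ)..1, H (x, r) ≤ D * (n * T) := fun x hxm => by
          have hxc := hsub hxm
          simp only [hH]
          rw [intervalIntegral.integral_const_mul]
          refine mul_le_mul_of_nonneg_left ?_ hD0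
          rw [intervalIntegral.integral_finsetSum]
          · calc ∑ l, ∫ r in (0 : ℝ)..1, |halfExt τ u l (x, y (clampUnit x) - r)|
                ≤ ∑ _l : Fin n, T := Finset.sum_le_sum fun l _ => by
                  have hc : Continuous fun s => |halfExt τ u l (x, s)| := by
                    have := continuous_halfExt hu.contDiffOn l
                    fun_prop
                  rw [clampUnit_of_mem hxc]
                  exact integral_comp_sub_le hc (fun _ => abs_nonneg _) (hyI x hxm).1
                    (hyI x hxm).2 (hT x hxc l)
              _ = n * T := by simp
          · intro l _
            refine Continuous.intervalIntegrable ?_ _ _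
            have := continuous_halfExt hu.contDiffOn l
            fun_prop
        have hHx : Continuous fun x => ∫ r in (0 : ℝ)..1, H (x, r) :=
          intervalIntegral.continuous_parametric_intervalIntegral_of_continuous'
            (f := fun x t => H (x, t)) (by exact hHc) _ _
        have hDT : 0 ≤ D * (n * T) := by
          have : 0 ≤ ∫ r in (0 : ℝ)..1, H (x₁, r) :=
            intervalIntegral.integral_nonneg zero_le_one fun r _ => by
              simp only [hH]; positivity
          exact this.trans (h1 x₁ ⟨le_rfl, hx⟩)
        calc ∫ x in x₁..x₂, ∫ r in (0 : ℝ)..1, H (x, r)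
            ≤ ∫ _x in x₁..x₂, D * (n * T) :=
              intervalIntegral.integral_mono_on hx (hHx.intervalIntegrable _ _)
                intervalIntegrable_const h1
          _ = (x₂ - x₁) * (D * (n * T)) := by
              rw [intervalIntegral.integral_const, smul_eq_mul]
          _ ≤ D * (n * T) := mul_le_of_le_one_left hDT (by linarith)
    have hend : ∀ x ∈ Icc x₁ x₂, |∫ r in (0 : ℝ)..1, f x * (1 - r) * u k (x, y x - r)| ≤ F * T := by
      intro x hxm
      have hxc := hsub hxm
      have hc : Continuous fun s => |halfExt τ u k (x, s)| := by
        have := continuous_halfExt hu.contDiffOn k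
        fun_prop
      have h1 := integral_comp_sub_le hc (fun _ => abs_nonneg _) (hyI x hxm).1 (hyI x hxm).2
        (hT x hxc k)
      refine (intervalIntegral.norm_integral_le_of_norm_le
        (f := fun r => f x * (1 - r) * u k (x, y x - r)) zero_le_one (Eventually.of_forall
        fun r hr => ?_) ((hc.comp (by fun_prop : Continuous fun r : ℝ => y x - r)).const_mul
          F |>.intervalIntegrable 0 1)).trans ?_
      · rw [Real.norm_eq_abs, abs_mul, abs_mul, Function.comp_apply,
          halfExt_of_mem u hxc (by linarith [(hyI x hxm).1, hr.2])]
        have hr1 : |1 - r| ≤ 1 := abs_le.2 ⟨by linarith [hr.2], by linarith [hr.1]⟩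
        refine mul_le_mul_of_nonneg_right ?_ (abs_nonneg _)
        exact (mul_le_mul (hfb x hxc) hr1 (abs_nonneg _) hF).trans_eq (mul_one F)
      · rw [intervalIntegral.integral_const_mul]
        exact mul_le_mul_of_nonneg_left h1 hF
    have hQ1 : ∫ x in x₁..x₂, f x * (1 - 1) * (g x - (S.a k (m (x, 1)))⁻¹) * u k (m (x, 1)) = 0 := by
      simp
    have hQ0 : ∫ x in x₁..x₂, f x * (1 - 0) * (g x - (S.a k (m (x, 0)))⁻¹) * u k (m (x, 0)) =
        ∫ ξ in x₁..x₂, f ξ * (g ξ - (S.a k (ξ, y ξ))⁻¹) * u k (ξ, y ξ) := by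
      simp [hm]
    rw [hQ1, hQ0] at hdiv
    have e2 := hend x₂ ⟨hx, le_rfl⟩
    have e1 := hend x₁ ⟨le_rfl, hx⟩
    simp only [hm] at hdiv
    have hfin : ∫ ξ in x₁..x₂, f ξ * (g ξ - (S.a k (ξ, y ξ))⁻¹) * u k (ξ, y ξ) =
        (∫ r in (0 : ℝ)..1, f x₂ * (1 - r) * u k (x₂, y x₂ - r)) -
        (∫ r in (0 : ℝ)..1, f x₁ * (1 - r) * u k (x₁, y x₁ - r)) -
        ∫ x in x₁..x₂, ∫ r in (0 : ℝ)..1, PX (x, r) + QR (x, r) := by linarith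
    rw [hfin]
    refine (abs_sub _ _).trans ((add_le_add ((abs_sub _ _).trans (add_le_add e2 e1))
      hbound).trans_eq ?_)
    rw [hD]; ring
  · have hx' : x ∈ Ioo (0 : ℝ) 1 := ⟨hx₁.trans_lt hxm.1, hxm.2.trans_le hx₂⟩
    have ht' : τ < y x - t := by linarith [htm.2, (hyI x (Ioo_subset_Icc_self hxm)).1]
    have d0 := (hasDerivAt_of_contDiffOn_half (hu.contDiffOn k) hx' ht').1
    have d1 := HasFDerivAt.comp_hasDerivAt (f := fun ξ => (ξ, y ξ - t)) x d0
      ((hasDerivAt_id x).prodMk ((hyd x hx').sub_const t))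
    refine (((hfd x hx').mul_const (1 - t)).mul d1).congr_deriv ?_
    simp [hPX, hm, hux, hut]
    left
    ring
  · have hx' : x ∈ Ioo (0 : ℝ) 1 := ⟨hx₁.trans_lt hxm.1, hxm.2.trans_le hx₂⟩
    have hxc := Ioo_subset_Icc_self hx'
    have ht' : τ < y x - t := by linarith [htm.2, (hyI x (Ioo_subset_Icc_self hxm)).1]
    have d0 := (hasDerivAt_of_contDiffOn_half (hu.contDiffOn k) hx' ht').2.2
    have dl : HasDerivAt (fun s => y x - s) (-1) t := (hasDerivAt_id t).const_sub (y x)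
    have d1 := d0.comp t dl
    have d2 := (((h.a_bc k).hasDerivAt_snd hxc (y x - t)).comp t dl).inv
      (h.a_ne_zero k (mem_closedStrip.2 hxc))
    have d3 : HasDerivAt (fun s : ℝ => 1 - s) (-1) t := (hasDerivAt_id t).const_sub 1
    refine (((d3.const_mul (f x)).mul (d2.const_sub (g x))).mul d1).congr_deriv ?_
    simp [hQR, hm, hut, hat]

/-- The flow of the extended speed shows that the choice in the definition of `omega` is never the
default. -/
lemma CoeffBounds.isCharacteristic_omega {n : ℕ} {S : HyperbolicProblem n} {Λ M : ℝ}
    (h : CoeffBounds S Λ M) (j : Fin n) (x t : ℝ) :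
    S.IsCharacteristic j x t fun ξ => S.omega j ξ x t := by
  obtain ⟨Y, hα, -⟩ := h.exists_charSystem
  have hex : ∃ y, S.IsCharacteristic j x t y := by
    refine ⟨fun ξ => Y.Ω j ξ x t, (Y.flow j).self x t, fun ξ hξ => ?_⟩
    refine (((Y.flow j).deriv ξ x t).congr_deriv ?_).hasDerivWithinAt
    rw [hα j]
    simp only [clampExt_of_mem _ hξ, one_div]
  have he : (fun ξ => S.omega j ξ x t) = hex.choose := by
    funext ξ
    simp only [HyperbolicProblem.omega, dif_pos hex]
  rw [he]
  exact hex.choose_spec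

/-- A function of class `BC¹` along a curve with slope at most `Λ⁻¹`. -/
lemma IsBC1.comp_curve {β : ℝ × ℝ → ℝ} (hβ : IsBC1 β) {N Λ : ℝ} (hΛ : 0 < Λ)
    (hN : ∀ q ∈ closedStrip, |β q| ≤ N ∧ ‖fderivWithin ℝ β closedStrip q‖ ≤ N) {y g : ℝ → ℝ}
    (hy : ContDiffOn ℝ 1 y (Icc 0 1)) (hyd : ∀ ξ ∈ Ioo (0 : ℝ) 1, HasDerivAt y (g ξ) ξ)
    (hgb : ∀ ξ ∈ Icc (0 : ℝ) 1, |g ξ| ≤ Λ⁻¹) :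
    ContDiffOn ℝ 1 (fun ξ => β (ξ, y ξ)) (Icc 0 1) ∧
    ∃ β' : ℝ → ℝ, ∀ ξ ∈ Ioo (0 : ℝ) 1, HasDerivAt (fun ξ => β (ξ, y ξ)) (β' ξ) ξ ∧
      |β' ξ| ≤ N * (1 + Λ⁻¹) := by
  refine ⟨hβ.1.comp (contDiffOn_id.prodMk hy) fun ξ hξ => mem_closedStrip.2 hξ,
    fun ξ => fderivWithin ℝ β closedStrip (ξ, y ξ) (1, g ξ), fun ξ hξ => ⟨?_, ?_⟩⟩
  · have hm : (ξ, y ξ) ∈ closedStrip := mem_closedStrip.2 (Ioo_subset_Icc_self hξ)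
    have h0 : HasFDerivAt β (fderivWithin ℝ β closedStrip (ξ, y ξ)) (ξ, y ξ) :=
      ((hβ.1.differentiableOn one_ne_zero) _ hm).hasFDerivWithinAt.hasFDerivAt
        (closedStrip_mem_nhds hξ (y ξ))
    exact HasFDerivAt.comp_hasDerivAt (f := fun η => (η, y η)) ξ h0
      ((hasDerivAt_id ξ).prodMk (hyd ξ hξ))
  · have hm : (ξ, y ξ) ∈ closedStrip := mem_closedStrip.2 (Ioo_subset_Icc_self hξ)
    have h1 : ‖((1 : ℝ), g ξ)‖ ≤ 1 + Λ⁻¹ := by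
      have h2 := hgb ξ (Ioo_subset_Icc_self hξ)
      have h3 : 0 < Λ⁻¹ := inv_pos.2 hΛ
      rw [Prod.norm_def]
      refine max_le ?_ ?_
      · simp; linarith
      · exact h2.trans (by linarith)
    refine ((fderivWithin ℝ β closedStrip (ξ, y ξ)).le_opNorm _).trans ?_
    have := (hN _ hm).2
    exact mul_le_mul this h1 (norm_nonneg _) ((norm_nonneg _).trans this)

namespace CoeffBounds

variable {n : ℕ} {S : HyperbolicProblem n} {Λ M : ℝ}

lemma contDiffOn_characteristic (h : CoeffBounds S Λ M) {j : Fin n} {x t : ℝ} {y : ℝ → ℝ}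
    (hy : S.IsCharacteristic j x t y) :
    ContDiffOn ℝ 1 y (Icc 0 1) ∧
    (∀ ξ ∈ Ioo (0 : ℝ) 1, HasDerivAt y (S.a j (ξ, y ξ))⁻¹ ξ) ∧
    ContDiffOn ℝ 1 (fun ξ => (S.a j (ξ, y ξ))⁻¹) (Icc 0 1) := by
  have hd : ∀ ξ ∈ Icc (0 : ℝ) 1, HasDerivWithinAt y (S.a j (ξ, y ξ))⁻¹ (Icc 0 1) ξ := fun ξ hξ => by
    simpa only [one_div] using hy.2 ξ hξ
  have hm : MapsTo (fun ξ => (ξ, y ξ)) (Icc (0 : ℝ) 1) closedStrip := fun ξ hξ =>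
    mem_closedStrip.2 hξ
  have hyc : ContinuousOn y (Icc 0 1) := fun ξ hξ => (hd ξ hξ).continuousWithinAt
  have hu := uniqueDiffOn_Icc (zero_lt_one' ℝ)
  have hgc : ContinuousOn (fun ξ => (S.a j (ξ, y ξ))⁻¹) (Icc 0 1) :=
    ((h.a_bc j).1.continuousOn.comp (continuousOn_id.prodMk hyc) hm).inv₀ fun ξ hξ =>
      h.a_ne_zero j (hm hξ)
  have hy1 : ContDiffOn ℝ 1 y (Icc 0 1) := by
    rw [contDiffOn_one_iff_derivWithin hu]
    exact ⟨fun ξ hξ => (hd ξ hξ).differentiableWithinAt,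
      hgc.congr fun ξ hξ => (hd ξ hξ).derivWithin (hu ξ hξ)⟩
  exact ⟨hy1, fun ξ hξ => (hd ξ (Ioo_subset_Icc_self hξ)).hasDerivAt (Icc_mem_nhds hξ.1 hξ.2),
    ((h.a_bc j).1.comp (contDiffOn_id.prodMk hy1) hm).inv fun ξ hξ => h.a_ne_zero j (hm hξ)⟩

lemma abs_characteristic_sub_le (h : CoeffBounds S Λ M) {j : Fin n} {x t : ℝ} {y : ℝ → ℝ}
    (hx : x ∈ Icc (0 : ℝ) 1) (hy : S.IsCharacteristic j x t y) {ξ : ℝ} (hξ : ξ ∈ Icc (0 : ℝ) 1) :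
    |y ξ - t| ≤ Λ⁻¹ := by
  have h1 := (convex_Icc (0 : ℝ) 1).norm_image_sub_le_of_norm_hasDerivWithin_le hy.2
    (C := Λ⁻¹) (fun η hη => by
      rw [one_div]; exact h.abs_inv_le j (mem_closedStrip.2 hη)) hx hξ
  rw [hy.1] at h1
  refine h1.trans (mul_le_of_le_one_right (inv_pos.2 h.Λ_pos).le ?_)
  exact abs_sub_le_one hξ hx

/-- The exponential weight along a characteristic, extended to the whole line. -/
lemma exists_weight (h : CoeffBounds S Λ M) {j : Fin n} {x t : ℝ} (hx : x ∈ Icc (0 : ℝ) 1) :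
    ∃ E : ℝ → ℝ, (∀ ξ ∈ Icc (0 : ℝ) 1, E ξ = S.c j ξ x t) ∧ ContDiff ℝ 1 E ∧
      (∀ ξ ∈ Icc (0 : ℝ) 1, HasDerivAt E (E ξ * (S.b j j (ξ, S.omega j ξ x t) *
        (S.a j (ξ, S.omega j ξ x t))⁻¹)) ξ) ∧
      ∀ ξ ∈ Icc (0 : ℝ) 1, |E ξ| ≤ Real.exp (M * Λ⁻¹) := by
  set y := fun ξ => S.omega j ξ x t with hydef
  have hy := h.isCharacteristic_omega j x t
  set k : ℝ → ℝ := fun η => S.b j j (clampUnit η, y (clampUnit η)) *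
    (S.a j (clampUnit η, y (clampUnit η)))⁻¹ with hk
  have hm : MapsTo (fun ξ => (ξ, y ξ)) (Icc (0 : ℝ) 1) closedStrip := fun ξ hξ =>
    mem_closedStrip.2 hξ
  obtain ⟨hy1, -, hg1⟩ := h.contDiffOn_characteristic hy
  have hkc : Continuous k := by
    have h1 : ContinuousOn (fun ξ => S.b j j (ξ, y ξ) * (S.a j (ξ, y ξ))⁻¹) (Icc 0 1) :=
      ((h.b_bc j j).1.continuousOn.comp (continuousOn_id.prodMk hy1.continuousOn) hm).mul
        hg1.continuousOn
    exact h1.comp_continuous continuous_clampUnit clampUnit_mem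
  have hkb : ∀ η, |k η| ≤ M * Λ⁻¹ := fun η => by
    have hq : (clampUnit η, y (clampUnit η)) ∈ closedStrip := mem_closedStrip.2 (clampUnit_mem η)
    rw [hk, abs_mul]
    exact mul_le_mul (h.b_le j j _ hq).1 (h.abs_inv_le j hq) (abs_nonneg _) h.M_pos.le
  set E : ℝ → ℝ := fun ξ => Real.exp (∫ η in x..ξ, k η) with hE
  have hEd : ∀ ξ, HasDerivAt E (E ξ * k ξ) ξ := fun ξ =>
    (intervalIntegral.integral_hasDerivAt_right (hkc.intervalIntegrable _ _)
      hkc.stronglyMeasurable.stronglyMeasurableAtFilter hkc.continuousAt).exp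
  have hEc : Continuous E := continuous_iff_continuousAt.2 fun ξ => (hEd ξ).continuousAt
  refine ⟨E, fun ξ hξ => ?_, ?_, fun ξ hξ => ?_, fun ξ hξ => ?_⟩
  · simp only [hE, HyperbolicProblem.c]
    congr 1
    refine intervalIntegral.integral_congr fun η hη => ?_
    have hη' : η ∈ Icc (0 : ℝ) 1 := uIcc_subset_Icc hx hξ hη
    simp only [hk, clampUnit_of_mem hη', hydef, div_eq_mul_inv]
  · refine contDiff_one_iff_deriv.2 ⟨fun ξ => (hEd ξ).differentiableAt, ?_⟩
    have : deriv E = fun ξ => E ξ * k ξ := funext fun ξ => (hEd ξ).deriv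
    rw [this]
    exact hEc.mul hkc
  · have := hEd ξ
    simpa only [hk, clampUnit_of_mem hξ] using this
  · rw [hE, Real.abs_exp]
    refine Real.exp_le_exp.2 ((le_abs_self _).trans ?_)
    refine (abs_intervalIntegral_le fun s _ => hkb s).trans ?_
    have := h.M_pos
    have := h.Λ_pos
    exact mul_le_of_le_one_right (by positivity) (abs_sub_le_one hξ hx)

lemma exists_levy (h : CoeffBounds S Λ M) (hL : S.LevyCondition) :
    ∃ (β : Fin n → Fin n → ℝ × ℝ → ℝ) (N : ℝ), (∀ j k, IsBC1 (β j k)) ∧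
      (∀ j k, ∀ q ∈ closedStrip, |β j k q| ≤ N ∧ ‖fderivWithin ℝ (β j k) closedStrip q‖ ≤ N) ∧
      ∀ j k, j ≠ k → ∀ q ∈ closedStrip, S.b j k q = β j k q * (S.a k q - S.a j q) := by
  have h1 : ∀ j k, ∃ β : ℝ × ℝ → ℝ, IsBC1 β ∧
      (j ≠ k → ∀ q ∈ closedStrip, S.b j k q = β q * (S.a k q - S.a j q)) := fun j k => by
    rcases eq_or_ne j k with rfl | hjk
    · exact ⟨S.b j j, h.b_bc j j, fun hne => absurd rfl hne⟩
    · obtain ⟨β, hβ, he⟩ := hL j k hjk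
      exact ⟨β, hβ, fun _ => he⟩
  choose β hβ he using h1
  choose N hN using fun j k => (hβ j k).2
  have hle : ∀ j k, N j k ≤ ∑ j, ∑ k, |N j k| := fun j k =>
    (le_abs_self _).trans ((Finset.single_le_sum (f := fun k => |N j k|)
      (fun _ _ => abs_nonneg _) (Finset.mem_univ k)).trans
      (Finset.single_le_sum (f := fun j => ∑ k, |N j k|)
        (fun _ _ => Finset.sum_nonneg fun _ _ => abs_nonneg _) (Finset.mem_univ j)))
  exact ⟨β, ∑ j, ∑ k, |N j k|, hβ, fun j k q hq =>
    ⟨((hN j k q hq).1).trans (hle j k), ((hN j k q hq).2).trans (hle j k)⟩, he⟩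

/-- The difference between a solution and its boundary contribution along the characteristics is
controlled by the traces on time-like segments. -/
theorem exists_abs_sub_CP_le (h : CoeffBounds S Λ M) (hL : S.LevyCondition) :
    ∃ K, 0 ≤ K ∧ ∀ (τ : ℝ) (u : Fin n → ℝ × ℝ → ℝ), IsNearSolution S τ 0 u →
      ∀ x ∈ Icc (0 : ℝ) 1, ∀ t T : ℝ, τ ≤ t - Λ⁻¹ - 1 →
      (∀ x ∈ Icc (0 : ℝ) 1, ∀ l, ∫ s in (t - Λ⁻¹ - 1)..(t + Λ⁻¹), |halfExt τ u l (x, s)| ≤ T) →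
      ∀ j, |halfExt τ u j (x, t) - S.C (S.P (halfExt τ u)) j (x, t)| ≤ K * T := by
  obtain ⟨β, N, hβ, hN, hbβ⟩ := h.exists_levy hL
  have hM := h.M_pos
  have hΛ := h.Λ_pos
  rcases isEmpty_or_nonempty (Fin n) with hemp | ⟨⟨j₀⟩⟩
  · exact ⟨0, le_rfl, fun τ u hu x hx t T ht hT j => (hemp.false j).elim⟩
  have hN0 : 0 ≤ N := (abs_nonneg _).trans (hN j₀ j₀ (0, 0) (mem_closedStrip.2 (by simp))).1
  set e₀ := Real.exp (M * Λ⁻¹) with he₀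
  -- `F` dominates both the multiplier `E β a_k` on the curve and its derivative: the summand `M
  -- Λ⁻¹` comes from `E'`, the two copies of `1 + Λ⁻¹` from `β` and `a_k`.
  set F := e₀ * N * M * (1 + M * Λ⁻¹ + 2 * (1 + Λ⁻¹)) with hF
  set L := F * (2 + (1 + 2 * Λ⁻¹ + M * Λ⁻¹ ^ 2 + Λ⁻¹ * M) * n) with hLd
  refine ⟨n * L, by positivity, fun τ u hu x hx t T ht hT j => ?_⟩
  obtain ⟨E, hEc, hE1, hEd, hEb⟩ := h.exists_weight (j := j) (t := t) hx
  have hy := h.isCharacteristic_omega j x t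
  set y := fun ξ => S.omega j ξ x t with hydef
  replace hEd : ∀ ξ ∈ Icc (0 : ℝ) 1,
      HasDerivAt E (E ξ * (S.b j j (ξ, y ξ) * (S.a j (ξ, y ξ))⁻¹)) ξ := hEd
  obtain ⟨hy1, hyd, hg1⟩ := h.contDiffOn_characteristic hy
  set g := fun ξ => (S.a j (ξ, y ξ))⁻¹ with hg
  have hgb : ∀ ξ ∈ Icc (0 : ℝ) 1, |g ξ| ≤ Λ⁻¹ := fun ξ hξ =>
    h.abs_inv_le j (mem_closedStrip.2 hξ)
  have hΛi : 0 < Λ⁻¹ := inv_pos.2 hΛ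
  have hyI : ∀ ξ ∈ Icc (0 : ℝ) 1, y ξ ∈ Icc (t - Λ⁻¹ - 1 + 1) (t + Λ⁻¹) := fun ξ hξ => by
    have := abs_le.1 (h.abs_characteristic_sub_le hx hy hξ)
    exact ⟨by linarith [this.1], by linarith [this.2]⟩
  have hyτ : ∀ ξ ∈ Icc (0 : ℝ) 1, τ < y ξ := fun ξ hξ => by linarith [(hyI ξ hξ).1]
  have hcu : ∀ k, ContinuousOn (fun ξ => u k (ξ, y ξ)) (Icc 0 1) := fun k =>
    (hu.contDiffOn k).continuousOn.comp (continuousOn_id.prodMk hy1.continuousOn)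
      fun ξ hξ => ⟨hξ, (hyτ ξ hξ).le⟩
  -- Chosen so that `f_k (1/a_j - 1/a_k) = E b_jk / a_j` for `k ≠ j`; for `k = j` the bracket
  -- vanishes whatever `β_jj` is.
  set f : Fin n → ℝ → ℝ := fun k ξ => E ξ * β j k (ξ, y ξ) * S.a k (ξ, y ξ) with hf
  have hβc := fun k => (hβ j k).comp_curve hΛ (hN j k) hy1 hyd hgb
  have hac := fun k => (h.a_bc k).comp_curve hΛ (h.a_le k) hy1 hyd hgb
  have hf1 : ∀ k, ContDiffOn ℝ 1 (f k) (Icc 0 1) := fun k =>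
    (hE1.contDiffOn.mul (hβc k).1).mul (hac k).1
  have hterm : ∀ k a b, 0 ≤ a → a ≤ b → b ≤ 1 →
      |∫ ξ in a..b, f k ξ * (g ξ - (S.a k (ξ, y ξ))⁻¹) * u k (ξ, y ξ)| ≤ L * T := by
    intro k a b ha hab hb
    obtain ⟨β', hβ'⟩ := (hβc k).2
    obtain ⟨a', ha'⟩ := (hac k).2
    set E' : ℝ → ℝ := fun ξ => E ξ * (S.b j j (ξ, y ξ) * (S.a j (ξ, y ξ))⁻¹) with hE'
    have hE'b : ∀ ξ ∈ Icc (0 : ℝ) 1, |E' ξ| ≤ e₀ * (M * Λ⁻¹) := fun ξ hξ => by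
      have hq : (ξ, y ξ) ∈ closedStrip := mem_closedStrip.2 hξ
      rw [hE', abs_mul, abs_mul]
      exact mul_le_mul (hEb ξ hξ) (mul_le_mul (h.b_le j j _ hq).1 (h.abs_inv_le j hq)
        (abs_nonneg _) hM.le) (by positivity) (by positivity)
    refine hu.abs_integral_curve_le h k ha hab hb ht hy1 hg1 (hf1 k)
      (f' := fun ξ => (E' ξ * β j k (ξ, y ξ) + E ξ * β' ξ) * S.a k (ξ, y ξ) +
        E ξ * β j k (ξ, y ξ) * a' ξ) hyd (fun ξ hξ => ?_)
      (fun ξ hξ => hyI ξ ⟨ha.trans hξ.1, hξ.2.trans hb⟩) hgb (fun ξ hξ => ?_) (fun ξ hξ => ?_) hT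
    · exact ((hEd ξ (Ioo_subset_Icc_self hξ)).mul (hβ' ξ hξ).1).mul (ha' ξ hξ).1
    · have hq : (ξ, y ξ) ∈ closedStrip := mem_closedStrip.2 hξ
      simp only [hf]
      rw [abs_mul, abs_mul]
      calc |E ξ| * |β j k (ξ, y ξ)| * |S.a k (ξ, y ξ)| ≤ e₀ * N * M := by
            refine mul_le_mul (mul_le_mul (hEb ξ hξ) (hN j k _ hq).1 (abs_nonneg _)
              (by positivity)) (h.a_le k _ hq).1 (abs_nonneg _) (by positivity)
        _ ≤ F := by
            rw [hF]
            refine le_mul_of_one_le_right (by positivity) ?_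
            have : 0 < M * Λ⁻¹ := by positivity
            linarith
    · have hξ' := Ioo_subset_Icc_self hξ
      have hq : (ξ, y ξ) ∈ closedStrip := mem_closedStrip.2 hξ'
      have b1 : |E' ξ * β j k (ξ, y ξ)| ≤ e₀ * (M * Λ⁻¹) * N := by
        rw [abs_mul]
        exact mul_le_mul (hE'b ξ hξ') (hN j k _ hq).1 (abs_nonneg _) (by positivity)
      have b2 : |E ξ * β' ξ| ≤ e₀ * (N * (1 + Λ⁻¹)) := by
        rw [abs_mul]
        exact mul_le_mul (hEb ξ hξ') (hβ' ξ hξ).2 (abs_nonneg _) (by positivity)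
      have b3 : |(E' ξ * β j k (ξ, y ξ) + E ξ * β' ξ) * S.a k (ξ, y ξ)| ≤
          (e₀ * (M * Λ⁻¹) * N + e₀ * (N * (1 + Λ⁻¹))) * M := by
        rw [abs_mul]
        exact mul_le_mul ((abs_add_le _ _).trans (add_le_add b1 b2)) (h.a_le k _ hq).1
          (abs_nonneg _) (by positivity)
      have b4 : |E ξ * β j k (ξ, y ξ) * a' ξ| ≤ e₀ * N * (M * (1 + Λ⁻¹)) := by
        rw [abs_mul, abs_mul]
        exact mul_le_mul (mul_le_mul (hEb ξ hξ') (hN j k _ hq).1 (abs_nonneg _)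
          (by positivity)) (ha' ξ hξ).2 (abs_nonneg _) (by positivity)
      refine (abs_add_le _ _).trans ((add_le_add b3 b4).trans ?_)
      rw [hF]
      have : 0 ≤ e₀ * N * M := by positivity
      linarith
  -- The weight `E` is the integrating factor of the diagonal term, so only the couplings with `k ≠
  -- j` appear in `v'`.
  set v : ℝ → ℝ := fun ξ => E ξ * u j (ξ, y ξ) with hv
  have hincr : ∀ a b, 0 ≤ a → a ≤ b → b ≤ 1 → |v b - v a| ≤ n * L * T := by
    intro a b ha hab hb
    have hsub : Icc a b ⊆ Icc (0 : ℝ) 1 := Icc_subset_Icc ha hb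
    have hci : ∀ k, IntervalIntegrable
        (fun ξ => f k ξ * (g ξ - (S.a k (ξ, y ξ))⁻¹) * u k (ξ, y ξ)) volume a b := fun k => by
      refine ContinuousOn.intervalIntegrable ?_
      rw [uIcc_of_le hab]
      refine ContinuousOn.mono ?_ hsub
      exact ((hf1 k).continuousOn.mul (hg1.continuousOn.sub ((hac k).1.continuousOn.inv₀
        fun ξ hξ => h.a_ne_zero k (mem_closedStrip.2 hξ)))).mul (hcu k)
    have hint := intervalIntegral.integral_eq_sub_of_hasDerivAt_of_le (f := v)
      (f' := fun ξ => -∑ k, f k ξ * (g ξ - (S.a k (ξ, y ξ))⁻¹) * u k (ξ, y ξ)) hab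
      ((hE1.continuous.continuousOn.mul (hcu j)).mono hsub) (fun ξ hξ => ?_)
      ((IntervalIntegrable.sum Finset.univ fun k _ => hci k).neg.congr fun ξ _ => by
        simp [Finset.sum_apply])
    · rw [← hint, intervalIntegral.integral_neg, abs_neg,
        intervalIntegral.integral_finsetSum fun k _ => hci k]
      refine (Finset.abs_sum_le_sum_abs _ _).trans ?_
      calc _ ≤ ∑ _k : Fin n, L * T := Finset.sum_le_sum fun k _ => hterm k a b ha hab hb
        _ = _ := by simp [mul_assoc]
    · have hξ' : ξ ∈ Ioo (0 : ℝ) 1 := ⟨ha.trans_lt hξ.1, hξ.2.trans_le hb⟩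
      have hξc := Ioo_subset_Icc_self hξ'
      have hq : (ξ, y ξ) ∈ closedStrip := mem_closedStrip.2 hξc
      have d0 := (hasDerivAt_of_contDiffOn_half (hu.contDiffOn j) hξ' (hyτ ξ hξc)).1
      have d1 := HasFDerivAt.comp_hasDerivAt (f := fun ξ => (ξ, y ξ)) ξ d0
        ((hasDerivAt_id ξ).prodMk (hyd ξ hξ'))
      refine ((hEd ξ hξc).mul d1).congr_deriv ?_
      have hres0 := abs_eq_zero.1
        (le_antisymm (hu.residual j ξ hξ' _ (hyτ ξ hξc)) (abs_nonneg _))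
      have haj := h.a_ne_zero j hq
      have hsum : ∑ k, f k ξ * (g ξ - (S.a k (ξ, y ξ))⁻¹) * u k (ξ, y ξ) =
          E ξ * g ξ * ((∑ k, S.b j k (ξ, y ξ) * u k (ξ, y ξ)) - S.b j j (ξ, y ξ) * u j (ξ, y ξ)) := by
        rw [← Finset.add_sum_erase _ _ (Finset.mem_univ j),
          ← Finset.add_sum_erase _ (fun k => S.b j k (ξ, y ξ) * u k (ξ, y ξ)) (Finset.mem_univ j)]
        have e1 : f j ξ * (g ξ - (S.a j (ξ, y ξ))⁻¹) * u j (ξ, y ξ) = 0 := by simp [hg]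
        rw [e1, zero_add, add_sub_cancel_left, Finset.mul_sum]
        refine Finset.sum_congr rfl fun k hk => ?_
        have hak := h.a_ne_zero k hq
        rw [hbβ j k (Finset.ne_of_mem_erase hk).symm _ hq]
        simp only [hf, hg]
        field_simp
      rw [hsum]
      have e2 : ∑ k, S.b j k (ξ, y ξ) * u k (ξ, y ξ) =
          -(deriv (fun s => u j (ξ, s)) (y ξ) +
            S.a j (ξ, y ξ) * deriv (fun z => u j (z, y ξ)) ξ) := by linarith
      rw [e2]
      simp only [hg, add_apply, smul_apply,
        ContinuousLinearMap.coe_fst', ContinuousLinearMap.coe_snd', smul_eq_mul, Function.comp_apply]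
      field_simp
      ring
  have hvx : v x = halfExt τ u j (x, t) := by
    have hyx : y x = t := hy.1
    have hcx : S.c j x x t = 1 := by simp [HyperbolicProblem.c]
    rw [halfExt_of_mem u hx (by linarith)]
    simp only [hv, hyx, hEc x hx, hcx, one_mul]
  have hin : (S.inPt j : ℝ) ∈ Icc (0 : ℝ) 1 := (S.inPt j).2
  -- At the inflow end the boundary condition turns `v` into `CPu`, while at `x` the weight is `1`
  -- and `v` is `u_j(x,t)`.
  have hvin : v (S.inPt j) = S.C (S.P (halfExt τ u)) j (x, t) := by
    have h1 := hu.boundary j (y (S.inPt j)) (hyτ _ hin).le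
    simp only [hv, HyperbolicProblem.C, hEc _ hin]
    rw [h1]
    congr 1
    simp only [HyperbolicProblem.P]
    refine Finset.sum_congr rfl fun k _ => ?_
    rw [halfExt_of_mem u (S.outPt k).2 (hyτ _ hin).le]
  rw [← hvx, ← hvin]
  rcases le_total (S.inPt j : ℝ) x with hle | hle
  · exact hincr _ _ hin.1 hle hx.2
  · rw [abs_sub_comm]
    exact hincr _ _ hx.1 hle hin.2

end CoeffBounds

/-! ### From the defect `u - CPu` to a supremum bound. -/

/-- Nonnegativity of the variance of `|v|`, `c` being the mean. -/
lemma sq_integral_abs_le {v : ℝ → ℝ} (hv : Continuous v) {a b : ℝ} (hab : a < b) :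
    (∫ s in a..b, |v s|) ^ 2 ≤ (b - a) * ∫ s in a..b, v s ^ 2 := by
  set J := ∫ s in a..b, |v s| with hJ
  set c := J / (b - a) with hc
  have hL : 0 < b - a := sub_pos.2 hab
  have h1 : 0 ≤ ∫ s in a..b, (|v s| - c) ^ 2 :=
    intervalIntegral.integral_nonneg hab.le fun s _ => sq_nonneg _
  have h2 : ∫ s in a..b, (|v s| - c) ^ 2 =
      (∫ s in a..b, v s ^ 2) - 2 * c * J + c ^ 2 * (b - a) := by
    have i1 : IntervalIntegrable (fun s => v s ^ 2) volume a b :=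
      (hv.pow 2).intervalIntegrable _ _
    have i2 : IntervalIntegrable (fun s => 2 * c * |v s|) volume a b :=
      (continuous_const.mul hv.abs).intervalIntegrable _ _
    have e : ∀ s, (|v s| - c) ^ 2 = v s ^ 2 - 2 * c * |v s| + c ^ 2 := fun s => by
      rw [← sq_abs (v s)]; ring
    simp only [e]
    rw [intervalIntegral.integral_add (i1.sub i2) intervalIntegrable_const,
      intervalIntegral.integral_sub i1 i2, intervalIntegral.integral_const_mul,
      intervalIntegral.integral_const, smul_eq_mul]
    ring
  have h3 : c * (b - a) = J := by rw [hc]; field_simp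
  rw [h2] at h1
  have h4 : (b - a) * ((∫ s in a..b, v s ^ 2) - 2 * c * J + c ^ 2 * (b - a)) =
      (b - a) * (∫ s in a..b, v s ^ 2) - J ^ 2 := by
    rw [← h3]; ring
  have := mul_nonneg hL.le h1
  linarith

namespace CoeffBounds

variable {n : ℕ} {S : HyperbolicProblem n} {Λ M : ℝ}

/-- `CP` is local in time: a characteristic crosses the strip within time `Λ⁻¹`, so only traces that
close to `t` matter. -/
lemma abs_CP_sub_le (h : CoeffBounds S Λ M) {w w' : Fin n → ℝ × ℝ → ℝ} {ρ x t : ℝ}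
    (hx : x ∈ Icc (0 : ℝ) 1)
    (hw : ∀ k, ∀ z ∈ Icc (0 : ℝ) 1, ∀ s, |s - t| ≤ Λ⁻¹ → |w k (z, s) - w' k (z, s)| ≤ ρ)
    (j : Fin n) :
    |S.C (S.P w) j (x, t) - S.C (S.P w') j (x, t)| ≤ Real.exp (M * Λ⁻¹) * (n * M) * ρ := by
  obtain ⟨E, hEc, -, -, hEb⟩ := h.exists_weight (j := j) (t := t) hx
  have hin : (S.inPt j : ℝ) ∈ Icc (0 : ℝ) 1 := (S.inPt j).2
  have hc := hEb _ hin
  rw [hEc _ hin] at hc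
  simp only [HyperbolicProblem.C, HyperbolicProblem.P]
  rw [← mul_sub, abs_mul, mul_assoc]
  refine mul_le_mul hc ?_ (abs_nonneg _) (Real.exp_nonneg _)
  rw [← Finset.sum_sub_distrib]
  refine (Finset.abs_sum_le_sum_abs _ _).trans ?_
  calc _ ≤ ∑ _k : Fin n, M * ρ := Finset.sum_le_sum fun k _ => by
        rw [← mul_sub, abs_mul]
        exact mul_le_mul (h.p_le j k) (hw k _ (S.outPt k).2 _
          (h.abs_characteristic_sub_le hx (h.isCharacteristic_omega j x t) hin))
          (abs_nonneg _) h.M_pos.le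
    _ = n * M * ρ := by simp [mul_assoc]

/-- If the `k`-th power of the operator `CP` vanishes, then a function is controlled by the defect
in the fixed point equation for `CP`. -/
lemma abs_le_of_iterate (h : CoeffBounds S Λ M) {w : Fin n → ℝ × ℝ → ℝ} {k : ℕ}
    (hk : ∀ j, ∀ q ∈ closedStrip, ((fun w => S.C (S.P w))^[k] w) j q = 0) {ρ s₁ s₂ : ℝ}
    (hρ : ∀ j, ∀ x ∈ Icc (0 : ℝ) 1, ∀ t ∈ Icc s₁ s₂,
      |w j (x, t) - S.C (S.P w) j (x, t)| ≤ ρ) (j : Fin n) {x t : ℝ} (hx : x ∈ Icc (0 : ℝ) 1)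
    (ht : t ∈ Icc (s₁ + k * Λ⁻¹) (s₂ - k * Λ⁻¹)) :
    |w j (x, t)| ≤ (∑ i ∈ Finset.range k, (Real.exp (M * Λ⁻¹) * (n * M)) ^ i) * ρ := by
  set T : (Fin n → ℝ × ℝ → ℝ) → Fin n → ℝ × ℝ → ℝ := fun w => S.C (S.P w) with hT
  set B := Real.exp (M * Λ⁻¹) * (n * M) with hB
  have hΛi : 0 < Λ⁻¹ := inv_pos.2 h.Λ_pos
  -- Telescoping differences of iterates; every application of `CP` costs a margin `Λ⁻¹` at both
  -- ends of the time interval.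
  have step : ∀ i : ℕ, ∀ j, ∀ x ∈ Icc (0 : ℝ) 1, ∀ t ∈ Icc (s₁ + i * Λ⁻¹) (s₂ - i * Λ⁻¹),
      |(T^[i] w) j (x, t) - (T^[i + 1] w) j (x, t)| ≤ B ^ i * ρ := by
    intro i
    induction i with
    | zero =>
      intro j x hx t ht
      simpa [hT] using hρ j x hx t (by simpa using ht)
    | succ i ih =>
      intro j x hx t ht
      rw [Function.iterate_succ_apply', Function.iterate_succ_apply' (n := i + 1), pow_succ',
        mul_assoc]
      refine h.abs_CP_sub_le hx (fun k z hz s hs => ih k z hz s ?_) j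
      have hs' := abs_le.1 hs
      have := ht.1
      have := ht.2
      push_cast at *
      constructor <;> linarith [hs'.1, hs'.2]
  have sum : ∀ i : ℕ, i ≤ k → |w j (x, t) - (T^[i] w) j (x, t)| ≤
      (∑ l ∈ Finset.range i, B ^ l) * ρ := by
    intro i
    induction i with
    | zero => intro _; simp
    | succ i ih =>
      intro hi
      have h1 := ih (by omega)
      have h2 := step i j x hx t (by
        have : (i : ℝ) * Λ⁻¹ ≤ k * Λ⁻¹ :=
          mul_le_mul_of_nonneg_right (by exact_mod_cast (by omega : i ≤ k)) hΛi.le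
        exact ⟨by linarith [ht.1], by linarith [ht.2]⟩)
      rw [Finset.sum_range_succ, add_mul]
      exact (abs_sub_le _ _ _).trans (add_le_add h1 h2)
  have := sum k le_rfl
  rwa [hk j (x, t) (mem_closedStrip.2 hx), sub_zero] at this

/-- Classical solutions are bounded, after a certain time, by the `L²` norm of their initial
values. -/
theorem exists_sup_estimate (h : CoeffBounds S Λ M) (hCP : S.CPNilpotent)
    (hL : S.LevyCondition) :
    ∃ T₀ > 0, ∀ α > 0, ∃ K > 0, ∀ (τ : ℝ) (u : Fin n → ℝ × ℝ → ℝ) (φ : L2n n),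
      IsNearSolution S τ 0 u → Represents φ (fun j x => u j (x, τ)) →
      ∀ t ∈ Icc (τ + T₀) (τ + T₀ + α), ∀ j, ∀ x ∈ Icc (0 : ℝ) 1, |u j (x, t)| ≤ K * ‖φ‖ := by
  obtain ⟨k, hk⟩ := hCP
  obtain ⟨K₀, hK₀, hD⟩ := h.exists_abs_sub_CP_le hL
  obtain ⟨C, c, hC, hc, hE⟩ := h.exists_energy_estimate
  have hΛ := h.Λ_pos
  have hM := h.M_pos
  have hΛi : 0 < Λ⁻¹ := inv_pos.2 hΛ
  -- The defect is controlled from `τ + Λ⁻¹ + 1` on, and the `k` iterations consume a further `k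
  -- Λ⁻¹`.
  set T₀ := (k + 1) * Λ⁻¹ + 1 with hT₀
  refine ⟨T₀, by positivity, fun α hα => ?_⟩
  -- The last time that is looked at: `k Λ⁻¹` ahead for the iterations and one more `Λ⁻¹` for the
  -- trace window, whose length is `L`.
  set Θ := T₀ + α + (k + 1) * Λ⁻¹ with hΘ
  set L := 2 * Λ⁻¹ + 1 with hLdef
  -- Cauchy–Schwarz on the window, the trace estimate and the energy estimate, multiplied together.
  set A := L * (Λ⁻¹ * ((4 + 2 * (2 * M + 1 + n * M + M) * L) * (C * n * Real.exp (c * Θ)))) with hA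
  set G := ∑ i ∈ Finset.range k, (Real.exp (M * Λ⁻¹) * (n * M)) ^ i with hG
  have hG0 : 0 ≤ G := Finset.sum_nonneg fun i _ => by positivity
  refine ⟨G * (K₀ * √A) + 1, by positivity, fun τ u φ hu hφ t ht j x hx => ?_⟩
  have hcont := fun l => continuous_halfExt hu.contDiffOn l
  have hen : ∀ s, τ ≤ s → s ≤ τ + Θ → energy τ u s ≤ C * n * Real.exp (c * Θ) * ‖φ‖ ^ 2 := by
    intro s hs hs'
    have h1 := hE τ 0 u hu s hs
    have h2 := hφ.energy_le hu.contDiffOn le_rfl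
    have h3 : Real.exp (c * (s - τ)) ≤ Real.exp (c * Θ) :=
      Real.exp_le_exp.2 (mul_le_mul_of_nonneg_left (by linarith) hc)
    calc energy τ u s ≤ C * (energy τ u τ + 0 ^ 2 * (s - τ)) * Real.exp (c * (s - τ)) := h1
      _ = C * energy τ u τ * Real.exp (c * (s - τ)) := by ring
      _ ≤ C * (n * ‖φ‖ ^ 2) * Real.exp (c * Θ) := by gcongr
      _ = _ := by ring
  have hk1 : (0 : ℝ) ≤ k * Λ⁻¹ := by positivity
  have htrace : ∀ s, τ + Λ⁻¹ + 1 ≤ s → s ≤ τ + T₀ + α + k * Λ⁻¹ → ∀ z ∈ Icc (0 : ℝ) 1, ∀ l,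
      ∫ r in (s - Λ⁻¹ - 1)..(s + Λ⁻¹), |halfExt τ u l (z, r)| ≤ √A * ‖φ‖ := by
    intro s hs1 hs2 z hz l
    have hlen : s + Λ⁻¹ - (s - Λ⁻¹ - 1) = L := by rw [hLdef]; ring
    have h1 := sq_integral_abs_le ((hcont l).comp (by fun_prop : Continuous fun r : ℝ => (z, r)))
      (by linarith : s - Λ⁻¹ - 1 < s + Λ⁻¹)
    have h2 := hu.trace_le h l hz (by linarith : τ ≤ s - Λ⁻¹ - 1)
      (by linarith : s - Λ⁻¹ - 1 ≤ s + Λ⁻¹) fun r hr => hen r (by linarith [hr.1]) (by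
        rw [hΘ]; linarith [hr.2])
    have h3 : ∫ r in (s - Λ⁻¹ - 1)..(s + Λ⁻¹), halfExt τ u l (z, r) ^ 2 =
        ∫ r in (s - Λ⁻¹ - 1)..(s + Λ⁻¹), u l (z, r) ^ 2 :=
      intervalIntegral.integral_congr fun r hr => by
        rw [uIcc_of_le (by linarith)] at hr
        simp only [halfExt_of_mem u hz (by linarith [hr.1] : τ ≤ r)]
    simp only [Function.comp_def] at h1
    rw [h3, hlen] at h1
    rw [hlen] at h2
    have h4 : ∫ r in (s - Λ⁻¹ - 1)..(s + Λ⁻¹), u l (z, r) ^ 2 ≤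
        Λ⁻¹ * ((4 + 2 * (2 * M + 1 + n * M + M) * L) *
          (C * n * Real.exp (c * Θ) * ‖φ‖ ^ 2)) := by
      rw [inv_mul_eq_div, le_div_iff₀' hΛ]
      exact h2
    have hA0 : 0 ≤ A := by positivity
    refine (abs_le_of_sq_le_sq' ?_ (by positivity)).2
    rw [mul_pow, Real.sq_sqrt hA0]
    refine h1.trans ((mul_le_mul_of_nonneg_left h4 (by positivity)).trans_eq ?_)
    rw [hA]; ring
  have hdef : ∀ j, ∀ z ∈ Icc (0 : ℝ) 1, ∀ s ∈ Icc (τ + Λ⁻¹ + 1) (τ + T₀ + α + k * Λ⁻¹),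
      |halfExt τ u j (z, s) - S.C (S.P (halfExt τ u)) j (z, s)| ≤ K₀ * (√A * ‖φ‖) :=
    fun j z hz s hs => hD τ u hu z hz s _ (by linarith [hs.1]) (htrace s hs.1 hs.2) j
  have := h.abs_le_of_iterate (hk (halfExt τ u) fun j => (hcont j).continuousOn) hdef j hx
    (t := t) ⟨by rw [hT₀] at ht; linarith [ht.1], by linarith [ht.2]⟩
  have hT₀0 : 0 < T₀ := by positivity
  rw [halfExt_of_mem u hx (by linarith [ht.1])] at this
  refine this.trans ?_
  have hn := norm_nonneg φ
  calc G * (K₀ * (√A * ‖φ‖)) = G * (K₀ * √A) * ‖φ‖ := by ring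
    _ ≤ _ := by rw [add_mul]; linarith

end CoeffBounds

/-! ### Passage to `Y₀` and the main theorem. -/

/-- Needed for continuous functions that agree almost everywhere to be equal, that is, for `Y₀` to
embed injectively. A nonempty relatively open set meets the open interval. -/
instance isOpenPosMeasure_volume_unitInterval : (volume : Measure I).IsOpenPosMeasure := by
  refine ⟨fun U hU hne => ?_⟩
  obtain ⟨V, hV, rfl⟩ := isOpen_induced_iff.1 hU
  obtain ⟨x, hx⟩ := hne
  have hcl : (x : ℝ) ∈ closure (Ioo (0 : ℝ) 1) := by
    rw [closure_Ioo zero_ne_one]; exact x.2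
  have hpos : 0 < volume (V ∩ Ioo (0 : ℝ) 1) :=
    (hV.inter isOpen_Ioo).measure_pos volume (mem_closure_iff.1 hcl V hV hx)
  have heq : volume (Subtype.val ⁻¹' V : Set I) = volume (Subtype.val '' (Subtype.val ⁻¹' V : Set I)) :=
    comap_subtype_coe_apply measurableSet_Icc volume _
  have hsub : V ∩ Ioo (0 : ℝ) 1 ⊆ Subtype.val '' (Subtype.val ⁻¹' V : Set I) := fun z hz =>
    ⟨⟨z, Ioo_subset_Icc_self hz.2⟩, hz.1, rfl⟩
  rw [heq]
  exact (hpos.trans_le (measure_mono hsub)).ne'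

namespace HyperbolicProblem

variable {n : ℕ} (S : HyperbolicProblem n)

lemma Y0.toL2_injective : Function.Injective (Y0.toL2 S) := fun _ _ hvw =>
  Subtype.ext (funext fun j => ContinuousMap.toLp_injective (p := 2) (𝕜 := ℝ) volume
    (congrFun hvw j))

lemma isClosed_Y0 : IsClosed (S.Y0 : Set (Fin n → C(I, ℝ))) := by
  have : (S.Y0 : Set (Fin n → C(I, ℝ))) =
      ⋂ j, {v | v j (S.inPt j) = ∑ k, S.p j k * v k (S.outPt k)} := by
    ext v; rw [mem_iInter]; rfl
  rw [this]
  have he : ∀ (k : Fin n) (x : I), Continuous fun v : Fin n → C(I, ℝ) => v k x := fun k x =>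
    (continuous_eval_const x).comp (continuous_apply k)
  exact isClosed_iInter fun j => isClosed_eq (he _ _)
    (continuous_finsetSum _ fun k _ => continuous_const.mul (he _ _))

variable {S}

/-- If classical solutions at time `t` are bounded by the `L²` norm of their initial values, then
the generalized solutions belong to `Y₀` at time `t`, as uniform limits of classical solutions. -/
theorem Generates.exists_Y0 {U : ℝ → ℝ → L2n n →L[ℝ] L2n n}
    (hU : S.Generates U) {K τ t : ℝ} (hK : 0 < K) (ht : τ < t)
    (hest : ∀ (u : Fin n → ℝ × ℝ → ℝ) (φ : L2n n), IsNearSolution S τ 0 u →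
      Represents φ (fun j x => u j (x, τ)) → ∀ j, ∀ x ∈ Icc (0 : ℝ) 1, |u j (x, t)| ≤ K * ‖φ‖)
    (φ : L2n n) : ∃ v : S.Y0, Y0.toL2 S v = U t τ φ ∧ ‖v‖ ≤ K * ‖φ‖ := by
  choose f ψ hf hψ hn using fun l : ℕ =>
    exists_testFunction_near φ (by positivity : (0 : ℝ) < 1 / ((l : ℝ) + 1))
  have hψlim : Tendsto ψ atTop (𝓝 φ) := by
    rw [tendsto_iff_norm_sub_tendsto_zero]
    refine squeeze_zero (fun l => norm_nonneg _) (fun l => ?_)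
      tendsto_one_div_add_atTop_nhds_zero_nat
    rw [norm_sub_rev]
    exact (hn l).le
  have hlim : ∀ j, Tendsto (fun l => eLpNorm (fun x : I => φ j x - f l j x) 2 volume) atTop
      (𝓝 0) := fun j => by
    have h1 : Tendsto (fun l => ‖φ j - ψ l j‖) atTop (𝓝 0) := by
      refine squeeze_zero (fun l => norm_nonneg _) (fun l => ?_)
        tendsto_one_div_add_atTop_nhds_zero_nat
      exact (norm_le_pi_norm (φ - ψ l) j).trans (hn l).le
    have h2 := ENNReal.tendsto_ofReal h1
    rw [ENNReal.ofReal_zero] at h2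
    exact h2.congr fun l => ((hψ l).eLpNorm_sub φ j).symm
  -- Only the definition of a generalized solution enters, so the argument applies to every
  -- generated family and not just to the one constructed above.
  obtain ⟨ul, hul, hconv⟩ := (hU.2 τ φ).2 f hf hlim
  have hsol := fun l => (hul l).isNearSolution
  have hψ' : ∀ l, Represents (ψ l) fun j x => ul l j (x, τ) := fun l =>
    (hψ l).congr fun j x hx => ((hul l).initial j x hx).symm
  have hcont : ∀ l j, Continuous fun x : I => ul l j ((x : ℝ), t) := fun l j =>
    ((hsol l).contDiffOn j).continuousOn.comp_continuous (by fun_prop) fun x => ⟨x.2, ht.le⟩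
  let V : ℕ → S.Y0 := fun l => ⟨fun j => ⟨fun x => ul l j ((x : ℝ), t), hcont l j⟩, fun j =>
    (hsol l).boundary j t ht.le⟩
  have hVrep : ∀ l, Represents (Y0.toL2 S (V l)) fun j x => ul l j (x, t) := fun l j =>
    ContinuousMap.coeFn_toLp (p := 2) (𝕜 := ℝ) volume _
  have hVsub : ∀ l l', ‖V l - V l'‖ ≤ K * ‖ψ l - ψ l'‖ := fun l l' => by
    have hs : IsNearSolution S τ 0 (ul l - ul l') := by simpa using (hsol l).sub (hsol l')
    have hb := hest _ _ hs ((hψ' l).sub (hψ' l'))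
    refine (pi_norm_le_iff_of_nonneg (by positivity)).2 fun j => ?_
    exact (ContinuousMap.norm_le _ (by positivity)).2 fun x => hb j x x.2
  have hVn : ∀ l, ‖V l‖ ≤ K * ‖ψ l‖ := fun l => by
    have hb := hest _ _ (hsol l) (hψ' l)
    refine (pi_norm_le_iff_of_nonneg (by positivity)).2 fun j => ?_
    exact (ContinuousMap.norm_le _ (by positivity)).2 fun x => hb j x x.2
  -- Linearity: the supremum estimate for differences turns `L²` convergence of the data into
  -- uniform convergence at time `t`.
  have hcauchy : CauchySeq V := by
    rw [Metric.cauchySeq_iff]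
    intro ε hε
    obtain ⟨N, hN⟩ := Metric.cauchySeq_iff.1 hψlim.cauchySeq (ε / K) (by positivity)
    refine ⟨N, fun l hl l' hl' => ?_⟩
    rw [dist_eq_norm]
    have := hN l hl l' hl'
    rw [dist_eq_norm, lt_div_iff₀' hK] at this
    exact (hVsub l l').trans_lt this
  have : CompleteSpace S.Y0 := S.isClosed_Y0.completeSpace_coe
  obtain ⟨v, hv⟩ := cauchySeq_tendsto_of_complete hcauchy
  refine ⟨v, ?_, le_of_tendsto_of_tendsto' hv.norm (hψlim.norm.const_mul K) hVn⟩
  -- The uniform limit and the generalized solution are `L²` limits of the same sequence.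
  refine tendsto_nhds_unique (((Y0.toL2 S).continuous.tendsto v).comp hv) ?_
  rw [tendsto_pi_nhds]
  intro j
  rw [Metric.tendsto_nhds]
  intro ε hε
  filter_upwards [hconv t ht (ε / 2) (by positivity)] with l hl
  have h1 := hl t ⟨ht.le, le_rfl⟩ j
  rw [(hVrep l).eLpNorm_sub (U t τ φ) j, ENNReal.ofReal_le_ofReal_iff (by positivity)] at h1
  rw [dist_comm, dist_eq_norm]
  exact h1.trans_lt (by linarith)

end HyperbolicProblem

/-- Injectivity of `ι` makes the pointwise lifts unique, hence linear. -/
lemma exists_clm_of_injective {X Y Z : Type*} [NormedAddCommGroup X] [NormedSpace ℝ X]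
    [NormedAddCommGroup Y] [NormedSpace ℝ Y] [NormedAddCommGroup Z] [NormedSpace ℝ Z]
    {ι : Y →L[ℝ] Z} (hι : Function.Injective ι) {A : X →L[ℝ] Z} {K : ℝ}
    (h : ∀ x, ∃ y, ι y = A x ∧ ‖y‖ ≤ K * ‖x‖) : ∃ W : X →L[ℝ] Y, ι.comp W = A := by
  choose w hw hn using h
  refine ⟨LinearMap.mkContinuous ⟨⟨w, fun x y => hι ?_⟩, fun c x => hι ?_⟩ K hn,
    ContinuousLinearMap.ext hw⟩
  · rw [map_add, hw, hw, hw, map_add]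
  · simp only [RingHom.id_apply]
    rw [map_smul, hw, hw, map_smul]

theorem lemma3p3 {n : ℕ} (hn : 2 ≤ n) (S : HyperbolicProblem n) (hm : S.m ≤ n)
    (ha : ∀ j, IsBC1 (S.a j)) (hΛ : S.NonDegenerate)
    (hb : ∀ j k, IsBC1 (S.b j k)) (hCP : S.CPNilpotent) (hLevy : S.LevyCondition) :
    (∃ U, S.Generates U) ∧
    ∀ U, S.Generates U →
      ∃ T₀, IsSmoothingAfter (HyperbolicProblem.Y0.toL2 S) U T₀ ∧
        ∀ α > 0, ∃ K > 0, ∀ (τ : ℝ) (φ : L2n n), ∀ t ∈ Icc (τ + T₀) (τ + T₀ + α),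
          ∃ v : S.Y0, HyperbolicProblem.Y0.toL2 S v = U t τ φ ∧ ‖v‖ ≤ K * ‖φ‖ := by
  obtain ⟨Λ, M, h⟩ := exists_coeffBounds S ha hΛ hb
  obtain ⟨C, c, U₀, hU₀⟩ := h.exists_isPropagator
  refine ⟨⟨U₀, hU₀.generates h⟩, fun U hU => ?_⟩
  obtain ⟨T₀, hT₀, hest⟩ := h.exists_sup_estimate hCP hLevy
  have key : ∀ α > 0, ∃ K > 0, ∀ (τ : ℝ) (φ : L2n n), ∀ t ∈ Icc (τ + T₀) (τ + T₀ + α),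
      ∃ v : S.Y0, HyperbolicProblem.Y0.toL2 S v = U t τ φ ∧ ‖v‖ ≤ K * ‖φ‖ := fun α hα => by
    obtain ⟨K, hK, hb⟩ := hest α hα
    exact ⟨K, hK, fun τ φ t ht => hU.exists_Y0 hK (by linarith [ht.1])
      (fun u φ hu hφ => hb τ u φ hu hφ t ht) φ⟩
  refine ⟨T₀, ⟨hT₀, fun τ t ht => ?_⟩, key⟩
  -- The length is chosen so that `t` lies in the window; the `1` keeps it positive when `t = τ +
  -- T₀`.
  obtain ⟨K, -, hK⟩ := key (t - (τ + T₀) + 1) (by linarith)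
  exact exists_clm_of_injective (HyperbolicProblem.Y0.toL2_injective S) fun φ =>
    hK τ φ t ⟨ht, by linarith⟩
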